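/- Let $N>n\ge 1$ be integers and put $k=(N-n)/2$, $k'=k-N/2=-n/2$, so that $2k\in\mathbb Z$, $0<k<N/2$ and $2n=2N-4k=4|k'|$. **Notation.** For a commutative ring $R$ and units $q^{1/2},t^{1/2}\in R^\times$ let $\mathcal H$ be the double affine Hecke algebra of type $A_1$: it is generated over $R$ by $X^{\pm1},Y^{\pm1},T^{\pm1}$ with the relations $(T-t^{1/2})(T+t^{-1/2})=0$, $TXT=X^{-1}$, $T^{-1}YT^{-1}=Y^{-1}$, $q^{1/2}Y^{-1}X^{-1}YXT^2=1$. It acts in $\mathscr X=R[X^{\pm1}]$: $X$ by multiplication, $T=t^{1/2}s+\frac{t^{1/2}-t^{-1/2}}{X^2-1}(s-1)$ and $Y=\pi T$, where $s(X^m)=X^{-m}$, $\pi(X^m)=q^{m/2}X^{-m}$. For $m\in\mathbb Z$ the nonsymmetric Macdonald polynomial $e_m=X^m+(\text{lower terms})$ over $\mathbb Q(q^{1/2},t^{1/2})$ is defined by $Ye_m=(t^{1/2}q^{|m|/2})^{-\mathrm{sign}(m)}e_m$ with $\mathrm{sign}(0)=-1$; lower terms are combinations of $X^j$ with $|j|<|m|$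 and, if $m<0$, also $X^{|m|}$. At special parameters, $e_m$ denotes its specialization when the coefficients are well defined. If $p=q^{1/4}\in R^\times$, let $\tau_\pm$ be the automorphisms of $\mathcal H$ with $\tau_+(X)=X$, $\tau_+(T)=T$, $\tau_+(Y)=q^{-1/4}XY$ and $\tau_-(Y)=Y$, $\tau_-(T)=T$, $\tau_-(X)=q^{1/4}YX$. An action of the projective $PSL_2(\mathbb Z)$ in an $\mathcal H$-module $V$ is a pair of $\hat\tau_\pm\in GL(V)$ with $\hat\tau_\pm H\hat\tau_\pm^{-1}=\tau_\pm(H)$ for $H\in\mathcal H$ and $\hat\tau_+\hat\tau_-^{-1}\hat\tau_+=\hat\tau_-^{-1}\hat\tau_+\hat\tau_-^{-1}$. Given an involution $*$ of $R$, the standard form in a quotient of $\mathscr X$ having the images of the $e_m$, $-n<m\le n$, as a basis is the form, linear in the first and $*$-linear in the second argument, for which they are pairwise orthogonal and $$\langle e_m,e_m\rangle=\prod_{0<j<|\tilde m|}\frac{(1-q^j)(1-q^jt^2)}{(1-q^jt)^2},$$ where $|\tilde m|=|m|+1$ for $m\le0$ and $|\tilde m|=m$ for $m>0$. Call $q$ *generic*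 if $2$ and $1-q^j$ for $0<j<n$ are invertible in $R$. **(i) The module $V'_{4|k'|}$.** For $q\in\mathbb C^*$ not a root of unity and $t=-q^{k'}=-(q^{1/2})^{-n}$, the polynomial $e_{-n}$ is well defined, and it is the specialization of a unique polynomial with coefficients in $\mathbb Z[q^{\pm1/2}]$. Hence $(e_{-n})$ makes sense for every commutative ring $R$ and all units with $t=-(q^{1/2})^{-n}$, in particular for every $q\in\mathbb C^*$. It is always an $\mathcal H$-submodule of $\mathscr X$. The algebra and $\mathcal H$-module $V'_{4|k'|}=\mathscr X/(e_{-n})$ is free over $R$ with basis $X^m$, $-n<m\le n$, and its formation (algebra and $\mathcal H$-action) commutes with every base change $R\to S$. So the $V'_{4|k'|}$ form a flat family over the space of parameters. **(ii) Roots of unity.** Let $R$ be an integral domain of characteristic $0$, $q^{1/2}\in R$ a primitive $(2N)$-th root of unity and $t=(q^{1/2})^{2k}$. Then $t=-(q^{1/2})^{2k'}$, the polynomial $e_{-n}$ is well defined at $(q,t)$ with coefficients in $R$, the ideal $(e_{-n})$ is an $\mathcal H$-submodule, and $V_{2N-4k}=\mathscr X/(e_{-n})$, of rank $2N-4k$,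 is isomorphic to $V'_{4|k'|}$ as an algebra and as an $\mathcal H$-module. If $R$ is a field, then $q$ is generic, $V'_{4|k'|}$ is the unique irreducible $\mathcal H$-module quotient of $\mathscr X/(X^{2N}+X^{-2N}-2)$ if $k\in\mathbb Z$ and of $\mathscr X/(X^N+X^{-N})$ if $k\in\frac12+\mathbb Z$, and (given any involution of the field) the standard form exists in $V_{2N-4k}$, is unique, and is that of $V'_{4|k'|}$. **(iii) The structures of $V'_{4|k'|}$ for generic $q$.** Let $t=-(q^{1/2})^{-n}$ and let $q$ be generic. If $R$ is a field, $V'_{4|k'|}$ is irreducible. If $R$ is an integral domain, then the $e_m$, $-n<m\le n$, are well defined and their images form a basis of $V'_{4|k'|}$; $X$ and $Y$ each have a basis of eigenvectors; if $q^{1/4}\in R$, an action of the projective $PSL_2(\mathbb Z)$ in $V'_{4|k'|}$ exists, and any two differ by $(\hat\tau_+,\hat\tau_-)\mapsto(c\hat\tau_+,c^{-1}\hat\tau_-)$ with $c\in R^\times$. If moreover $*$ is an involution of $R$ with $(q^{1/2})^*=q^{-1/2}$, $(t^{1/2})^*=t^{-1/2}$, the standard form exists, is unique and Hermitian, and $\langle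 Hf,g\rangle=\langle f,H^{-1}g\rangle$ for $H=X,Y,T$. Under a homomorphism $R\to S$ (for forms: of integral domains, compatible with involutions) every action of the projective $PSL_2(\mathbb Z)$ in $V'_{4|k'|}$ over $R$ specializes to one over $S$, and the standard form specializes to the standard form. By (ii), the structures of $V'_{4|k'|}$ thus deform those of $V_{2N-4k}$. **(iv) Positivity.** Let $q=e^{i\varphi}$ with $\varphi\in\mathbb R$, $|\varphi|\le 2\pi/N$, and $q\neq1$ unless $n=1$. Let $q^{1/2}$ be a square root of $q$ with $(q^{1/2})^n=e^{in\varphi/2}$ (for instance $q^{1/2}=e^{i\varphi/2}$), and $t=-(q^{1/2})^{-n}=-e^{i k'\varphi}$. Then the standard form in $V'_{4|k'|}$ over $\mathbb C$ is positive definite. -/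

import Mathlib

open scoped LaurentPolynomial

noncomputable section

namespace DahaA1

/-! ### The double affine Hecke algebra of type `A₁`

Throughout `r` stands for `q^{1/2}`, `u` for `t^{1/2}` and `p` for `q^{1/4}`. -/

/-- The generators `X^{±1}, Y^{±1}, T^{±1}`. -/
inductive Gen
  | X | Xi | Y | Yi | T | Ti

section Algebra

variable {R : Type*} [CommRing R]

local notation "ι" => FreeAlgebra.ι R

/-- The defining relations of the double affine Hecke algebra. -/
inductive Rel (r u : Rˣ) : FreeAlgebra R Gen → FreeAlgebra R Gen → Prop
  | X_Xi : Rel r u (ι Gen.X * ι Gen.Xi) 1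
  | Xi_X : Rel r u (ι Gen.Xi * ι Gen.X) 1
  | Y_Yi : Rel r u (ι Gen.Y * ι Gen.Yi) 1
  | Yi_Y : Rel r u (ι Gen.Yi * ι Gen.Y) 1
  | T_Ti : Rel r u (ι Gen.T * ι Gen.Ti) 1
  | Ti_T : Rel r u (ι Gen.Ti * ι Gen.T) 1
  | quad : Rel r u
      ((ι Gen.T - algebraMap R _ (u : R)) * (ι Gen.T + algebraMap R _ ((u⁻¹ : Rˣ) : R))) 0
  | TXT : Rel r u (ι Gen.T * ι Gen.X * ι Gen.T) (ι Gen.Xi)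
  | TYT : Rel r u (ι Gen.Ti * ι Gen.Y * ι Gen.Ti) (ι Gen.Yi)
  | comm : Rel r u
      ((r : R) • (ι Gen.Yi * ι Gen.Xi * ι Gen.Y * ι Gen.X * ι Gen.T * ι Gen.T)) 1

/-- The double affine Hecke algebra with parameters `q^{1/2} = r`, `t^{1/2} = u` over `R`. -/
abbrev Daha (r u : Rˣ) : Type _ := RingQuot (Rel r u)

/-- The image of a generator. -/
def gen (r u : Rˣ) (g : Gen) : Daha r u := RingQuot.mkAlgHom R (Rel r u) (ι g)

theorem rel_of (r u : Rˣ) {a b : FreeAlgebra R Gen} (h : Rel r u a b) :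
    RingQuot.mkAlgHom R (Rel r u) a = RingQuot.mkAlgHom R (Rel r u) b :=
  RingQuot.mkAlgHom_rel R h

/-- An algebra homomorphism out of the double affine Hecke algebra, given by operators that
satisfy the defining relations. -/
def liftHom {A : Type*} [Ring A] [Algebra R A] (r u : Rˣ) (X Xi Y Yi T Ti : A)
    (hX : X * Xi = 1) (hX' : Xi * X = 1) (hY : Y * Yi = 1) (hY' : Yi * Y = 1)
    (hT : T * Ti = 1) (hT' : Ti * T = 1)
    (hq : (T - algebraMap R A (u : R)) * (T + algebraMap R A ((u⁻¹ : Rˣ) : R)) = 0)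
    (hTX : T * X * T = Xi) (hTY : Ti * Y * Ti = Yi)
    (hc : (r : R) • (Yi * Xi * Y * X * T * T) = 1) : Daha r u →ₐ[R] A :=
  RingQuot.liftAlgHom R
    ⟨FreeAlgebra.lift R (fun g => match g with
      | Gen.X => X | Gen.Xi => Xi | Gen.Y => Y | Gen.Yi => Yi | Gen.T => T | Gen.Ti => Ti), by
      intro a b h
      cases h <;> simpa using by assumption⟩

/-- The defining relations, read in the algebra. -/
theorem gen_rels (r u : Rˣ) :
    gen r u Gen.X * gen r u Gen.Xi = 1 ∧ gen r u Gen.Xi * gen r u Gen.X = 1 ∧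
    gen r u Gen.Y * gen r u Gen.Yi = 1 ∧ gen r u Gen.Yi * gen r u Gen.Y = 1 ∧
    gen r u Gen.T * gen r u Gen.Ti = 1 ∧ gen r u Gen.Ti * gen r u Gen.T = 1 ∧
    (gen r u Gen.T - algebraMap R _ (u : R)) *
      (gen r u Gen.T + algebraMap R _ ((u⁻¹ : Rˣ) : R)) = 0 ∧
    gen r u Gen.T * gen r u Gen.X * gen r u Gen.T = gen r u Gen.Xi ∧
    gen r u Gen.Ti * gen r u Gen.Y * gen r u Gen.Ti = gen r u Gen.Yi ∧
    (r : R) • (gen r u Gen.Yi * gen r u Gen.Xi * gen r u Gen.Y * gen r u Gen.X *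
      gen r u Gen.T * gen r u Gen.T) = 1 := by
  refine ⟨?_, ?_, ?_, ?_, ?_, ?_, ?_, ?_, ?_, ?_⟩
  · simpa [gen] using rel_of r u Rel.X_Xi
  · simpa [gen] using rel_of r u Rel.Xi_X
  · simpa [gen] using rel_of r u Rel.Y_Yi
  · simpa [gen] using rel_of r u Rel.Yi_Y
  · simpa [gen] using rel_of r u Rel.T_Ti
  · simpa [gen] using rel_of r u Rel.Ti_T
  · simpa [gen] using rel_of r u Rel.quad
  · simpa [gen] using rel_of r u Rel.TXT
  · simpa [gen] using rel_of r u Rel.TYT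
  · simpa [gen] using rel_of r u Rel.comm

end Algebra

section Automorphisms

variable {R : Type*} [CommRing R]

theorem comm_aux {A : Type*} [Ring A] [Algebra R A] (r : Rˣ) (X Xi Y Yi T : A)
    (hX : X * Xi = 1) (hY : Y * Yi = 1)
    (hc : (r : R) • (Yi * Xi * Y * X * T * T) = 1) :
    (r : R) • (Y * X * T * T) = X * Y := by
  have h : X * Y * ((r : R) • (Yi * Xi * Y * X * T * T)) = X * Y := by rw [hc, mul_one]
  rw [← h, mul_smul_comm]
  congr 1
  have : X * Y * (Yi * Xi * Y * X * T * T) = X * (Y * Yi) * Xi * Y * X * T * T := by noncomm_ring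
  rw [this, hY, mul_one, hX, one_mul]

theorem sq_aux {p r : Rˣ} (hp : p ^ 2 = r) : ((p⁻¹ : Rˣ) : R) * (r : R) = p := by
  rw [← hp, ← Units.val_mul]
  congr 1
  group

/-- The automorphism `τ₊`: `X ↦ X`, `T ↦ T`, `Y ↦ q^{-1/4} X Y`. -/
def tauPlus (p r u : Rˣ) (hp : p ^ 2 = r) : Daha r u →ₐ[R] Daha r u :=
  liftHom r u (gen r u Gen.X) (gen r u Gen.Xi)
    (((p⁻¹ : Rˣ) : R) • (gen r u Gen.X * gen r u Gen.Y))
    ((p : R) • (gen r u Gen.Yi * gen r u Gen.Xi)) (gen r u Gen.T) (gen r u Gen.Ti)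
    (gen_rels r u).1 (gen_rels r u).2.1
    (by
      obtain ⟨hX, hX', hY, hY', -⟩ := gen_rels r u
      rw [smul_mul_smul_comm, Units.inv_mul, one_smul, mul_assoc, ← mul_assoc (gen r u Gen.Y), hY,
        one_mul, hX])
    (by
      obtain ⟨hX, hX', hY, hY', -⟩ := gen_rels r u
      rw [smul_mul_smul_comm, Units.mul_inv, one_smul, mul_assoc, ← mul_assoc (gen r u Gen.Xi),
        hX', one_mul, hY'])
    (gen_rels r u).2.2.2.2.1 (gen_rels r u).2.2.2.2.2.1 (gen_rels r u).2.2.2.2.2.2.1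
    (gen_rels r u).2.2.2.2.2.2.2.1
    (by
      obtain ⟨hX, hX', hY, hY', hT, hT', -, hTX, hTY, hc⟩ := gen_rels r u
      have hc' := comm_aux r _ _ _ _ _ hX hY hc
      generalize gen r u Gen.X = X at *
      generalize gen r u Gen.Xi = Xi at *
      generalize gen r u Gen.Y = Y at *
      generalize gen r u Gen.Yi = Yi at *
      generalize gen r u Gen.T = T at *
      generalize gen r u Gen.Ti = Ti at *
      have h : Ti * (Y * X * T * T) * Ti = Yi * Xi := by
        calc Ti * (Y * X * T * T) * Ti = Ti * Y * 1 * X * T * (T * Ti) := by noncomm_ring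
          _ = (Ti * Y * Ti) * (T * X * T) := by 
              rw [hT]
              calc Ti * Y * 1 * X * T * 1 = Ti * Y * (Ti * T) * X * T := by rw [hT', mul_one]
                _ = _ := by noncomm_ring
          _ = Yi * Xi := by rw [hTY, hTX]
      rw [← hc', smul_smul, mul_smul_comm, smul_mul_assoc, h, sq_aux hp])
    (by
      obtain ⟨hX, hX', hY, hY', hT, hT', -, hTX, hTY, hc⟩ := gen_rels r u
      generalize gen r u Gen.X = X at *
      generalize gen r u Gen.Xi = Xi at *
      generalize gen r u Gen.Y = Y at *
      generalize gen r u Gen.Yi = Yi at *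
      generalize gen r u Gen.T = T at *
      rw [← hc]
      congr 1
      simp only [smul_mul_assoc, mul_smul_comm, smul_smul, Units.inv_mul, one_smul]
      calc Yi * Xi * Xi * (X * Y) * X * T * T = Yi * Xi * (Xi * X) * Y * X * T * T := by
            noncomm_ring
        _ = _ := by rw [hX', mul_one])

/-- The automorphism `τ₋`: `Y ↦ Y`, `T ↦ T`, `X ↦ q^{1/4} Y X`. -/
def tauMinus (p r u : Rˣ) (hp : p ^ 2 = r) : Daha r u →ₐ[R] Daha r u :=
  liftHom r u ((p : R) • (gen r u Gen.Y * gen r u Gen.X))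
    (((p⁻¹ : Rˣ) : R) • (gen r u Gen.Xi * gen r u Gen.Yi))
    (gen r u Gen.Y) (gen r u Gen.Yi) (gen r u Gen.T) (gen r u Gen.Ti)
    (by
      obtain ⟨hX, hX', hY, hY', -⟩ := gen_rels r u
      rw [smul_mul_smul_comm, Units.mul_inv, one_smul, mul_assoc, ← mul_assoc (gen r u Gen.X), hX,
        one_mul, hY])
    (by
      obtain ⟨hX, hX', hY, hY', -⟩ := gen_rels r u
      rw [smul_mul_smul_comm, Units.inv_mul, one_smul, mul_assoc, ← mul_assoc (gen r u Gen.Yi),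
        hY', one_mul, hX'])
    (gen_rels r u).2.2.1 (gen_rels r u).2.2.2.1
    (gen_rels r u).2.2.2.2.1 (gen_rels r u).2.2.2.2.2.1 (gen_rels r u).2.2.2.2.2.2.1
    (by
      obtain ⟨hX, hX', hY, hY', hT, hT', -, hTX, hTY, hc⟩ := gen_rels r u
      have hc' := comm_aux r _ _ _ _ _ hX hY hc
      generalize gen r u Gen.X = X at *
      generalize gen r u Gen.Xi = Xi at *
      generalize gen r u Gen.Y = Y at *
      generalize gen r u Gen.Yi = Yi at *
      generalize gen r u Gen.T = T at *
      generalize gen r u Gen.Ti = Ti at *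
      have h : (r : R) • (T * (Y * X) * T) = Xi * Yi := by
        calc (r : R) • (T * (Y * X) * T) = (r : R) • (T * (Y * X) * T * 1) := by rw [mul_one]
          _ = T * ((r : R) • (Y * X * T * T)) * Ti := by
              rw [← hT, mul_smul_comm, smul_mul_assoc]
              congr 1
              noncomm_ring
          _ = T * X * 1 * Y * Ti := by rw [hc']; noncomm_ring
          _ = (T * X * T) * (Ti * Y * Ti) := by rw [← hT]; noncomm_ring
          _ = Xi * Yi := by rw [hTY, hTX]
      rw [← h, smul_smul, mul_smul_comm, smul_mul_assoc, sq_aux hp])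
    (gen_rels r u).2.2.2.2.2.2.2.2.1
    (by
      obtain ⟨hX, hX', hY, hY', hT, hT', -, hTX, hTY, hc⟩ := gen_rels r u
      generalize gen r u Gen.X = X at *
      generalize gen r u Gen.Xi = Xi at *
      generalize gen r u Gen.Y = Y at *
      generalize gen r u Gen.Yi = Yi at *
      generalize gen r u Gen.T = T at *
      rw [← hc]
      congr 1
      simp only [smul_mul_assoc, mul_smul_comm, smul_smul, Units.mul_inv, one_smul]
      calc Yi * (Xi * Yi) * Y * (Y * X) * T * T = Yi * Xi * (Yi * Y) * Y * X * T * T := by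
            noncomm_ring
        _ = _ := by rw [hY', mul_one])

end Automorphisms

/-! ### The polynomial representation -/

section Polynomial

variable {R : Type*} [CommRing R]

open LaurentPolynomial

/-- The reflection `s (X^n) = X^{-n}`. -/
def opS : R[T;T⁻¹] →ₐ[R] R[T;T⁻¹] := (invert (R := R)).toAlgHom

theorem T_mul_T (a b : ℤ) : (T a * T b : R[T;T⁻¹]) = T (a + b) := (T_add a b).symm

/-- The unit `X⁻¹`. -/
def unitXi : (R[T;T⁻¹])ˣ where
  val := T (-1)
  inv := T 1
  val_inv := by rw [T_mul_T, neg_add_cancel, T_zero]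
  inv_val := by rw [T_mul_T, add_neg_cancel, T_zero]

/-- The involution `π (X^n) = q^{n/2} X^{-n}`, i.e. the substitution `X ↦ q^{1/2} X⁻¹`. -/
def opPi (r : Rˣ) : R[T;T⁻¹] →ₐ[R] R[T;T⁻¹] where
  __ := eval₂ C (Units.map (C (R := R)).toMonoidHom r * unitXi)
  commutes' _ := eval₂_C _ _ _

theorem unitXi_zpow (n : ℤ) : ((unitXi ^ n : (R[T;T⁻¹])ˣ) : R[T;T⁻¹]) = T (-n) := by
  induction n with
  | zero => rw [zpow_zero, Units.val_one, neg_zero, T_zero]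
  | succ n ih =>
    rw [zpow_add_one, Units.val_mul, ih]
    change T _ * T (-1) = _
    rw [T_mul_T]; congr 1; ring
  | pred n ih =>
    rw [zpow_sub_one, Units.val_mul, ih]
    change T _ * T 1 = _
    rw [T_mul_T]; congr 1; ring

theorem opS_T (n : ℤ) : opS (T n : R[T;T⁻¹]) = T (-n) := invert_T n

theorem opS_opS (f : R[T;T⁻¹]) : opS (opS f) = f := involutive_invert f

theorem opPi_T (r : Rˣ) (n : ℤ) :
    opPi r (T n) = C (((r ^ n : Rˣ)) : R) * T (-n) := by
  change eval₂ C _ (T n) = _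
  rw [eval₂_T, mul_zpow, Units.val_mul, unitXi_zpow, ← map_zpow]
  rfl

theorem opPi_opPi (r : Rˣ) (f : R[T;T⁻¹]) : opPi r (opPi r f) = f := by
  induction f using LaurentPolynomial.induction_on' with
  | add p q hp hq => rw [map_add, map_add, hp, hq]
  | C_mul_T n a =>
    have hC (c : R) : opPi r (C c) = C c := (opPi r).commutes c
    rw [map_mul, map_mul, hC, hC, opPi_T, map_mul, hC, opPi_T, neg_neg]
    congr 1
    rw [← mul_assoc, ← map_mul, ← Units.val_mul, ← zpow_add, add_neg_cancel, zpow_zero,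
      Units.val_one, map_one, one_mul]

theorem coeff_aux (g : R[T;T⁻¹]) (m : ℤ) :
    ((T 2 - 1) * g).coeff m = g.coeff (m - 2) - g.coeff m := by
  have h : (T 2 * g).coeff m = g.coeff (m - 2) := by
    have := AddMonoidAlgebra.coeff_single_mul_eq_mul_coeff (r := (1 : R)) (m := (2 : ℤ)) (x := g)
      (m₁ := m) (m - 2) (fun a _ => by constructor <;> intro h <;> linarith)
    rw [one_mul] at this
    exact this
  rw [sub_mul, one_mul, AddMonoidAlgebra.coeff_sub, Finsupp.sub_apply, h]

theorem regular_aux {g : R[T;T⁻¹]} (h : (T 2 - 1) * g = 0) : g = 0 := by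
  by_contra hg
  have hne : g.coeff.support.Nonempty := by
    rw [Finsupp.support_nonempty_iff]
    intro h0
    exact hg (LaurentPolynomial.ext fun a => by simp [h0])
  have hM := g.coeff.support.max'_mem hne
  set M := g.coeff.support.max' hne with hMdef
  have h2 : g.coeff (M + 2) = 0 := by
    by_contra h2
    have := g.coeff.support.le_max' (M + 2) (Finsupp.mem_support_iff.mpr h2)
    omega
  have h3 := coeff_aux g (M + 2)
  rw [h, h2, add_sub_cancel_right, sub_zero] at h3
  exact (Finsupp.mem_support_iff.mp hM) (by simpa using h3.symm)

theorem cancel_aux {f g : R[T;T⁻¹]} (h : (T 2 - 1) * f = (T 2 - 1) * g) : f = g :=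
  sub_eq_zero.mp (regular_aux (by rw [mul_sub, h, sub_self]))

theorem dvd_aux (n : ℕ) : (T 2 - 1 : R[T;T⁻¹]) ∣ T n - T (-n) := by
  have h : (T n - T (-n) : R[T;T⁻¹]) = T (-n) * (T 2 ^ n - 1 ^ n) := by
    rw [one_pow, T_pow, mul_sub, ← T_add, mul_one]
    congr 2
    ring
  rw [h]
  exact Dvd.dvd.mul_left (sub_dvd_pow_sub_pow _ _ _) _

theorem exists_demazure (f : R[T;T⁻¹]) : ∃ g, (T 2 - 1) * g = opS f - f := by
  suffices h : (T 2 - 1 : R[T;T⁻¹]) ∣ opS f - f by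
    obtain ⟨g, hg⟩ := h
    exact ⟨g, hg.symm⟩
  induction f using LaurentPolynomial.induction_on' with
  | add p q hp hq =>
    rw [map_add, add_sub_add_comm]
    exact dvd_add hp hq
  | C_mul_T n a =>
    have h : opS (C a * T n) - C a * T n = C a * (T (-n) - T n) := by
      rw [map_mul, opS_T, mul_sub]
      congr 2
      exact invert_C a
    rw [h]
    refine Dvd.dvd.mul_left ?_ _
    obtain ⟨k, rfl | rfl⟩ := n.eq_nat_or_neg
    · rw [← neg_sub (T (k : ℤ)), dvd_neg]
      exact dvd_aux k
    · rw [neg_neg]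
      exact dvd_aux k

/-- The Demazure operator `(X^2 - 1)^{-1} ∘ (s - 1)`: the unique `g` such that
`(X^2 - 1) g = s f - f`. -/
def demazure : R[T;T⁻¹] →ₗ[R] R[T;T⁻¹] where
  toFun f := (exists_demazure f).choose
  map_add' f g := by
    apply cancel_aux
    rw [mul_add, (exists_demazure f).choose_spec, (exists_demazure g).choose_spec,
      (exists_demazure (f + g)).choose_spec, map_add]
    ring
  map_smul' c f := by
    apply cancel_aux
    rw [RingHom.id_apply, mul_smul_comm, (exists_demazure f).choose_spec,
      (exists_demazure (c • f)).choose_spec, map_smul, smul_sub]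

theorem demazure_spec (f : R[T;T⁻¹]) : (T 2 - 1) * demazure f = opS f - f :=
  (exists_demazure f).choose_spec

theorem opS_demazure (f : R[T;T⁻¹]) : opS (demazure f) = T 2 * demazure f := by
  have h := congrArg opS (demazure_spec f)
  rw [map_mul, map_sub, map_sub, map_one, opS_T, opS_opS] at h
  apply cancel_aux
  have h1 : (T 2 * T (-2) : R[T;T⁻¹]) = 1 := by rw [T_mul_T, add_neg_cancel, T_zero]
  have h2 := demazure_spec f
  linear_combination (-T 2) * h + (opS (demazure f)) * h1 - T 2 * h2

theorem demazure_opS (f : R[T;T⁻¹]) : demazure (opS f) = - demazure f := by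
  apply cancel_aux
  rw [demazure_spec, opS_opS, mul_neg, demazure_spec]
  ring

theorem demazure_demazure (f : R[T;T⁻¹]) : demazure (demazure f) = demazure f := by
  apply cancel_aux
  rw [demazure_spec, opS_demazure]
  ring

theorem demazure_mul_X (f : R[T;T⁻¹]) :
    demazure (T 1 * f) = T (-1) * demazure f - T (-1) * f := by
  apply cancel_aux
  have h1 : (T 2 * T (-1) : R[T;T⁻¹]) = T 1 := by rw [T_mul_T]; rfl
  rw [demazure_spec, map_mul, opS_T]
  linear_combination (-T (-1)) * demazure_spec f + f * h1

/-- The operator `T = t^{1/2} s + (t^{1/2} - t^{-1/2}) (X^2 - 1)^{-1} ∘ (s - 1)`. -/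
def opT (u : Rˣ) : R[T;T⁻¹] →ₗ[R] R[T;T⁻¹] :=
  (u : R) • opS.toLinearMap + ((u : R) - ((u⁻¹ : Rˣ) : R)) • demazure

/-- The inverse of `opT`, by the quadratic relation. -/
def opTi (u : Rˣ) : R[T;T⁻¹] →ₗ[R] R[T;T⁻¹] :=
  opT u - ((u : R) - ((u⁻¹ : Rˣ) : R)) • LinearMap.id

/-- Multiplication by `X^n`. -/
def opX (n : ℤ) : R[T;T⁻¹] →ₗ[R] R[T;T⁻¹] := LinearMap.mulLeft R (T n)

/-- The operator `Y = π T`. -/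
def opY (r u : Rˣ) : R[T;T⁻¹] →ₗ[R] R[T;T⁻¹] := (opPi r).toLinearMap ∘ₗ opT u

/-- The inverse of `opY`. -/
def opYi (r u : Rˣ) : R[T;T⁻¹] →ₗ[R] R[T;T⁻¹] := opTi u ∘ₗ (opPi r).toLinearMap

theorem opT_apply (u : Rˣ) (f : R[T;T⁻¹]) :
    opT u f = C (u : R) * opS f + (C (u : R) - C ((u⁻¹ : Rˣ) : R)) * demazure f := by
  simp [opT, smul_eq_C_mul, sub_mul]

theorem opTi_apply (u : Rˣ) (f : R[T;T⁻¹]) :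
    opTi u f = opT u f - (C (u : R) - C ((u⁻¹ : Rˣ) : R)) * f := by
  simp [opTi, smul_eq_C_mul, sub_mul]

theorem C_unit_aux (u : Rˣ) : (C (u : R) * C ((u⁻¹ : Rˣ) : R) : R[T;T⁻¹]) = 1 := by
  rw [← map_mul, Units.mul_inv, map_one]

theorem opS_C (c : R) : opS (C c : R[T;T⁻¹]) = C c := invert_C c

theorem opT_C_mul (u : Rˣ) (c : R) (f : R[T;T⁻¹]) : opT u (C c * f) = C c * opT u f := by
  rw [← smul_eq_C_mul, map_smul, smul_eq_C_mul]

theorem opT_opT (u : Rˣ) (f : R[T;T⁻¹]) :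
    opT u (opT u f) = (C (u : R) - C ((u⁻¹ : Rˣ) : R)) * opT u f + f := by
  have hD : demazure (opT u f) = (C (u : R) - C ((u⁻¹ : Rˣ) : R)) * demazure f
      - C (u : R) * demazure f := by
    rw [opT, LinearMap.add_apply, map_add, LinearMap.smul_apply, LinearMap.smul_apply, map_smul,
      map_smul, demazure_demazure]
    change (u : R) • demazure (opS f) + _ = _
    rw [demazure_opS, smul_eq_C_mul, smul_eq_C_mul, map_sub]
    ring
  rw [opT_apply u (opT u f), hD, opT_apply u f]
  simp only [map_add, map_mul, map_sub, opS_C, opS_opS, opS_demazure]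
  have h1 := C_unit_aux u
  have h2 := demazure_spec f
  linear_combination (C (u : R) * (C (u : R) - C ((u⁻¹ : Rˣ) : R))) * h2 + f * h1

theorem opT_opTi (u : Rˣ) (f : R[T;T⁻¹]) : opT u (opTi u f) = f := by
  rw [opTi_apply, map_sub, opT_opT, ← map_sub, opT_C_mul]
  ring

theorem opTi_opT (u : Rˣ) (f : R[T;T⁻¹]) : opTi u (opT u f) = f := by
  rw [opTi_apply, opT_opT]
  ring

theorem opT_X_opT (u : Rˣ) (f : R[T;T⁻¹]) :
    opT u (T 1 * opT u f) = T (-1) * f := by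
  rw [opT_apply u (T 1 * opT u f), demazure_mul_X, map_mul, opS_T]
  have h : C (u : R) * opS (opT u f) + (C (u : R) - C ((u⁻¹ : Rˣ) : R)) * demazure (opT u f)
      = (C (u : R) - C ((u⁻¹ : Rˣ) : R)) * opT u f + f := by
    rw [← opT_apply, opT_opT]
  linear_combination T (-1) * h

theorem rep_comm (r u : Rˣ) (f : R[T;T⁻¹]) :
    (r : R) • opTi u (opPi r (T (-1) * opPi r (opT u (T 1 * opT u (opT u f))))) = f := by
  rw [opT_X_opT, map_mul (opPi r) (T (-1)) (opT u f), opPi_T, neg_neg, zpow_neg_one]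
  have h : T (-1) * (C ((r⁻¹ : Rˣ) : R) * T 1 * opPi r (opT u f))
      = ((r⁻¹ : Rˣ) : R) • opPi r (opT u f) := by
    have h1 : (T (-1) * T 1 : R[T;T⁻¹]) = 1 := by rw [T_mul_T, neg_add_cancel, T_zero]
    rw [smul_eq_C_mul]
    linear_combination (C ((r⁻¹ : Rˣ) : R) * opPi r (opT u f)) * h1
  rw [h, map_smul, map_smul, opPi_opPi, opTi_opT, smul_smul, Units.mul_inv, one_smul]

theorem rep_quad (u : Rˣ) (f : R[T;T⁻¹]) :
    opT u (opT u f + ((u⁻¹ : Rˣ) : R) • f) - (u : R) • (opT u f + ((u⁻¹ : Rˣ) : R) • f) = 0 := by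
  rw [map_add, map_smul, opT_opT]
  simp only [smul_eq_C_mul]
  linear_combination (-f) * C_unit_aux u

/-- The polynomial representation `X ↦ X`, `T ↦ opT`, `Y ↦ opY` in `R[X^{±1}]`. -/
def polyRep (r u : Rˣ) : Daha r u →ₐ[R] Module.End R R[T;T⁻¹] :=
  liftHom r u (opX 1) (opX (-1)) (opY r u) (opYi r u) (opT u) (opTi u)
    (LinearMap.ext fun f => by
      change T 1 * (T (-1) * f) = f
      rw [← mul_assoc, T_mul_T, add_neg_cancel, T_zero, one_mul])
    (LinearMap.ext fun f => by
      change T (-1) * (T 1 * f) = f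
      rw [← mul_assoc, T_mul_T, neg_add_cancel, T_zero, one_mul])
    (LinearMap.ext fun f => by simp [opY, opYi, opT_opTi, opPi_opPi])
    (LinearMap.ext fun f => by simp [opY, opYi, opTi_opT, opPi_opPi])
    (LinearMap.ext fun f => by simp [opT_opTi])
    (LinearMap.ext fun f => by simp [opTi_opT])
    (LinearMap.ext fun f => by
      simp only [Module.End.mul_apply, LinearMap.sub_apply, LinearMap.add_apply,
        Module.algebraMap_end_apply, LinearMap.zero_apply]
      exact rep_quad u f)
    (LinearMap.ext fun f => opT_X_opT u f)
    (LinearMap.ext fun f => by simp [opY, opYi, opT_opTi])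
    (LinearMap.ext fun f => by
      simp only [LinearMap.smul_apply, Module.End.mul_apply, Module.End.one_apply, opY, opYi, opX,
        LinearMap.comp_apply, LinearMap.mulLeft_apply, AlgHom.toLinearMap_apply]
      exact rep_comm r u f)

end Polynomial

/-! ### Nonsymmetric Macdonald polynomials -/

section Macdonald

open LaurentPolynomial

/-- The eigenvalue `(t^{1/2} q^{|m|/2})^{-sign m}`, where `sign 0 = -1`. -/
def eigenY {R : Type*} [CommRing R] (r u : Rˣ) (m : ℤ) : Rˣ :=
  if 0 < m then (u * r ^ m.natAbs)⁻¹ else u * r ^ m.natAbs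

/-- `f = X^m + lower terms` and `Y f = (t^{1/2} q^{|m|/2})^{-sign m} f`, where the lower terms are
combinations of `X^j` with `|j| < |m|` and, if `m < 0`, also of `X^{|m|}`. -/
def IsMacdonald {R : Type*} [CommRing R] (r u : Rˣ) (m : ℤ) (f : R[T;T⁻¹]) : Prop :=
  opY r u f = (eigenY r u m : R) • f ∧ f.coeff m = 1 ∧
    ∀ j, f.coeff j ≠ 0 → j = m ∨ |j| < |m| ∨ (m < 0 ∧ j = |m|)

/-- Polynomials in `q^{1/2}` and `t^{1/2}`. -/
abbrev ParamRing : Type := MvPolynomial (Fin 2) ℤ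

/-- The field `ℚ(q^{1/2}, t^{1/2})` of rational functions in the generic parameters. -/
abbrev GenField : Type := FractionRing ParamRing

/-- The generic `q^{1/2}` (for `i = 0`) and the generic `t^{1/2}` (for `i = 1`). -/
def genParam (i : Fin 2) : GenFieldˣ :=
  Units.mk0 (algebraMap ParamRing GenField (MvPolynomial.X i)) (by
    rw [Ne, FaithfulSMul.algebraMap_eq_zero_iff]
    exact MvPolynomial.X_ne_zero i)

/-- `x` is the value of the rational function `a` at `q^{1/2} = r`, `t^{1/2} = u`: there is a
presentation `a = P / Q` with `Q (r, u) ≠ 0` and `x = P (r, u) / Q (r, u)`. -/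
def IsValue {R : Type*} [CommRing R] (r u : Rˣ) (a : GenField) (x : R) : Prop :=
  ∃ P Q : ParamRing, MvPolynomial.aeval ![(r : R), (u : R)] Q ≠ 0 ∧
    a * algebraMap ParamRing GenField Q = algebraMap ParamRing GenField P ∧
    x * MvPolynomial.aeval ![(r : R), (u : R)] Q = MvPolynomial.aeval ![(r : R), (u : R)] P

/-- `f` is the nonsymmetric Macdonald polynomial `e_m` at the parameters `q^{1/2} = r`,
`t^{1/2} = u` of an integral domain: the coefficients of the generic `e_m` are well defined at
`(r, u)` and `f` is its specialization. -/
def IsEPoly {R : Type*} [CommRing R] (r u : Rˣ) (m : ℤ) (f : R[T;T⁻¹]) : Prop :=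
  ∃ g : GenField[T;T⁻¹], IsMacdonald (genParam 0) (genParam 1) m g ∧
    ∀ j, IsValue r u (g.coeff j) (f.coeff j)

/-- Substitution of `r` for `q^{1/2}` in the coefficients of a Laurent polynomial over
`ℤ[q^{±1/2}]`. -/
def evalCoeffs {R : Type*} [CommRing R] (E : ℤ[T;T⁻¹][T;T⁻¹]) (r : Rˣ) : R[T;T⁻¹] :=
  AddMonoidAlgebra.mapRingHom ℤ (eval₂ (Int.castRingHom R) r) E

/-- `E`, with coefficients in `ℤ[q^{±1/2}]`, is `e_{-n}` at `t = -q^{-n/2}` for all `q` that are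
not roots of unity. -/
def IsSpecialE (n : ℕ) (E : ℤ[T;T⁻¹][T;T⁻¹]) : Prop :=
  ∀ r u : ℂˣ, (∀ j : ℕ, 0 < j → r ^ j ≠ 1) → u ^ 2 * r ^ n = -1 →
    IsEPoly r u (-(n : ℤ)) (evalCoeffs E r)

end Macdonald

/-! ### Quotients of the polynomial representation -/

section Quotients

open LaurentPolynomial

variable {R : Type*} [CommRing R]

/-- The ideal `I` of `R[X^{±1}]` is a submodule for the double affine Hecke algebra. -/
def IsStable (r u : Rˣ) (I : Ideal R[T;T⁻¹]) : Prop :=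
  ∀ h : Daha r u, ∀ f ∈ I, polyRep r u h f ∈ I

/-- The operator on `R[X^{±1}] / I` induced by an operator that preserves `I`. -/
def quotOp (I : Ideal R[T;T⁻¹]) (φ : Module.End R R[T;T⁻¹]) (h : ∀ f ∈ I, φ f ∈ I) :
    Module.End R (R[T;T⁻¹] ⧸ I) :=
  Submodule.mapQ (I.restrictScalars R) (I.restrictScalars R) φ h

theorem quotOp_mk (I : Ideal R[T;T⁻¹]) (φ : Module.End R R[T;T⁻¹]) (h : ∀ f ∈ I, φ f ∈ I)
    (f : R[T;T⁻¹]) : quotOp I φ h (Ideal.Quotient.mk I f) = Ideal.Quotient.mk I (φ f) := rfl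

theorem quotOp_ext (I : Ideal R[T;T⁻¹]) (φ : Module.End R R[T;T⁻¹]) (h : ∀ f ∈ I, φ f ∈ I)
    (ψ : Module.End R (R[T;T⁻¹] ⧸ I))
    (hψ : ∀ f, Ideal.Quotient.mk I (φ f) = ψ (Ideal.Quotient.mk I f)) : quotOp I φ h = ψ := by
  refine LinearMap.ext fun x => ?_
  obtain ⟨f, rfl⟩ := Ideal.Quotient.mk_surjective x
  rw [quotOp_mk, hψ]

/-- The module `R[X^{±1}] / I` over the double affine Hecke algebra. -/
def quotRep (r u : Rˣ) (I : Ideal R[T;T⁻¹]) (hI : IsStable r u I) :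
    Daha r u →ₐ[R] Module.End R (R[T;T⁻¹] ⧸ I) where
  toFun h := quotOp I (polyRep r u h) (hI h)
  map_one' := quotOp_ext I _ _ _ fun f => by rw [map_one]; rfl
  map_mul' a b := quotOp_ext I _ _ _ fun f => by rw [map_mul]; rfl
  map_zero' := quotOp_ext I _ _ _ fun f => by rw [map_zero]; rfl
  map_add' a b := quotOp_ext I _ _ _ fun f => by rw [map_add]; rfl
  commutes' c := quotOp_ext I _ _ _ fun f => by rw [AlgHom.commutes]; rfl

/-- The ideal generated by the specialization of `E` at `q^{1/2} = r`. -/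
def idealE (E : ℤ[T;T⁻¹][T;T⁻¹]) (r : Rˣ) : Ideal R[T;T⁻¹] := Ideal.span {evalCoeffs E r}

/-- The algebra `R[X^{±1}] / (E)`, which is `V'_{2n}` if `E` is the special `e_{-n}`. -/
abbrev VPrime (E : ℤ[T;T⁻¹][T;T⁻¹]) (r : Rˣ) : Type _ := R[T;T⁻¹] ⧸ idealE E r

/-- The image of a unit parameter under a change of the base ring. -/
abbrev baseUnit (S : Type*) [CommRing S] [Algebra R S] (r : Rˣ) : Sˣ :=
  Units.map (algebraMap R S).toMonoidHom r

theorem eval₂_baseUnit (S : Type*) [CommRing S] [Algebra R S] (r : Rˣ) (f : ℤ[T;T⁻¹]) :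
    algebraMap R S (eval₂ (Int.castRingHom R) r f)
      = eval₂ (Int.castRingHom S) (baseUnit S r) f := by
  induction f using LaurentPolynomial.induction_on' with
  | add p q hp hq => rw [map_add, map_add, map_add, hp, hq]
  | C_mul_T n a =>
    rw [eval₂_C_mul_T, eval₂_C_mul_T, map_mul, ← map_zpow]
    congr 1
    exact map_intCast _ a

/-- The specialization homomorphism `V'` over `R` to `V'` over an `R`-algebra `S`. -/
def specMap (S : Type*) [CommRing S] [Algebra R S] (E : ℤ[T;T⁻¹][T;T⁻¹]) (r : Rˣ) :
    VPrime E r →ₐ[R] VPrime E (baseUnit S r) :=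
  Ideal.quotientMapₐ _ (AddMonoidAlgebra.mapAlgHom ℤ (Algebra.ofId R S)) (by
    rw [idealE, Ideal.span_singleton_le_iff_mem, Ideal.mem_comap]
    have h : AddMonoidAlgebra.mapAlgHom ℤ (Algebra.ofId R S) (evalCoeffs E r)
        = evalCoeffs E (baseUnit S r) := by
      change (AddMonoidAlgebra.mapRingHom ℤ (algebraMap R S)) (AddMonoidAlgebra.mapRingHom ℤ _ E)
        = AddMonoidAlgebra.mapRingHom ℤ _ E
      rw [← RingHom.comp_apply, ← AddMonoidAlgebra.mapRingHom_comp]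
      congr 2
      exact RingHom.ext fun f => eval₂_baseUnit S r f
    rw [h]
    exact Ideal.subset_span rfl)

/-- A module over the double affine Hecke algebra over a field is irreducible. -/
def IsIrreducibleRep {K : Type*} [Field K] {r u : Kˣ} {V : Type*} [AddCommGroup V] [Module K V]
    (ρ : Daha r u →ₐ[K] Module.End K V) : Prop :=
  Nontrivial V ∧ ∀ W : Submodule K V, (∀ h, ∀ w ∈ W, ρ h w ∈ W) → W = ⊥ ∨ W = ⊤

/-- An operator that has a basis of eigenvectors. -/
def IsDiagonalizable {V : Type*} [AddCommGroup V] [Module R V] (φ : Module.End R V) : Prop :=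
  ∃ (κ : Type) (b : Module.Basis κ R V) (c : κ → R), ∀ i, φ (b i) = c i • b i

/-- An action of the projective `PSL₂(ℤ)` (the group generated by `τ₊`, `τ₋` subject to
`τ₊ τ₋⁻¹ τ₊ = τ₋⁻¹ τ₊ τ₋⁻¹`) on a module, compatible with its action by automorphisms of the
double affine Hecke algebra. -/
structure IsPSLAction {p r u : Rˣ} (hp : p ^ 2 = r) {V : Type*} [AddCommGroup V] [Module R V]
    (ρ : Daha r u →ₐ[R] Module.End R V) (τp τm : V ≃ₗ[R] V) : Prop where
  plus : ∀ h v, τp (ρ h v) = ρ (tauPlus p r u hp h) (τp v)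
  minus : ∀ h v, τm (ρ h v) = ρ (tauMinus p r u hp h) (τm v)
  braid : ∀ v, τp (τm.symm (τp v)) = τm.symm (τp (τm.symm v))

/-- The number `|m| + 1` for `m ≤ 0` and `|m|` for `m > 0`. -/
def tildeAbs (m : ℤ) : ℕ := if 0 < m then m.natAbs else m.natAbs + 1

/-- The numerator `∏ (1 - q^j) (1 - q^j t²)`, `0 < j < |m̃|`, of the norm of `e_m`. -/
def normNum (r u : Rˣ) (m : ℤ) : R :=
  ∏ j ∈ Finset.Ico 1 (tildeAbs m),
    (1 - (r : R) ^ (2 * j)) * (1 - (r : R) ^ (2 * j) * (u : R) ^ 4)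

/-- The denominator `∏ (1 - q^j t)²`, `0 < j < |m̃|`, of the norm of `e_m`. -/
def normDen (r u : Rˣ) (m : ℤ) : R :=
  ∏ j ∈ Finset.Ico 1 (tildeAbs m), (1 - (r : R) ^ (2 * j) * (u : R) ^ 2) ^ 2

/-- The form on `R[X^{±1}] / I` for which the images of the `e_m`, `-n < m ≤ n`, are pairwise
orthogonal with `⟨e_m, e_m⟩ = ∏ (1 - q^j) (1 - q^j t²) / (1 - q^j t)²`, `0 < j < |m̃|`. It is linear
in the first and conjugate-linear in the second argument. -/
def IsStdForm [StarRing R] (r u : Rˣ) (n : ℕ) (I : Ideal R[T;T⁻¹])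
    (B : (R[T;T⁻¹] ⧸ I) →ₗ[R] (R[T;T⁻¹] ⧸ I) →ₗ⋆[R] R) : Prop :=
  ∀ m ∈ Set.Ioc (-(n : ℤ)) n, ∀ m' ∈ Set.Ioc (-(n : ℤ)) n, ∀ e e' : R[T;T⁻¹],
    IsEPoly r u m e → IsEPoly r u m' e' →
      B (Ideal.Quotient.mk I e) (Ideal.Quotient.mk I e') * normDen r u m
        = if m = m' then normNum r u m else 0

/-- `2` and `1 - q^j`, `0 < j < n`, are invertible. -/
def IsGeneric (n : ℕ) (r : Rˣ) : Prop :=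
  IsUnit (2 : R) ∧ ∀ j : ℕ, 0 < j → j < n → IsUnit (1 - (r : R) ^ (2 * j))

end Quotients

end DahaA1

end

noncomputable section

namespace DahaA1

open LaurentPolynomial

/-! ### Coefficients of Laurent polynomials -/

section Coefficients

variable {R : Type*} [CommRing R]

/-! Write `r = q^{1/2}` and `u = t^{1/2}`, so that `u² rⁿ = -1`. Everything rests on a product
formula: `e_{-n}` becomes `E = r⁻ⁿ ∏ (X + r^{2j-n} X⁻¹)`, `1 ≤ j ≤ n` (`polyE`). The exponents `2j -
n` are symmetric about `1`, hence `π` fixes `E` (`opPi_polyE`). Without the factor `j = n` they are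
symmetric about `0`, so the remaining product is `s`-invariant (`opS_symE`) and commutes with `T`.
The last factor `X + rⁿX⁻¹` is, up to a unit, the coefficient in `T = u + (uX² - u⁻¹)D`, where `D`
is the Demazure operator (`opT_eq`, `quad_factor`). Thus `E` is an eigenvector of `T` and `Y`, and
`(E)` is stable over every ring (`isStable_polyE`). Both extreme coefficients of `E` are units, so
the quotient is free on `2n` consecutive monomials and commutes with base change. If `2 ≠ 0` and no
`r^{2j}` with `0 < j ≤ n` is `1`, the eigenvalue of `E` is separated from those of the lower terms
and the intertwiner denominators do not vanish, so `E` is the specialized Macdonald polynomial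
(`isEPoly_polyE`). Evaluation at one transcendental `r` shows that its lift to `ℤ[q^{±1/2}]` is
unique.

For generic `q` the roots of `E` are `2n` points `x_m`, inverse to the eigenvalues of `Y`, with
invertible differences, so `V'` is the space of functions on them (`evEquiv`). There `X` is
diagonal, `π` exchanges `m` and `1 - m`, and `T` mixes `m` with `-m`, except that it is the scalar
`u` at the ends `m = 0, n`. Walking along the chain `0, 1, -1, 2, …, n` gives irreducibility
(`Vanishes.all`). Dually, the `e_m` built by intertwiners form a basis diagonalizing `Y`, where `Xπ`
exchanges `e_m` and `e_{1-m}` and `T` mixes `e_m` with `e_{-m}`; that the end `e_n` is an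
eigenvector of `T` is `exists_quotRep_T_vE_top`. The Gaussian `u^{|m|} q^{m²/4}` is even and has a
functional equation under `m ↦ 1 - m` (`gauss_one_sub`). Multiplication by it realizes `τ₊`, and its
inverse, acting diagonally on the `e_m`, realizes `τ₋`. The two sides of the braid relation induce
the same automorphism, so by Schur's lemma (`exists_unit_of_commute`) they differ by a scalar, which
is absorbed into `τ₊`. The standard form is diagonal in the `e_m`; its invariance is checked for
`Y`, `T` and `Xπ`, and `X = (Xπ) T Y⁻¹`.

At a root of unity `r^N = -1` turns `t = q^k` into `-q^{k'}`, so the quotient by `e_{-n}` is `V'`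
itself. For uniqueness of the irreducible quotient, every point where a proper stable ideal
containing the central relation vanishes can be moved to a root of `E`. Positivity holds because
each factor of a norm is `2 sin a sin b / (1 + cos (a - b))` with `a`, `b` of the same sign and
absolute value less than `π`. -/

theorem coeff_T_mul (k : ℤ) (f : R[T;T⁻¹]) (m : ℤ) : (T k * f).coeff m = f.coeff (m - k) := by
  have h := AddMonoidAlgebra.coeff_single_mul_apply f (1 : R) k m
  rw [one_mul, neg_add_eq_sub] at h
  exact h

theorem coeff_C_mul (c : R) (f : R[T;T⁻¹]) (m : ℤ) : (C c * f).coeff m = c * f.coeff m := by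
  rw [← smul_eq_C_mul]; rfl

theorem coeff_opS (f : R[T;T⁻¹]) (m : ℤ) : (opS f).coeff m = f.coeff (-m) := invert_apply f m

theorem opPi_C (r : Rˣ) (c : R) : opPi r (C c) = C c := (opPi r).commutes c

theorem coeff_opPi (r : Rˣ) (f : R[T;T⁻¹]) (m : ℤ) :
    (opPi r f).coeff m = ((r ^ (-m) : Rˣ) : R) * f.coeff (-m) := by
  induction f using LaurentPolynomial.induction_on' with
  | add p q hp hq =>
    rw [map_add, AddMonoidAlgebra.coeff_add, Finsupp.add_apply, hp, hq,
      AddMonoidAlgebra.coeff_add, Finsupp.add_apply, mul_add]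
  | C_mul_T n a =>
    rw [map_mul, opPi_C, opPi_T, coeff_C_mul, coeff_C_mul, coeff_C_mul, T_apply, T_apply]
    by_cases h : n = -m
    · subst h; simp; ring
    · rw [if_neg h, if_neg (by omega)]; simp

/-- All the exponents of `f` lie between `a` and `b`. -/
def SuppIn (f : R[T;T⁻¹]) (a b : ℤ) : Prop := ∀ j, f.coeff j ≠ 0 → a ≤ j ∧ j ≤ b

theorem SuppIn.coeff_eq_zero {f : R[T;T⁻¹]} {a b j : ℤ} (h : SuppIn f a b)
    (hj : j < a ∨ b < j) : f.coeff j = 0 := by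
  by_contra h0
  have := h j h0
  omega

theorem SuppIn.mono {f : R[T;T⁻¹]} {a b a' b' : ℤ} (h : SuppIn f a b) (ha : a' ≤ a)
    (hb : b ≤ b') : SuppIn f a' b' := fun j hj => by
  have := h j hj
  omega

theorem suppIn_T (k : ℤ) : SuppIn (T k : R[T;T⁻¹]) k k := fun j hj => by
  rw [T_apply] at hj
  by_cases h : k = j
  · omega
  · simp [h] at hj

theorem SuppIn.add {f g : R[T;T⁻¹]} {a b : ℤ} (hf : SuppIn f a b) (hg : SuppIn g a b) :
    SuppIn (f + g) a b := fun j hj => by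
  by_contra h
  rw [AddMonoidAlgebra.coeff_add, Finsupp.add_apply, hf.coeff_eq_zero (by omega),
    hg.coeff_eq_zero (by omega), add_zero] at hj
  exact hj rfl

theorem SuppIn.C_mul {f : R[T;T⁻¹]} {a b : ℤ} (hf : SuppIn f a b) (c : R) :
    SuppIn (C c * f) a b := fun j hj => hf j fun h => hj (by rw [coeff_C_mul, h, mul_zero])

theorem SuppIn.T_mul {f : R[T;T⁻¹]} {a b : ℤ} (hf : SuppIn f a b) (k : ℤ) :
    SuppIn (T k * f) (a + k) (b + k) := fun j hj => by
  rw [coeff_T_mul] at hj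
  have := hf _ hj
  omega

theorem SuppIn.opPi {f : R[T;T⁻¹]} {a b : ℤ} (hf : SuppIn f a b) (r : Rˣ) :
    SuppIn (opPi r f) (-b) (-a) := fun j hj => by
  rw [coeff_opPi] at hj
  have := hf _ (right_ne_zero_of_mul hj)
  omega

theorem SuppIn.opS {f : R[T;T⁻¹]} {a b : ℤ} (hf : SuppIn f a b) :
    SuppIn (opS f) (-b) (-a) := fun j hj => by
  rw [coeff_opS] at hj
  have := hf _ hj
  omega

theorem SuppIn.mul {f g : R[T;T⁻¹]} {a b a' b' : ℤ} (hf : SuppIn f a b) (hg : SuppIn g a' b') :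
    SuppIn (f * g) (a + a') (b + b') := fun j hj => by
  have h := AddMonoidAlgebra.support_coeff_mul_subset f g (Finsupp.mem_support_iff.mpr hj)
  rw [Finset.mem_add] at h
  obtain ⟨i, hi, k, hk, rfl⟩ := h
  have h1 := hf i (Finsupp.mem_support_iff.mp hi)
  have h2 := hg k (Finsupp.mem_support_iff.mp hk)
  omega

/-- The pair of lowest exponents is the only one with its sum, so no assumption on zero divisors is
needed. -/
theorem coeff_mul_low {f g : R[T;T⁻¹]} {a b a' b' : ℤ} (hf : SuppIn f a b)
    (hg : SuppIn g a' b') : (f * g).coeff (a + a') = f.coeff a * g.coeff a' := by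
  refine AddMonoidAlgebra.coeff_mul_add_of_uniqueAdd fun i k hi hk h => ?_
  have h1 := hf i (Finsupp.mem_support_iff.mp hi)
  have h2 := hg k (Finsupp.mem_support_iff.mp hk)
  omega

theorem coeff_mul_high {f g : R[T;T⁻¹]} {a b a' b' : ℤ} (hf : SuppIn f a b)
    (hg : SuppIn g a' b') : (f * g).coeff (b + b') = f.coeff b * g.coeff b' := by
  refine AddMonoidAlgebra.coeff_mul_add_of_uniqueAdd fun i k hi hk h => ?_
  have h1 := hf i (Finsupp.mem_support_iff.mp hi)
  have h2 := hg k (Finsupp.mem_support_iff.mp hk)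
  omega

/-- The exact range of exponents of a nonzero Laurent polynomial. -/
theorem exists_suppIn {f : R[T;T⁻¹]} (hf : f ≠ 0) :
    ∃ a b, SuppIn f a b ∧ f.coeff a ≠ 0 ∧ f.coeff b ≠ 0 := by
  have hne : f.coeff.support.Nonempty := by
    rw [Finsupp.support_nonempty_iff]
    intro h0
    exact hf (LaurentPolynomial.ext fun a => by simp [h0])
  exact ⟨_, _, fun j hj => ⟨f.coeff.support.min'_le j (Finsupp.mem_support_iff.mpr hj),
    f.coeff.support.le_max' j (Finsupp.mem_support_iff.mpr hj)⟩,
    Finsupp.mem_support_iff.mp (f.coeff.support.min'_mem hne),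
    Finsupp.mem_support_iff.mp (f.coeff.support.max'_mem hne)⟩

theorem coeff_demazure (f : R[T;T⁻¹]) (m : ℤ) :
    (demazure f).coeff (m - 2) - (demazure f).coeff m = f.coeff (-m) - f.coeff m := by
  rw [← coeff_aux, demazure_spec, AddMonoidAlgebra.coeff_sub, Finsupp.sub_apply, coeff_opS]

/-- In the recursion `coeff_demazure`, taken at the lowest exponent of the image or two above the
highest one, only one term survives on the left. Such an exponent must therefore come from a term of
`f`. -/
theorem SuppIn.demazure {f : R[T;T⁻¹]} {M : ℤ} (hf : SuppIn f (-M) M) :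
    SuppIn (demazure f) (-M) (M - 2) := by
  by_cases h0 : DahaA1.demazure f = 0
  · intro j hj
    rw [h0] at hj
    exact absurd rfl hj
  obtain ⟨a, b, hab, ha, hb⟩ := exists_suppIn h0
  have h1 : -M ≤ a := by
    by_contra h
    have := coeff_demazure f a
    rw [hab.coeff_eq_zero (j := a - 2) (by omega), hf.coeff_eq_zero (j := a) (by omega),
      hf.coeff_eq_zero (j := -a) (by omega)] at this
    exact ha (by linear_combination -this)
  have h2 : b ≤ M - 2 := by
    by_contra h
    have := coeff_demazure f (b + 2)
    rw [hab.coeff_eq_zero (j := b + 2) (by omega), hf.coeff_eq_zero (j := b + 2) (by omega),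
      hf.coeff_eq_zero (j := -(b + 2)) (by omega), add_sub_cancel_right] at this
    exact hb (by linear_combination this)
  exact hab.mono h1 h2

theorem coeff_opT (u : Rˣ) (f : R[T;T⁻¹]) (m : ℤ) :
    (opT u f).coeff m = u * f.coeff (-m) + (u - ((u⁻¹ : Rˣ) : R)) * (demazure f).coeff m := by
  rw [opT_apply, ← map_sub, AddMonoidAlgebra.coeff_add, Finsupp.add_apply, coeff_C_mul,
    coeff_C_mul, coeff_opS]

theorem SuppIn.opT {f : R[T;T⁻¹]} {M : ℤ} (hf : SuppIn f (-M) M) (u : Rˣ) :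
    SuppIn (opT u f) (-M) M := by
  rw [opT_apply, ← map_sub]
  refine ((hf.opS.mono (by omega) (by omega)).C_mul _).add ((hf.demazure.mono le_rfl ?_).C_mul _)
  omega

theorem coeff_opT_high {f : R[T;T⁻¹]} {M : ℤ} (hf : SuppIn f (-M) M) (u : Rˣ) :
    (opT u f).coeff M = u * f.coeff (-M) := by
  rw [coeff_opT, hf.demazure.coeff_eq_zero (by omega), mul_zero, add_zero]

theorem coeff_opT_low {f : R[T;T⁻¹]} {M : ℤ} (hf : SuppIn f (-M) M) (u : Rˣ) :
    (opT u f).coeff (-M) =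
      ((u⁻¹ : Rˣ) : R) * f.coeff M + (u - ((u⁻¹ : Rˣ) : R)) * f.coeff (-M) := by
  have h := coeff_demazure f (-M)
  rw [hf.demazure.coeff_eq_zero (j := -M - 2) (by omega), neg_neg] at h
  rw [coeff_opT, neg_neg]
  linear_combination (-((u : R) - ((u⁻¹ : Rˣ) : R))) * h

/-- `Y` is triangular for the order in which `X^{-M}` follows `X^M`. The two extreme coefficients
are the only ones needed to read off eigenvalues. -/
theorem coeff_opY_low {f : R[T;T⁻¹]} {M : ℤ} (hf : SuppIn f (-M) M) (r u : Rˣ) :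
    (opY r u f).coeff (-M) = ((u * r ^ M : Rˣ) : R) * f.coeff (-M) := by
  change (DahaA1.opPi r (DahaA1.opT u f)).coeff (-M) = _
  rw [coeff_opPi, neg_neg, coeff_opT_high hf, Units.val_mul]
  ring

theorem coeff_opY_high {f : R[T;T⁻¹]} {M : ℤ} (hf : SuppIn f (-M) M) (h0 : f.coeff (-M) = 0)
    (r u : Rˣ) : (opY r u f).coeff M = (((u * r ^ M)⁻¹ : Rˣ) : R) * f.coeff M := by
  change (DahaA1.opPi r (DahaA1.opT u f)).coeff M = _
  rw [coeff_opPi, coeff_opT_low hf, h0, mul_zero, add_zero, mul_inv, Units.val_mul, zpow_neg]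
  ring

end Coefficients

/-! ### Change of the base ring -/

section Map

variable {R S : Type*} [CommRing R] [CommRing S] (φ : R →+* S)

/-- The map on Laurent polynomials induced by a ring homomorphism on the coefficients. -/
abbrev mapL : R[T;T⁻¹] →+* S[T;T⁻¹] := AddMonoidAlgebra.mapRingHom ℤ φ

/-- The image of a unit. -/
abbrev mapU : Rˣ →* Sˣ := Units.map φ.toMonoidHom

theorem coeff_mapL (f : R[T;T⁻¹]) (m : ℤ) : (mapL φ f).coeff m = φ (f.coeff m) :=
  AddMonoidAlgebra.coeff_mapRingHom φ f m

theorem mapL_T (m : ℤ) : mapL φ (T m) = T m := by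
  refine LaurentPolynomial.ext fun j => ?_
  rw [coeff_mapL, T_apply, T_apply]
  split_ifs <;> simp

theorem mapL_C (c : R) : mapL φ (C c) = C (φ c) := by
  refine LaurentPolynomial.ext fun j => ?_
  rw [coeff_mapL, C_apply, C_apply]
  split_ifs <;> simp

theorem mapL_injective (h : Function.Injective φ) : Function.Injective (mapL φ) :=
  fun f g hfg => LaurentPolynomial.ext fun j => h <| by rw [← coeff_mapL, hfg, coeff_mapL]

theorem mapL_opS (f : R[T;T⁻¹]) : mapL φ (opS f) = opS (mapL φ f) :=
  LaurentPolynomial.ext fun j => by rw [coeff_mapL, coeff_opS, coeff_opS, coeff_mapL]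

theorem mapL_opPi (r : Rˣ) (f : R[T;T⁻¹]) :
    mapL φ (opPi r f) = opPi (mapU φ r) (mapL φ f) :=
  LaurentPolynomial.ext fun j => by
    rw [coeff_mapL, coeff_opPi, coeff_opPi, coeff_mapL, map_mul, ← map_zpow]; rfl

theorem mapL_demazure (f : R[T;T⁻¹]) : mapL φ (demazure f) = demazure (mapL φ f) := by
  apply cancel_aux
  rw [demazure_spec, ← mapL_opS, ← map_sub, ← demazure_spec, map_mul, map_sub, map_one, mapL_T]

theorem mapL_opT (u : Rˣ) (f : R[T;T⁻¹]) : mapL φ (opT u f) = opT (mapU φ u) (mapL φ f) := by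
  rw [opT_apply, opT_apply, map_add, map_mul, map_mul, map_sub, mapL_C, mapL_C, mapL_opS,
    mapL_demazure]
  rfl

end Map

/-! ### Nonsymmetric Macdonald polynomials by intertwiners -/

section Intertwiners

variable {R : Type*} [CommRing R]

/-- The denominator `1 - q^k t`. -/
def denomD (r u : Rˣ) (k : ℕ) : R := 1 - (r : R) ^ (2 * k) * (u : R) ^ 2

/-- The coefficient `(t^{1/2} - t^{-1/2}) / (q^k t - 1)` of the intertwiner. -/
def coefA (r u : Rˣ) (k : ℕ) : R :=
  -((u : R) - ((u⁻¹ : Rˣ) : R)) * Ring.inverse (denomD r u k)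

theorem coefA_mul {r u : Rˣ} {k : ℕ} (h : IsUnit (denomD r u k)) :
    coefA r u k * denomD r u k = -((u : R) - ((u⁻¹ : Rˣ) : R)) := by
  rw [coefA, mul_assoc, Ring.inverse_mul_cancel _ h, mul_one]

/-- The polynomials `e_{-k}`. -/
def eNeg (r u : Rˣ) : ℕ → R[T;T⁻¹]
  | 0 => 1
  | k + 1 => C (u : R) * (opT u (C ((r : R) ^ k) * (T 1 * opPi r (eNeg r u k))) +
      C (coefA r u (k + 1)) * (C ((r : R) ^ k) * (T 1 * opPi r (eNeg r u k))))

/-- The polynomials `e_{k + 1}`. -/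
def ePos (r u : Rˣ) (k : ℕ) : R[T;T⁻¹] := C ((r : R) ^ k) * (T 1 * opPi r (eNeg r u k))

theorem eNeg_zero (r u : Rˣ) : eNeg r u 0 = 1 := rfl

theorem eNeg_succ (r u : Rˣ) (k : ℕ) : eNeg r u (k + 1) =
    C (u : R) * (opT u (ePos r u k) + C (coefA r u (k + 1)) * ePos r u k) := rfl

/-- The nonsymmetric Macdonald polynomials. -/
def eMac (r u : Rˣ) (m : ℤ) : R[T;T⁻¹] :=
  if 0 < m then ePos r u (m.natAbs - 1) else eNeg r u m.natAbs

theorem eMac_neg (r u : Rˣ) (k : ℕ) : eMac r u (-k) = eNeg r u k := by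
  rw [eMac, if_neg (by omega), Int.natAbs_neg, Int.natAbs_natCast]

theorem eMac_pos (r u : Rˣ) (k : ℕ) : eMac r u (k + 1) = ePos r u k := by
  rw [eMac, if_pos (by omega)]
  congr 1

theorem eigenY_neg (r u : Rˣ) (k : ℕ) : eigenY r u (-k) = u * r ^ k := by
  rw [eigenY, if_neg (by omega), Int.natAbs_neg, Int.natAbs_natCast]

theorem eigenY_pos (r u : Rˣ) (k : ℕ) : eigenY r u (k + 1) = (u * r ^ (k + 1))⁻¹ := by
  rw [eigenY, if_pos (by omega)]
  congr 1

theorem tildeAbs_neg (k : ℕ) : tildeAbs (-k) = k + 1 := by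
  rw [tildeAbs, if_neg (by omega), Int.natAbs_neg, Int.natAbs_natCast]

theorem tildeAbs_pos (k : ℕ) : tildeAbs (k + 1) = k + 1 := by
  rw [tildeAbs, if_pos (by omega)]
  rfl

theorem int_cases_neg_pos (m : ℤ) : (∃ k : ℕ, m = -k) ∨ ∃ k : ℕ, m = k + 1 := by
  rcases le_or_gt m 0 with h | h
  · exact Or.inl ⟨m.natAbs, by omega⟩
  · exact Or.inr ⟨m.natAbs - 1, by omega⟩

theorem opPi_C_mul (r : Rˣ) (c : R) (f : R[T;T⁻¹]) : opPi r (C c * f) = C c * opPi r f := by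
  rw [map_mul, opPi_C]

theorem opY_eq (r u : Rˣ) (f : R[T;T⁻¹]) : opY r u f = opPi r (opT u f) := rfl

theorem opT_eq_of_eigen {r u : Rˣ} {f : R[T;T⁻¹]} {c : Rˣ} (h : opY r u f = (c : R) • f) :
    opT u f = C (c : R) * opPi r f := by
  rw [opY_eq, smul_eq_C_mul] at h
  rw [← opPi_C_mul, ← h, opPi_opPi]

theorem opPi_eq_of_eigen {r u : Rˣ} {f : R[T;T⁻¹]} {c : Rˣ} (h : opY r u f = (c : R) • f) :
    opPi r f = C ((c⁻¹ : Rˣ) : R) * opT u f := by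
  rw [opT_eq_of_eigen h]
  linear_combination (-opPi r f) * C_unit_aux c

/-- The intertwiner `X π` inverts the eigenvalues of `q^{1/4} Y`. -/
theorem opY_X_opPi {r u : Rˣ} {f : R[T;T⁻¹]} {c : Rˣ} (h : opY r u f = (c : R) • f) :
    opY r u (T 1 * opPi r f) = (((c * r)⁻¹ : Rˣ) : R) • (T 1 * opPi r f) := by
  have h1 : opT u (T 1 * opPi r f) = C ((c⁻¹ : Rˣ) : R) * (T (-1) * f) := by
    rw [opPi_eq_of_eigen h, mul_left_comm, opT_C_mul, opT_X_opT]
  rw [opY_eq, h1, opPi_C_mul, map_mul, opPi_T, neg_neg, smul_eq_C_mul, mul_inv, Units.val_mul,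
    map_mul, zpow_neg_one]
  ring

/-- On an eigenvector of `Y`, applying `T` gives a vector with the inverse eigenvalue up to a
multiple of the original one, which is what the intertwiner corrects. -/
theorem opY_opT {r u : Rˣ} {f : R[T;T⁻¹]} {c : Rˣ} (h : opY r u f = (c : R) • f) :
    opY r u (opT u f) = C ((c⁻¹ : Rˣ) : R) * opT u f +
      (C (u : R) - C ((u⁻¹ : Rˣ) : R)) * C (c : R) * f := by
  have h1 : opPi r (opT u f) = C (c : R) * f := by rw [← opY_eq, h, smul_eq_C_mul]
  rw [opY_eq, opT_opT, map_add, map_mul, map_sub, opPi_C, opPi_C, h1, opPi_eq_of_eigen h]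
  ring

theorem opY_intertwine {r u : Rˣ} {f : R[T;T⁻¹]} {c : Rˣ} {a : R}
    (h : opY r u f = (c : R) • f)
    (ha : ((u : R) - ((u⁻¹ : Rˣ) : R)) * c + a * c = ((c⁻¹ : Rˣ) : R) * a) :
    opY r u (opT u f + C a * f) = ((c⁻¹ : Rˣ) : R) • (opT u f + C a * f) := by
  have ha' := congrArg (C : R → R[T;T⁻¹]) ha
  simp only [map_add, map_mul, map_sub] at ha'
  rw [map_add, opY_opT h, ← smul_eq_C_mul a, map_smul, h]
  simp only [smul_eq_C_mul]
  linear_combination f * ha'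

theorem suppIn_one : SuppIn (1 : R[T;T⁻¹]) 0 0 := by
  rw [← T_zero]
  exact suppIn_T 0

theorem SuppIn.ePos {r u : Rˣ} {k : ℕ} (h : SuppIn (eNeg r u k) (-k) k) :
    SuppIn (ePos r u k) (-k + 1) (k + 1) := by
  have h1 := (((h.opPi r).T_mul 1).C_mul ((r : R) ^ k))
  rw [neg_neg] at h1
  exact h1

theorem SuppIn.eNeg (r u : Rˣ) (k : ℕ) : SuppIn (eNeg r u k) (-k) k := by
  induction k with
  | zero => exact suppIn_one.mono (by simp) (by simp)
  | succ k ih =>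
    have h := ih.ePos.mono (a' := -((k + 1 : ℕ) : ℤ)) (b' := ((k + 1 : ℕ) : ℤ)) (by push_cast; omega)
      (by push_cast; omega)
    exact ((h.opT u).add (h.C_mul _)).C_mul _

theorem coeff_ePos {r u : Rˣ} {k : ℕ} (h : (eNeg r u k).coeff (-k) = 1) :
    (ePos r u k).coeff (k + 1) = 1 := by
  rw [ePos, coeff_C_mul, coeff_T_mul, coeff_opPi, add_sub_cancel_right, h, mul_one, zpow_neg,
    zpow_natCast, ← Units.val_pow_eq_pow_val, Units.mul_inv]

theorem coeff_eNeg (r u : Rˣ) (k : ℕ) : (eNeg r u k).coeff (-k) = 1 := by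
  induction k with
  | zero =>
    rw [eNeg_zero, ← T_zero, T_apply]
    simp
  | succ k ih =>
    have h := (SuppIn.eNeg r u k).ePos
    have h' := h.mono (a' := -((k + 1 : ℕ) : ℤ)) (b' := ((k + 1 : ℕ) : ℤ)) (by push_cast; omega)
      (by push_cast; omega)
    have h2 : (DahaA1.ePos r u k).coeff ((k + 1 : ℕ) : ℤ) = 1 := by
      push_cast
      exact coeff_ePos ih
    rw [eNeg_succ, coeff_C_mul, AddMonoidAlgebra.coeff_add, Finsupp.add_apply, coeff_C_mul,
      coeff_opT_low h', h2, h.coeff_eq_zero (by push_cast; omega), mul_zero, mul_zero, add_zero,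
      add_zero, mul_one, Units.mul_inv]

theorem opY_ePos {r u : Rˣ} {k : ℕ} (h : opY r u (eNeg r u k) = ((u * r ^ k : Rˣ) : R) • eNeg r u k) :
    opY r u (ePos r u k) = (((u * r ^ (k + 1))⁻¹ : Rˣ) : R) • ePos r u k := by
  rw [ePos, ← smul_eq_C_mul, map_smul, opY_X_opPi h, smul_comm, mul_assoc, ← pow_succ]

theorem opY_eNeg {r u : Rˣ} {k : ℕ} (hD : ∀ j, 1 ≤ j → j ≤ k → IsUnit (denomD r u j)) :
    opY r u (eNeg r u k) = ((u * r ^ k : Rˣ) : R) • eNeg r u k := by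
  induction k with
  | zero =>
    have h : demazure (1 : R[T;T⁻¹]) = 0 := by
      apply cancel_aux
      rw [demazure_spec, map_one, sub_self, mul_zero]
    rw [eNeg_zero, opY_eq, opT_apply, h, mul_zero, add_zero, map_one, mul_one, opPi_C, pow_zero,
      mul_one, smul_eq_C_mul, mul_one]
  | succ k ih =>
    have h := opY_ePos (ih fun j h1 h2 => hD j h1 (by omega))
    have h2 := coefA_mul (hD (k + 1) (by omega) le_rfl)
    -- The condition on `coefA` is its defining equation multiplied by the eigenvalue of `e_{k+1}`.
    have h3 : opY r u _ = _ := opY_intertwine (a := coefA r u (k + 1)) h (by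
      have h4 := Units.mul_inv (u * r ^ (k + 1))
      rw [inv_inv]
      generalize (((u * r ^ (k + 1))⁻¹ : Rˣ) : R) = w at *
      rw [denomD, pow_mul'] at h2
      simp only [Units.val_mul, Units.val_pow_eq_pow_val] at h4 ⊢
      linear_combination w * h2 + (coefA r u (k + 1) * (u * r ^ (k + 1))) * h4)
    rw [eNeg_succ, ← smul_eq_C_mul, map_smul, h3, inv_inv, smul_comm]

/-- The polynomials constructed by intertwiners are nonsymmetric Macdonald polynomials. -/
theorem isMacdonald_eMac {r u : Rˣ} {m : ℤ}
    (hD : ∀ j, 1 ≤ j → j < tildeAbs m → IsUnit (denomD r u j)) :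
    IsMacdonald r u m (eMac r u m) := by
  rcases int_cases_neg_pos m with ⟨k, rfl⟩ | ⟨k, rfl⟩
  · rw [eMac_neg]
    rw [tildeAbs_neg] at hD
    refine ⟨?_, coeff_eNeg r u k, fun j hj => ?_⟩
    · rw [eigenY_neg]
      exact opY_eNeg fun j h1 h2 => hD j h1 (by omega)
    · have := SuppIn.eNeg r u k j hj
      rw [abs_neg, Nat.abs_cast, abs_lt]
      omega
  · rw [eMac_pos]
    rw [tildeAbs_pos] at hD
    refine ⟨?_, coeff_ePos (coeff_eNeg r u k), fun j hj => ?_⟩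
    · rw [eigenY_pos]
      exact opY_ePos (opY_eNeg fun j h1 h2 => hD j h1 (by omega))
    · have := (SuppIn.eNeg r u k).ePos j hj
      rw [abs_of_pos (by omega : (0 : ℤ) < k + 1), abs_lt]
      omega

/-- An eigenvector of `Y` has the eigenvalue of its leading term. -/
theorem exists_leading {R : Type*} [CommRing R] [IsDomain R] {r u c : Rˣ} {f : R[T;T⁻¹]}
    (hf : f ≠ 0) (h : opY r u f = (c : R) • f) : ∃ m, f.coeff m ≠ 0 ∧ eigenY r u m = c := by
  have hne : f.coeff.support.Nonempty := by
    rw [Finsupp.support_nonempty_iff]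
    intro h0
    exact hf (LaurentPolynomial.ext fun a => by simp [h0])
  obtain ⟨j, hj, hmax⟩ := f.coeff.support.exists_max_image Int.natAbs hne
  rw [Finsupp.mem_support_iff] at hj
  have hs : SuppIn f (-(j.natAbs : ℤ)) j.natAbs := fun i hi => by
    have := hmax i (Finsupp.mem_support_iff.mpr hi)
    omega
  -- Among the exponents of maximal absolute value the negative one leads whenever it occurs;
  -- otherwise the positive one does.
  by_cases h0 : f.coeff (-(j.natAbs : ℤ)) = 0
  · have hj0 : 0 < j := by
      by_contra hneg
      have : -(j.natAbs : ℤ) = j := by omega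
      rw [this] at h0
      exact hj h0
    have hj1 : (j.natAbs : ℤ) = j := by omega
    refine ⟨j, hj, ?_⟩
    have h2 := coeff_opY_high hs h0 r u
    rw [h, hj1] at h2
    have h3 := mul_right_cancel₀ hj h2
    rw [eigenY, if_pos hj0, ← Units.val_inj, h3, ← zpow_natCast, hj1]
  · refine ⟨_, h0, ?_⟩
    have h2 := coeff_opY_low hs r u
    rw [h] at h2
    have h3 := mul_right_cancel₀ h0 h2
    rw [eigenY_neg, ← Units.val_inj, h3, zpow_natCast]

/-- The difference of two candidates is an eigenvector made of lower terms only, and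
`exists_leading` gives it the eigenvalue of one of these. -/
theorem IsMacdonald.unique {R : Type*} [CommRing R] [IsDomain R] {r u : Rˣ} {m : ℤ}
    {f g : R[T;T⁻¹]} (hf : IsMacdonald r u m f) (hg : IsMacdonald r u m g)
    (hm : ∀ j, j ≠ m → |j| < |m| ∨ (m < 0 ∧ j = |m|) → eigenY r u j ≠ eigenY r u m) : f = g := by
  by_contra hne
  have h : opY r u (f - g) = (eigenY r u m : R) • (f - g) := by
    rw [map_sub, hf.1, hg.1, smul_sub]
  obtain ⟨j, hj, hj'⟩ := exists_leading (sub_ne_zero.mpr hne) h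
  rw [AddMonoidAlgebra.coeff_sub, Finsupp.sub_apply] at hj
  have hjm : j ≠ m := by
    rintro rfl
    rw [hf.2.1, hg.2.1, sub_self] at hj
    exact hj rfl
  refine hm j hjm ?_ hj'
  by_cases hfj : f.coeff j = 0
  · have hgj : g.coeff j ≠ 0 := fun h0 => hj (by rw [hfj, h0, sub_zero])
    exact (hg.2.2 j hgj).resolve_left hjm
  · exact (hf.2.2 j hfj).resolve_left hjm

theorem map_inverse_of_isUnit {S : Type*} [CommRing S] (φ : R →+* S) {a : R} (h : IsUnit a) :
    φ (Ring.inverse a) = Ring.inverse (φ a) := by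
  obtain ⟨a, rfl⟩ := h
  rw [Ring.inverse_unit]
  exact (Ring.inverse_unit (Units.map φ.toMonoidHom a)).symm

theorem map_denomD {S : Type*} [CommRing S] (φ : R →+* S) (r u : Rˣ) (k : ℕ) :
    φ (denomD r u k) = denomD (mapU φ r) (mapU φ u) k := by
  simp [denomD]

theorem map_coefA {S : Type*} [CommRing S] (φ : R →+* S) {r u : Rˣ} {k : ℕ}
    (h : IsUnit (denomD r u k)) : φ (coefA r u k) = coefA (mapU φ r) (mapU φ u) k := by
  rw [coefA, coefA, ← map_denomD, map_mul, map_inverse_of_isUnit φ h, map_neg, map_sub]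
  rfl

/-- The construction uses only ring operations and `Ring.inverse` of the denominators. The latter
commutes with homomorphisms on units but not on non-units, where it is the default value `0`. -/
theorem mapL_eMac {S : Type*} [CommRing S] (φ : R →+* S) {r u : Rˣ} {m : ℤ}
    (hD : ∀ j, 1 ≤ j → j < tildeAbs m → IsUnit (denomD r u j)) :
    mapL φ (eMac r u m) = eMac (mapU φ r) (mapU φ u) m := by
  have hpos (k : ℕ) (h : mapL φ (eNeg r u k) = eNeg (mapU φ r) (mapU φ u) k) :
      mapL φ (ePos r u k) = ePos (mapU φ r) (mapU φ u) k := by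
    rw [ePos, map_mul, map_mul, mapL_C, mapL_T, mapL_opPi, h, ePos, map_pow]
    rfl
  have hneg (k : ℕ) : (∀ j, 1 ≤ j → j ≤ k → IsUnit (denomD r u j)) →
      mapL φ (eNeg r u k) = eNeg (mapU φ r) (mapU φ u) k := by
    induction k with
    | zero => exact fun _ => map_one _
    | succ k ih =>
      intro hk
      have h := hpos k (ih fun j h1 h2 => hk j h1 (by omega))
      rw [eNeg_succ, eNeg_succ, map_mul, map_add, map_mul, mapL_C, mapL_C, mapL_opT, h,
        map_coefA φ (hk (k + 1) (by omega) le_rfl)]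
      rfl
  rcases int_cases_neg_pos m with ⟨k, rfl⟩ | ⟨k, rfl⟩
  · rw [eMac_neg, eMac_neg]
    rw [tildeAbs_neg] at hD
    exact hneg k fun j h1 h2 => hD j h1 (by omega)
  · rw [eMac_pos, eMac_pos]
    rw [tildeAbs_pos] at hD
    exact hpos k (hneg k fun j h1 h2 => hD j h1 (by omega))

end Intertwiners

/-! ### Specialization of the generic Macdonald polynomials -/

section Specialization

theorem paramRing_relation {P Q : ParamRing} (x y : ℤ)
    (h : algebraMap ParamRing GenField P = algebraMap ParamRing GenField Q) :
    MvPolynomial.aeval ![x, y] P = MvPolynomial.aeval ![x, y] Q := by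
  rw [FaithfulSMul.algebraMap_injective ParamRing GenField h]

theorem genParam_zpow_injective {a b : ℕ} (h : genParam 0 ^ a = genParam 0 ^ b) : a = b := by
  have h1 := congrArg Units.val h
  simp only [Units.val_pow_eq_pow_val, genParam, Units.val_mk0, ← map_pow] at h1
  -- At `q^{1/2} = 2`, `t^{1/2} = 1` the relation becomes one between powers of `2`.
  have h2 := paramRing_relation 2 1 h1
  simp only [map_pow, MvPolynomial.aeval_X, Matrix.cons_val_zero] at h2
  exact Int.pow_right_injective (by norm_num) h2

theorem genParam_mul_ne_one (a b : ℕ) :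
    genParam 1 * genParam 0 ^ a ≠ (genParam 1 * genParam 0 ^ b)⁻¹ := by
  intro h
  rw [eq_inv_iff_mul_eq_one] at h
  have h1 := congrArg Units.val h
  simp only [Units.val_mul, Units.val_pow_eq_pow_val, genParam, Units.val_mk0, ← map_pow, ← map_mul,
    Units.val_one] at h1
  rw [← map_one (algebraMap ParamRing GenField)] at h1
  -- At `q^{1/2} = 1`, `t^{1/2} = 2` the relation would say `4 = 1`.
  have h2 := paramRing_relation 1 2 h1
  simp at h2

theorem eigenY_genParam_injective :
    Function.Injective (eigenY (genParam 0) (genParam 1)) := by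
  intro i j h
  rw [eigenY, eigenY] at h
  split_ifs at h with hi hj hj
  · have := genParam_zpow_injective (mul_left_cancel (inv_injective h))
    omega
  · exact absurd h.symm (genParam_mul_ne_one _ _)
  · exact absurd h (genParam_mul_ne_one _ _)
  · have := genParam_zpow_injective (mul_left_cancel h)
    omega

theorem IsValue.unique {R : Type*} [CommRing R] [IsDomain R] {r u : Rˣ} {a : GenField} {x y : R}
    (hx : IsValue r u a x) (hy : IsValue r u a y) : x = y := by
  obtain ⟨P, Q, hQ, hPQ, hx⟩ := hx
  obtain ⟨P', Q', hQ', hPQ', hy⟩ := hy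
  have h : P * Q' = P' * Q := by
    apply FaithfulSMul.algebraMap_injective ParamRing GenField
    rw [map_mul, map_mul, ← hPQ, ← hPQ']
    ring
  have h2 := congrArg (MvPolynomial.aeval ![(r : R), (u : R)]) h
  rw [map_mul, map_mul, ← hx, ← hy] at h2
  apply mul_right_cancel₀ (mul_ne_zero hQ hQ')
  linear_combination h2

theorem IsEPoly.unique {R : Type*} [CommRing R] [IsDomain R] {r u : Rˣ} {m : ℤ} {f g : R[T;T⁻¹]}
    (hf : IsEPoly r u m f) (hg : IsEPoly r u m g) : f = g := by
  obtain ⟨f', hf', hf⟩ := hf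
  obtain ⟨g', hg', hg⟩ := hg
  obtain rfl := hf'.unique hg' fun j hj _ h => hj (eigenY_genParam_injective h)
  exact LaurentPolynomial.ext fun j => (hf j).unique (hg j)

/-- Allows passing from a domain to its fraction field, where nonzero denominators become units. -/
theorem IsEPoly.of_mapL {R S : Type*} [CommRing R] [CommRing S] {φ : R →+* S}
    (hφ : Function.Injective φ) {r u : Rˣ} {m : ℤ} {f : R[T;T⁻¹]}
    (h : IsEPoly (mapU φ r) (mapU φ u) m (mapL φ f)) : IsEPoly r u m f := by
  have hev (P : ParamRing) : MvPolynomial.aeval ![((mapU φ r : Sˣ) : S), ((mapU φ u : Sˣ) : S)] P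
      = φ (MvPolynomial.aeval ![(r : R), (u : R)] P) := by
    simp only [MvPolynomial.aeval_def, MvPolynomial.eval₂_eq, map_sum, map_mul, map_prod, map_pow]
    refine Finset.sum_congr rfl fun d _ => ?_
    congr 1
    · simp
    · refine Finset.prod_congr rfl fun i _ => ?_
      fin_cases i <;> rfl
  obtain ⟨g, hg, hgf⟩ := h
  refine ⟨g, hg, fun j => ?_⟩
  obtain ⟨P, Q, hQ, hPQ, hx⟩ := hgf j
  rw [hev] at hQ
  rw [hev, hev, coeff_mapL, ← map_mul] at hx
  exact ⟨P, Q, fun h0 => hQ (by rw [h0, map_zero]), hPQ, hφ hx⟩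

/-- The intertwiners are applied over a localization of the parameter ring that maps both to the
generic field and to `R`. One polynomial over it has the generic `e_m` as one image and the
polynomial over `R` as the other. -/
theorem isEPoly_eMac {R : Type*} [CommRing R] [Nontrivial R] {r u : Rˣ} {m : ℤ}
    (hD : ∀ j, 1 ≤ j → j < tildeAbs m → IsUnit (denomD r u j)) :
    IsEPoly r u m (eMac r u m) := by
  let ev : ParamRing →+* R := (MvPolynomial.aeval ![(r : R), (u : R)]).toRingHom
  -- Exactly the parameter polynomials whose value in `R` is invertible are inverted; these include
  -- both parameters and the denominators needed for `m`.
  let M : Submonoid ParamRing := (IsUnit.submonoid R).comap ev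
  have hM (Q : M) : IsUnit (ev Q) := Q.2
  have hM' (Q : M) : IsUnit (algebraMap ParamRing GenField Q) := by
    rw [isUnit_iff_ne_zero, Ne, FaithfulSMul.algebraMap_eq_zero_iff]
    intro h0
    have := hM Q
    rw [h0, map_zero] at this
    exact not_isUnit_zero this
  let A := Localization M
  let φ : A →+* R := IsLocalization.lift (M := M) hM
  let ψ : A →+* GenField := IsLocalization.lift (M := M) hM'
  have hφ (P : ParamRing) : φ (algebraMap ParamRing A P) = ev P := IsLocalization.lift_eq hM P
  have hψ (P : ParamRing) : ψ (algebraMap ParamRing A P) = algebraMap ParamRing GenField P :=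
    IsLocalization.lift_eq hM' P
  have hX0 : ev (MvPolynomial.X 0) = r := MvPolynomial.aeval_X _ _
  have hX1 : ev (MvPolynomial.X 1) = u := MvPolynomial.aeval_X _ _
  let r' : Aˣ := (IsLocalization.map_units A (⟨MvPolynomial.X 0, by
    change IsUnit (ev _); rw [hX0]; exact r.isUnit⟩ : M)).unit
  let u' : Aˣ := (IsLocalization.map_units A (⟨MvPolynomial.X 1, by
    change IsUnit (ev _); rw [hX1]; exact u.isUnit⟩ : M)).unit
  have hr' : (r' : A) = algebraMap ParamRing A (MvPolynomial.X 0) := rfl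
  have hu' : (u' : A) = algebraMap ParamRing A (MvPolynomial.X 1) := rfl
  have hφr : mapU φ r' = r := Units.ext ((hφ _).trans hX0)
  have hφu : mapU φ u' = u := Units.ext ((hφ _).trans hX1)
  have hψr : mapU ψ r' = genParam 0 := Units.ext (hψ _)
  have hψu : mapU ψ u' = genParam 1 := Units.ext (hψ _)
  have hD' : ∀ j, 1 ≤ j → j < tildeAbs m → IsUnit (denomD r' u' j) := by
    intro j h1 h2
    have h3 : denomD r' u' j = algebraMap ParamRing A
        (1 - MvPolynomial.X 0 ^ (2 * j) * MvPolynomial.X 1 ^ 2) := by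
      simp [denomD, hr', hu']
    have h4 : ev (1 - MvPolynomial.X 0 ^ (2 * j) * MvPolynomial.X 1 ^ 2) = denomD r u j := by
      rw [map_sub, map_one, map_mul, map_pow, map_pow, hX0, hX1, denomD]
    rw [h3]
    exact IsLocalization.map_units A (⟨_, by
      change IsUnit (ev _); rw [h4]; exact hD j h1 h2⟩ : M)
  refine ⟨mapL ψ (eMac r' u' m), ?_, fun j => ?_⟩
  · rw [mapL_eMac ψ hD', ← hψr, ← hψu]
    refine isMacdonald_eMac fun j h1 h2 => ?_
    rw [← map_denomD]
    exact (hD' j h1 h2).map ψ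
  · have h : eMac r u m = mapL φ (eMac r' u' m) := by rw [mapL_eMac φ hD', hφr, hφu]
    rw [h, coeff_mapL, coeff_mapL]
    obtain ⟨⟨P, Q⟩, hPQ⟩ := IsLocalization.surj M ((eMac r' u' m).coeff j)
    refine ⟨P, Q, (hM Q).ne_zero, ?_, ?_⟩
    · rw [← hψ, ← hψ, ← map_mul, hPQ]
    · have := congrArg φ hPQ
      rw [map_mul, hφ, hφ] at this
      exact this

end Specialization

/-! ### Operators coming from the double affine Hecke algebra -/

section Operators

variable {R : Type*} [CommRing R]

theorem daha_induction {r u : Rˣ} {P : Daha r u → Prop} (hgen : ∀ g, P (gen r u g))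
    (hC : ∀ c : R, P (algebraMap R _ c)) (hadd : ∀ a b, P a → P b → P (a + b))
    (hmul : ∀ a b, P a → P b → P (a * b)) (h : Daha r u) : P h := by
  obtain ⟨a, rfl⟩ := RingQuot.mkAlgHom_surjective R (Rel r u) h
  induction a using FreeAlgebra.induction with
  | grade0 c => rw [AlgHom.commutes]; exact hC c
  | grade1 g => exact hgen g
  | mul a b ha hb => rw [map_mul]; exact hmul _ _ ha hb
  | add a b ha hb => rw [map_add]; exact hadd _ _ ha hb

section

variable {A : Type*} [Ring A] [Algebra R A] {r u : Rˣ} {X Xi Y Yi Z Zi : A}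
    (h1 : X * Xi = 1) (h2 : Xi * X = 1) (h3 : Y * Yi = 1) (h4 : Yi * Y = 1)
    (h5 : Z * Zi = 1) (h6 : Zi * Z = 1)
    (h7 : (Z - algebraMap R A (u : R)) * (Z + algebraMap R A ((u⁻¹ : Rˣ) : R)) = 0)
    (h8 : Z * X * Z = Xi) (h9 : Zi * Y * Zi = Yi)
    (hc : (r : R) • (Yi * Xi * Y * X * Z * Z) = 1)

theorem liftHom_gen (g : Gen) :
    liftHom r u X Xi Y Yi Z Zi h1 h2 h3 h4 h5 h6 h7 h8 h9 hc (gen r u g) =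
      match g with
      | Gen.X => X | Gen.Xi => Xi | Gen.Y => Y | Gen.Yi => Yi | Gen.T => Z | Gen.Ti => Zi := by
  cases g <;> rw [liftHom, gen, RingQuot.liftAlgHom_mkAlgHom_apply, FreeAlgebra.lift_ι_apply]

end

theorem polyRep_X (r u : Rˣ) (f : R[T;T⁻¹]) : polyRep r u (gen r u Gen.X) f = T 1 * f := by
  rw [polyRep, liftHom_gen]; rfl

theorem polyRep_Xi (r u : Rˣ) (f : R[T;T⁻¹]) : polyRep r u (gen r u Gen.Xi) f = T (-1) * f := by
  rw [polyRep, liftHom_gen]; rfl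

theorem polyRep_Y (r u : Rˣ) (f : R[T;T⁻¹]) :
    polyRep r u (gen r u Gen.Y) f = opPi r (opT u f) := by
  rw [polyRep, liftHom_gen]; rfl

theorem polyRep_Yi (r u : Rˣ) (f : R[T;T⁻¹]) :
    polyRep r u (gen r u Gen.Yi) f = opTi u (opPi r f) := by
  rw [polyRep, liftHom_gen]; rfl

theorem polyRep_T (r u : Rˣ) (f : R[T;T⁻¹]) : polyRep r u (gen r u Gen.T) f = opT u f := by
  rw [polyRep, liftHom_gen]

theorem polyRep_Ti (r u : Rˣ) (f : R[T;T⁻¹]) : polyRep r u (gen r u Gen.Ti) f = opTi u f := by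
  rw [polyRep, liftHom_gen]

/-- An ideal is stable under `X^{±1}` anyway, `T⁻¹` differs from `T` by a scalar, and `Y = πT`. -/
theorem isStable_of {r u : Rˣ} {I : Ideal R[T;T⁻¹]} (hT : ∀ f ∈ I, opT u f ∈ I)
    (hπ : ∀ f ∈ I, opPi r f ∈ I) : IsStable r u I := by
  have hTi : ∀ f ∈ I, opTi u f ∈ I := fun f hf => by
    rw [opTi_apply]
    exact I.sub_mem (hT f hf) (I.mul_mem_left _ hf)
  refine daha_induction (fun g => ?_) (fun c f hf => ?_) (fun a b ha hb f hf => ?_)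
    (fun a b ha hb f hf => ?_)
  · intro f hf
    cases g
    · rw [polyRep_X]; exact I.mul_mem_left _ hf
    · rw [polyRep_Xi]; exact I.mul_mem_left _ hf
    · rw [polyRep_Y]; exact hπ _ (hT f hf)
    · rw [polyRep_Yi]; exact hTi _ (hπ f hf)
    · rw [polyRep_T]; exact hT f hf
    · rw [polyRep_Ti]; exact hTi f hf
  · rw [AlgHom.commutes, Module.algebraMap_end_apply, smul_eq_C_mul]
    exact I.mul_mem_left _ hf
  · rw [map_add]
    exact I.add_mem (ha f hf) (hb f hf)
  · rw [map_mul]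
    exact ha _ (hb f hf)

theorem IsStable.opT_mem {r u : Rˣ} {I : Ideal R[T;T⁻¹]} (hI : IsStable r u I) {f : R[T;T⁻¹]}
    (hf : f ∈ I) : opT u f ∈ I := by
  rw [← polyRep_T r u]
  exact hI _ f hf

theorem IsStable.opPi_mem {r u : Rˣ} {I : Ideal R[T;T⁻¹]} (hI : IsStable r u I) {f : R[T;T⁻¹]}
    (hf : f ∈ I) : opPi r f ∈ I := by
  have h := hI (gen r u Gen.Y * gen r u Gen.Ti) f hf
  rw [map_mul] at h
  change polyRep r u (gen r u Gen.Y) (polyRep r u (gen r u Gen.Ti) f) ∈ I at h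
  rwa [polyRep_Ti, polyRep_Y, opT_opTi] at h

/-- In this form all of `T` except the scalar `u` carries the factor `uX² - u⁻¹`. This gives both
the stability of the special ideal and the behaviour of `T` at the ends of the spectrum. -/
theorem opT_eq (u : Rˣ) (f : R[T;T⁻¹]) :
    opT u f = C (u : R) * f + (C (u : R) * T 2 - C ((u⁻¹ : Rˣ) : R)) * demazure f := by
  rw [opT_apply]
  linear_combination (-C (u : R)) * demazure_spec f

theorem demazure_mul_of_opS_eq {g : R[T;T⁻¹]} (hg : opS g = g) (f : R[T;T⁻¹]) :
    demazure (g * f) = g * demazure f := by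
  apply cancel_aux
  rw [demazure_spec, map_mul, hg]
  linear_combination (-g) * demazure_spec f

theorem opT_mul_of_opS_eq {g : R[T;T⁻¹]} (hg : opS g = g) (u : Rˣ) (f : R[T;T⁻¹]) :
    opT u (g * f) = g * opT u f := by
  rw [opT_eq, opT_eq, demazure_mul_of_opS_eq hg]
  ring

end Operators

/-! ### The special polynomial -/

section SpecialPolynomial

variable {R : Type*} [CommRing R]

/-- The Laurent polynomial `X + c X⁻¹`. -/
def linFactor (c : R) : R[T;T⁻¹] := T 1 + C c * T (-1)

/-- The polynomial `r^{-n} ∏ (X + r^{2j-n} X⁻¹)`, `1 ≤ j ≤ n`. -/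
def polyE (r : Rˣ) (n : ℕ) : R[T;T⁻¹] :=
  C ((r ^ (-n : ℤ) : Rˣ) : R) *
    ∏ i ∈ Finset.range n, linFactor ((r ^ (2 * i + 2 - n : ℤ) : Rˣ) : R)

/-- The symmetric polynomial `∏ (X + r^{2j-k-1} X⁻¹)`, `1 ≤ j ≤ k`. -/
def symE (r : Rˣ) (k : ℕ) : R[T;T⁻¹] :=
  ∏ i ∈ Finset.range k, linFactor ((r ^ (2 * i + 1 - k : ℤ) : Rˣ) : R)

/-- The exponents `1 - k, 3 - k, …, k + 1` are symmetric about `0` once the last one is split off.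
-/
theorem polyE_succ (r : Rˣ) (k : ℕ) : polyE r (k + 1) =
    C ((r ^ (-(k + 1) : ℤ) : Rˣ) : R) * (symE r k * linFactor ((r ^ (k + 1) : Rˣ) : R)) := by
  have h1 : ∏ i ∈ Finset.range k, linFactor ((r ^ (2 * i + 2 - (k + 1 : ℕ) : ℤ) : Rˣ) : R) =
      symE r k := Finset.prod_congr rfl fun i _ => by
    congr 3
    push_cast
    ring
  have h2 : r ^ (2 * k + 2 - (k + 1 : ℕ) : ℤ) = r ^ (k + 1) := by
    rw [← zpow_natCast]
    congr 1
    push_cast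
    ring
  rw [polyE, Finset.prod_range_succ, h1, h2]
  push_cast
  rfl

theorem sum_symm_exponents (k : ℕ) : ∑ i ∈ Finset.range k, (2 * i + 1 - k : ℤ) = 0 := by
  rw [Finset.sum_sub_distrib, Finset.sum_add_distrib, ← Finset.mul_sum, Finset.sum_const,
    Finset.sum_const, Finset.card_range]
  have h := Finset.sum_range_id_mul_two k
  have h2 : (∑ i ∈ Finset.range k, (i : ℤ)) * 2 = k * (k - 1) := by
    rcases k with _ | k
    · simp
    · have h3 := congrArg (Nat.cast : ℕ → ℤ) h
      push_cast at h3 ⊢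
      rw [h3]
      simp
  simp only [nsmul_eq_mul, mul_one]
  linear_combination h2

theorem prod_symm_powers (r : Rˣ) (k : ℕ) :
    ∏ i ∈ Finset.range k, r ^ (2 * i + 1 - k : ℤ) = 1 := by
  have h (s : Finset ℕ) (f : ℕ → ℤ) : ∏ i ∈ s, r ^ f i = r ^ ∑ i ∈ s, f i :=
    (map_sum (zpowersHom Rˣ r).toAdditiveRight f s).symm
  rw [h, sum_symm_exponents, zpow_zero]

theorem opS_linFactor (c : Rˣ) :
    opS (linFactor (c : R)) = C (c : R) * linFactor ((c⁻¹ : Rˣ) : R) := by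
  rw [linFactor, linFactor, map_add, map_mul, opS_T, opS_C, opS_T, neg_neg]
  linear_combination (-T (-1)) * C_unit_aux c

theorem opPi_linFactor (r c : Rˣ) : opPi r (linFactor (c : R)) =
    C ((r⁻¹ * c : Rˣ) : R) * linFactor ((r ^ 2 * c⁻¹ : Rˣ) : R) := by
  have h : r⁻¹ * c * (r ^ 2 * c⁻¹) = r := by
    rw [mul_comm (r ^ 2), mul_assoc, mul_inv_cancel_left, pow_two, inv_mul_cancel_left]
  have h' := congrArg (fun x : Rˣ => (C (x : R) : R[T;T⁻¹])) h
  simp only [Units.val_mul, map_mul] at h'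
  rw [linFactor, linFactor, map_add, map_mul, opPi_T, opPi_C, opPi_T, neg_neg, zpow_one,
    zpow_neg_one, Units.val_mul, Units.val_mul, map_mul, map_mul]
  linear_combination (-T (-1)) * h'

/-- `s` inverts the constant of each factor up to a scalar. It thereby permutes the factors, and the
scalars multiply to `1`. -/
theorem opS_symE (r : Rˣ) (k : ℕ) : opS (symE r k) = symE r k := by
  rw [symE, map_prod]
  simp_rw [opS_linFactor]
  rw [Finset.prod_mul_distrib, ← map_prod, ← Units.coe_prod, prod_symm_powers, Units.val_one,
    map_one, one_mul, ← Finset.prod_range_reflect]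
  refine Finset.prod_congr rfl fun i hi => ?_
  rw [Finset.mem_range] at hi
  rw [← zpow_neg]
  congr 3
  omega

/-- `π` replaces the constant `c` of a factor by `r² c⁻¹`, which reflects the exponents about `1`
and so permutes the factors. The scalars again multiply to `1`. -/
theorem opPi_polyE (r : Rˣ) (n : ℕ) : opPi r (polyE r n) = polyE r n := by
  rw [polyE, map_mul, opPi_C, map_prod]
  simp_rw [opPi_linFactor]
  rw [Finset.prod_mul_distrib, ← map_prod, ← Units.coe_prod]
  have h : ∏ i ∈ Finset.range n, r⁻¹ * r ^ (2 * i + 2 - n : ℤ) = 1 := by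
    rw [← prod_symm_powers r n]
    refine Finset.prod_congr rfl fun i _ => ?_
    rw [← zpow_neg_one, ← zpow_add]
    congr 1
    ring
  rw [h, Units.val_one, map_one, one_mul, ← Finset.prod_range_reflect]
  congr 1
  refine Finset.prod_congr rfl fun i hi => ?_
  rw [Finset.mem_range] at hi
  rw [← zpow_neg, ← zpow_natCast, ← zpow_add]
  congr 3
  push_cast
  omega

theorem u_mul_pow {r u : Rˣ} {n : ℕ} (h : u ^ 2 * r ^ n = -1) : u * r ^ n = -u⁻¹ := by
  rw [← mul_right_inj u, ← mul_assoc, ← pow_two, h, mul_neg, mul_inv_cancel]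

/-- The only place where the special relation between `t` and `q` enters the stability of the ideal:
it makes the coefficient of `D` in `T` a unit multiple of the last factor of the special polynomial.
-/
theorem quad_factor {r u : Rˣ} {n : ℕ} (h : u ^ 2 * r ^ n = -1) :
    (C (u : R) * T 2 - C ((u⁻¹ : Rˣ) : R) : R[T;T⁻¹]) =
      C (u : R) * T 1 * linFactor ((r ^ n : Rˣ) : R) := by
  have h1 : (C (u : R) * C ((r ^ n : Rˣ) : R) : R[T;T⁻¹]) = -C ((u⁻¹ : Rˣ) : R) := by
    rw [← map_mul, ← Units.val_mul, u_mul_pow h, Units.val_neg, map_neg]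
  have h2 : (T 1 * T 1 : R[T;T⁻¹]) = T 2 := T_mul_T 1 1
  have h3 : (T 1 * T (-1) : R[T;T⁻¹]) = 1 := by rw [T_mul_T, add_neg_cancel, T_zero]
  rw [linFactor]
  linear_combination (-C (u : R)) * h2 - h1 - (C (u : R) * C ((r ^ n : Rˣ) : R)) * h3

theorem demazure_linFactor (c : R) : demazure (linFactor c) = C (c - 1) * T (-1) := by
  apply cancel_aux
  have h3 : (T 2 * T (-1) : R[T;T⁻¹]) = T 1 := T_mul_T 2 (-1)
  rw [demazure_spec, linFactor, map_add, map_mul, opS_T, opS_C, opS_T, neg_neg, map_sub, map_one]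
  linear_combination (-C c + 1) * h3

theorem opT_linFactor {r u : Rˣ} {n : ℕ} (h : u ^ 2 * r ^ n = -1) :
    opT u (linFactor ((r ^ n : Rˣ) : R)) =
      C ((u * r ^ n : Rˣ) : R) * linFactor ((r ^ n : Rˣ) : R) := by
  have h3 : (T 1 * T (-1) : R[T;T⁻¹]) = 1 := by rw [T_mul_T, add_neg_cancel, T_zero]
  rw [opT_eq, quad_factor h, demazure_linFactor, Units.val_mul, map_sub, map_one, map_mul]
  linear_combination (C (u : R) * (C ((r ^ n : Rˣ) : R) - 1) * linFactor ((r ^ n : Rˣ) : R)) * h3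

theorem opT_polyE {r u : Rˣ} {n : ℕ} (hn : 0 < n) (h : u ^ 2 * r ^ n = -1) :
    opT u (polyE r n) = C ((u * r ^ n : Rˣ) : R) * polyE r n := by
  obtain ⟨k, rfl⟩ := Nat.exists_eq_succ_of_ne_zero hn.ne'
  rw [polyE_succ, opT_C_mul, opT_mul_of_opS_eq (opS_symE r k), opT_linFactor h]
  ring

theorem opY_polyE {r u : Rˣ} {n : ℕ} (hn : 0 < n) (h : u ^ 2 * r ^ n = -1) :
    opY r u (polyE r n) = ((u * r ^ n : Rˣ) : R) • polyE r n := by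
  rw [opY_eq, opT_polyE hn h, opPi_C_mul, opPi_polyE, smul_eq_C_mul]

/-- The symmetric factor passes through `T`. On a multiple of the last factor, the scalar part of
`T` keeps the divisor and the Demazure part produces it again by `quad_factor`. -/
theorem polyE_dvd_opT {r u : Rˣ} {n : ℕ} (hn : 0 < n) (h : u ^ 2 * r ^ n = -1)
    (f : R[T;T⁻¹]) : polyE r n ∣ opT u (polyE r n * f) := by
  obtain ⟨k, rfl⟩ := Nat.exists_eq_succ_of_ne_zero hn.ne'
  rw [polyE_succ, mul_assoc, opT_C_mul, mul_assoc, opT_mul_of_opS_eq (opS_symE r k), opT_eq,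
    quad_factor h]
  refine mul_dvd_mul_left _ (mul_dvd_mul_left _ (dvd_add ?_ ?_))
  · exact Dvd.intro_left _ (by ring : C (u : R) * f * linFactor _ = _)
  · rw [mul_assoc]
    exact (dvd_mul_right _ _).mul_left _

theorem isStable_polyE {r u : Rˣ} {n : ℕ} (hn : 0 < n) (h : u ^ 2 * r ^ n = -1) :
    IsStable r u (Ideal.span {polyE r n}) := by
  refine isStable_of (fun f hf => ?_) (fun f hf => ?_)
  · rw [Ideal.mem_span_singleton] at hf ⊢
    obtain ⟨g, rfl⟩ := hf
    exact polyE_dvd_opT hn h g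
  · rw [Ideal.mem_span_singleton] at hf ⊢
    obtain ⟨g, rfl⟩ := hf
    rw [map_mul, opPi_polyE]
    exact dvd_mul_right _ _

theorem suppIn_linFactor (c : R) : SuppIn (linFactor c) (-1) 1 :=
  ((suppIn_T 1).mono (by omega) le_rfl).add (((suppIn_T (-1)).mono le_rfl (by omega)).C_mul c)

theorem prod_linFactor (k : ℕ) (c : ℕ → R) :
    SuppIn (∏ i ∈ Finset.range k, linFactor (c i)) (-k) k ∧
    (∏ i ∈ Finset.range k, linFactor (c i)).coeff (-k) = ∏ i ∈ Finset.range k, c i ∧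
    (∏ i ∈ Finset.range k, linFactor (c i)).coeff k = 1 := by
  induction k with
  | zero =>
    rw [Finset.prod_range_zero, Finset.prod_range_zero]
    refine ⟨suppIn_one.mono (by simp) (by simp), ?_, ?_⟩ <;> simp [← T_zero]
  | succ k ih =>
    obtain ⟨h1, h2, h3⟩ := ih
    have h4 := suppIn_linFactor (c k)
    have e1 : -((k + 1 : ℕ) : ℤ) = -(k : ℤ) + -1 := by push_cast; ring
    rw [Finset.prod_range_succ, Finset.prod_range_succ]
    refine ⟨?_, ?_, ?_⟩
    · rw [e1, Nat.cast_succ]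
      exact h1.mul h4
    · rw [e1, coeff_mul_low h1 h4, h2]
      simp [linFactor, coeff_C_mul]
    · rw [Nat.cast_succ, coeff_mul_high h1 h4, h3]
      simp [linFactor, coeff_C_mul]

theorem suppIn_polyE (r : Rˣ) (n : ℕ) : SuppIn (polyE r n) (-n) n :=
  (prod_linFactor n _).1.C_mul _

theorem coeff_polyE_high (r : Rˣ) (n : ℕ) :
    (polyE r n).coeff n = ((r ^ (-n : ℤ) : Rˣ) : R) := by
  rw [polyE, coeff_C_mul, (prod_linFactor n _).2.2, mul_one]

/-- The constants of the factors multiply to `rⁿ`, which explains the normalization `r⁻ⁿ`. -/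
theorem coeff_polyE_low (r : Rˣ) (n : ℕ) : (polyE r n).coeff (-n) = 1 := by
  rw [polyE, coeff_C_mul, (prod_linFactor n _).2.1, ← Units.coe_prod, ← Units.val_mul]
  have h : ∏ i ∈ Finset.range n, r ^ (2 * i + 2 - n : ℤ) = r ^ (n : ℤ) := by
    have h2 : ∏ i ∈ Finset.range n, r ^ (2 * i + 2 - n : ℤ) =
        ∏ i ∈ Finset.range n, (r ^ (2 * i + 1 - n : ℤ) * r) := by
      refine Finset.prod_congr rfl fun i _ => ?_
      rw [← zpow_add_one]
      congr 1
      ring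
    rw [h2, Finset.prod_mul_distrib, prod_symm_powers, one_mul, Finset.prod_const,
      Finset.card_range, zpow_natCast]
  rw [h, ← zpow_add, neg_add_cancel, zpow_zero, Units.val_one]

theorem isMacdonald_polyE {r u : Rˣ} {n : ℕ} (hn : 0 < n) (h : u ^ 2 * r ^ n = -1) :
    IsMacdonald r u (-n) (polyE r n) := by
  refine ⟨?_, coeff_polyE_low r n, fun j hj => ?_⟩
  · rw [eigenY_neg]
    exact opY_polyE hn h
  · have := suppIn_polyE r n j hj
    rw [abs_neg, Nat.abs_cast, abs_lt]
    omega

theorem mapL_polyE {S : Type*} [CommRing S] (φ : R →+* S) (r : Rˣ) (n : ℕ) :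
    mapL φ (polyE r n) = polyE (mapU φ r) n := by
  simp only [polyE, linFactor, map_mul, map_prod, map_add, mapL_C, mapL_T, ← map_zpow]
  rfl

/-- The special polynomial with coefficients in `ℤ[q^{±1/2}]`. -/
def specE (n : ℕ) : ℤ[T;T⁻¹][T;T⁻¹] := polyE (unitXi⁻¹ : (ℤ[T;T⁻¹])ˣ) n

/-- The inner Laurent variable, which is the unit `unitXi⁻¹`, plays the role of `q^{1/2}`. -/
theorem evalCoeffs_specE (r : Rˣ) (n : ℕ) : evalCoeffs (specE n) r = polyE r n := by
  have h : mapU (eval₂ (Int.castRingHom R) r) (unitXi⁻¹ : (ℤ[T;T⁻¹])ˣ) = r := by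
    refine Units.ext ?_
    change eval₂ (Int.castRingHom R) r (T 1) = _
    rw [eval₂_T, zpow_one]
  change mapL _ (polyE _ n) = _
  rw [mapL_polyE, h]

theorem idealE_specE (r : Rˣ) (n : ℕ) : idealE (specE n) r = Ideal.span {polyE r n} := by
  rw [idealE, evalCoeffs_specE]

theorem denomD_eq {r u : Rˣ} {n : ℕ} (h : u ^ 2 * r ^ n = -1) (j : ℕ) :
    denomD r u j = 1 + ((r ^ (2 * j - n : ℤ) : Rˣ) : R) := by
  have h1 : u ^ 2 = -(r ^ (-n : ℤ)) := by
    rw [zpow_neg, zpow_natCast, eq_comm, ← mul_left_inj (r ^ n), h, neg_mul, inv_mul_cancel]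
  rw [denomD, ← Units.val_pow_eq_pow_val u, h1, Units.val_neg, ← Units.val_pow_eq_pow_val, mul_neg,
    ← Units.val_mul, ← zpow_natCast, ← zpow_add, sub_neg_eq_add]
  push_cast
  rfl

theorem pow_eq_one_of_zpow {r : Rˣ} {k : ℤ} (h : r ^ k = -1) : r ^ (2 * k.natAbs) = 1 := by
  have h2 : r ^ (2 * k) = 1 := by rw [mul_comm, zpow_mul, h]; norm_num
  rw [← zpow_natCast]
  push_cast
  rcases abs_choice k with h3 | h3
  · rw [h3, h2]
  · rw [h3, mul_neg, zpow_neg, h2, inv_one]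

/-- A coincidence with an index `-k` gives `r^{n-k} = 1`. One with an index `k + 1` gives `r^{k+1} =
-1`, by the special relation. -/
theorem eigenY_ne_of_special [IsDomain R] {r u : Rˣ} {n : ℕ} (h : u ^ 2 * r ^ n = -1)
    (hq : ∀ j, 0 < j → j ≤ n → r ^ (2 * j) ≠ 1) {j : ℤ} (hj : j ≠ -(n : ℤ))
    (hj' : |j| ≤ n) : eigenY r u j ≠ eigenY r u (-n) := by
  rw [abs_le] at hj'
  rw [eigenY_neg]
  rcases int_cases_neg_pos j with ⟨k, rfl⟩ | ⟨k, rfl⟩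
  · rw [eigenY_neg, Ne, mul_right_inj]
    intro h0
    obtain ⟨d, rfl⟩ : ∃ d, n = k + d := ⟨n - k, by omega⟩
    rw [pow_add] at h0
    refine hq d (by omega) (by omega) ?_
    rw [mul_comm, pow_mul, left_eq_mul.mp h0, one_pow]
  · rw [eigenY_pos, Ne, inv_eq_iff_mul_eq_one]
    intro h0
    refine hq (k + 1) (by omega) (by omega) ?_
    have h1 : r ^ ((k + 1 : ℕ) : ℤ) = -1 := by
      rw [zpow_natCast]
      have : u * r ^ (k + 1) * (u * r ^ n) = u ^ 2 * r ^ n * r ^ (k + 1) := by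
        rw [pow_two, mul_mul_mul_comm, mul_assoc (u * u), mul_comm (r ^ (k + 1))]
      rw [this, h, neg_one_mul] at h0
      rw [← h0, neg_neg]
    exact pow_eq_one_of_zpow h1

/-- Over the fraction field the product and the polynomial built by intertwiners are eigenvectors
with the same leading term and a separated eigenvalue, hence equal. -/
theorem isEPoly_polyE [IsDomain R] {r u : Rˣ} {n : ℕ} (hn : 0 < n) (h : u ^ 2 * r ^ n = -1)
    (h2 : (2 : R) ≠ 0) (hq : ∀ j, 0 < j → j ≤ n → r ^ (2 * j) ≠ 1) :
    IsEPoly r u (-n) (polyE r n) := by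
  let φ : R →+* FractionRing R := algebraMap R (FractionRing R)
  have hφ : Function.Injective φ := IsFractionRing.injective R (FractionRing R)
  have h' : mapU φ u ^ 2 * mapU φ r ^ n = -1 := by
    rw [← map_pow, ← map_pow, ← map_mul, h]
    exact Units.ext (by simp)
  have hinj : Function.Injective (mapU φ) := Units.map_injective hφ
  refine IsEPoly.of_mapL hφ ?_
  rw [mapL_polyE]
  have hD : ∀ j, 1 ≤ j → j < tildeAbs (-(n : ℤ)) → IsUnit (denomD (mapU φ r) (mapU φ u) j) := by
    intro j h3 h4
    rw [tildeAbs_neg] at h4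
    rw [isUnit_iff_ne_zero, ← map_denomD]
    intro h0
    have h5 := hφ (h0.trans (map_zero φ).symm)
    rw [denomD_eq h] at h5
    -- A vanishing denominator `1 + r^{2j-n}` means `2 = 0` if `2j = n`. Otherwise it gives
    -- `r^{2|2j-n|} = 1` with `0 < |2j - n| ≤ n`.
    by_cases hjn : 2 * j = n
    · have : (2 * j - n : ℤ) = 0 := by omega
      rw [this, zpow_zero, Units.val_one] at h5
      exact h2 (by linear_combination h5)
    · have h6 : r ^ (2 * j - n : ℤ) = -1 := Units.ext (by
        rw [Units.val_neg, Units.val_one]; linear_combination h5)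
      exact hq _ (by omega) (by omega) (pow_eq_one_of_zpow h6)
  rw [(isMacdonald_polyE hn h').unique (isMacdonald_eMac hD) fun j hj hj' =>
    eigenY_ne_of_special h' (fun i h3 h4 h0 => hq i h3 h4 (hinj (by rw [map_pow, h0, map_one])))
      hj (by rw [abs_neg, Nat.abs_cast] at hj'; rcases hj' with h6 | ⟨-, h6⟩
             · exact h6.le
             · rw [h6, Nat.abs_cast])]
  exact isEPoly_eMac hD

end SpecialPolynomial

/-! ### Uniqueness of the special polynomial -/

section SpecialUnique

theorem exists_transcendental_unit : ∃ r : ℂˣ, Transcendental ℤ (r : ℂ) := by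
  obtain ⟨x, hx⟩ : ∃ x : ℝ, Transcendental ℤ x :=
    ⟨_, transcendental_liouvilleNumber (m := 2) le_rfl⟩
  have hx' : Transcendental ℤ (x : ℂ) :=
    (transcendental_algebraMap_iff (R := ℤ) (A := ℂ) (S := ℝ) Complex.ofReal_injective).mpr hx
  exact ⟨Units.mk0 (x : ℂ) fun h0 => hx' (h0 ▸ isAlgebraic_zero), hx'⟩

theorem eval₂_injective_of_transcendental {r : ℂˣ} (hr : Transcendental ℤ (r : ℂ)) :
    Function.Injective (eval₂ (Int.castRingHom ℂ) r) := by
  rw [injective_iff_map_eq_zero]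
  intro f hf
  obtain ⟨k, p, hp⟩ := f.exists_T_pow
  have h1 : Polynomial.aeval (r : ℂ) p = 0 := by
    have h2 := congrArg (eval₂ (Int.castRingHom ℂ) r) hp
    rw [eval₂_toLaurent, map_mul, hf, zero_mul] at h2
    exact h2
  have h3 := (transcendental_iff.mp hr) p h1
  rw [h3, map_zero] at hp
  exact ((isUnit_T (k : ℤ)).mul_left_eq_zero).mp hp.symm

theorem isSpecialE_specE {n : ℕ} (hn : 0 < n) : IsSpecialE n (specE n) := by
  intro r u hr h
  rw [evalCoeffs_specE]
  exact isEPoly_polyE hn h two_ne_zero fun j hj _ => hr _ (by omega)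

/-- A single transcendental value of `q^{1/2}` suffices, since evaluation there is injective on
`ℤ[q^{±1/2}]`. -/
theorem IsSpecialE.eq_specE {n : ℕ} (hn : 0 < n) {E : ℤ[T;T⁻¹][T;T⁻¹]} (hE : IsSpecialE n E) :
    E = specE n := by
  obtain ⟨r, hr⟩ := exists_transcendental_unit
  have hroot : ∀ j : ℕ, 0 < j → r ^ j ≠ 1 := by
    intro j hj h
    refine hr ⟨Polynomial.X ^ j - 1, (Polynomial.monic_X_pow_sub_C 1 hj.ne').ne_zero, ?_⟩
    rw [map_sub, map_pow, Polynomial.aeval_X, map_one, ← Units.val_pow_eq_pow_val, h,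
      Units.val_one, sub_self]
  obtain ⟨u, hu⟩ : ∃ u : ℂˣ, u ^ 2 * r ^ n = -1 := by
    obtain ⟨z, hz⟩ := IsAlgClosed.exists_pow_nat_eq (-((r ^ n)⁻¹ : ℂˣ) : ℂ) (n := 2) (by norm_num)
    have hz0 : z ≠ 0 := by
      rintro rfl
      simp at hz
    refine ⟨Units.mk0 z hz0, Units.ext ?_⟩
    rw [Units.val_mul, Units.val_pow_eq_pow_val, Units.val_mk0, hz, neg_mul, Units.inv_mul]
    simp
  have h := (hE r u hroot hu).unique (isSpecialE_specE hn r u hroot hu)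
  exact mapL_injective _ (eval₂_injective_of_transcendental hr) h

end SpecialUnique

/-! ### The action on a quotient -/

section QuotientAction

variable {R : Type*} [CommRing R] {r u : Rˣ} {I : Ideal R[T;T⁻¹]} (hI : IsStable r u I)

theorem quotRep_mk (h : Daha r u) (f : R[T;T⁻¹]) :
    quotRep r u I hI h (Ideal.Quotient.mk I f) = Ideal.Quotient.mk I (polyRep r u h f) := rfl

theorem quotRep_X (f : R[T;T⁻¹]) : quotRep r u I hI (gen r u Gen.X) (Ideal.Quotient.mk I f) =
    Ideal.Quotient.mk I (T 1 * f) := by rw [quotRep_mk, polyRep_X]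

theorem quotRep_Xi (f : R[T;T⁻¹]) : quotRep r u I hI (gen r u Gen.Xi) (Ideal.Quotient.mk I f) =
    Ideal.Quotient.mk I (T (-1) * f) := by rw [quotRep_mk, polyRep_Xi]

theorem quotRep_Y (f : R[T;T⁻¹]) : quotRep r u I hI (gen r u Gen.Y) (Ideal.Quotient.mk I f) =
    Ideal.Quotient.mk I (opPi r (opT u f)) := by rw [quotRep_mk, polyRep_Y]

theorem quotRep_Yi (f : R[T;T⁻¹]) : quotRep r u I hI (gen r u Gen.Yi) (Ideal.Quotient.mk I f) =
    Ideal.Quotient.mk I (opTi u (opPi r f)) := by rw [quotRep_mk, polyRep_Yi]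

theorem quotRep_T (f : R[T;T⁻¹]) : quotRep r u I hI (gen r u Gen.T) (Ideal.Quotient.mk I f) =
    Ideal.Quotient.mk I (opT u f) := by rw [quotRep_mk, polyRep_T]

theorem quotRep_Ti (f : R[T;T⁻¹]) : quotRep r u I hI (gen r u Gen.Ti) (Ideal.Quotient.mk I f) =
    Ideal.Quotient.mk I (opTi u f) := by rw [quotRep_mk, polyRep_Ti]

end QuotientAction

/-! ### Checking intertwining relations on generators -/

section Intertwining

variable {R : Type*} [CommRing R] {r u : Rˣ}

theorem intertwine_of_gen {V W : Type*} [AddCommGroup V] [Module R V] [AddCommGroup W] [Module R W]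
    (ρ : Daha r u →ₐ[R] Module.End R V) (ρ' : Daha r u →ₐ[R] Module.End R W) (τ : V →ₗ[R] W)
    (H : ∀ g v, τ (ρ (gen r u g) v) = ρ' (gen r u g) (τ v)) (h : Daha r u) :
    ∀ v, τ (ρ h v) = ρ' h (τ v) := by
  induction h using daha_induction with
  | hgen g => exact H g
  | hC c =>
    intro v
    rw [AlgHom.commutes, AlgHom.commutes, Module.algebraMap_end_apply, Module.algebraMap_end_apply,
      map_smul]
  | hadd a b ha hb =>
    intro v
    rw [map_add, map_add, LinearMap.add_apply, LinearMap.add_apply, map_add, ha, hb]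
  | hmul a b ha hb =>
    intro v
    rw [map_mul, map_mul, Module.End.mul_apply, Module.End.mul_apply, ha, hb]

theorem tauPlus_gen {p : Rˣ} (hp : p ^ 2 = r) (g : Gen) : tauPlus p r u hp (gen r u g) =
    match g with
    | Gen.X => gen r u Gen.X
    | Gen.Xi => gen r u Gen.Xi
    | Gen.Y => ((p⁻¹ : Rˣ) : R) • (gen r u Gen.X * gen r u Gen.Y)
    | Gen.Yi => (p : R) • (gen r u Gen.Yi * gen r u Gen.Xi)
    | Gen.T => gen r u Gen.T
    | Gen.Ti => gen r u Gen.Ti := by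
  cases g <;> rw [tauPlus, liftHom_gen]

theorem tauMinus_gen {p : Rˣ} (hp : p ^ 2 = r) (g : Gen) : tauMinus p r u hp (gen r u g) =
    match g with
    | Gen.X => (p : R) • (gen r u Gen.Y * gen r u Gen.X)
    | Gen.Xi => ((p⁻¹ : Rˣ) : R) • (gen r u Gen.Xi * gen r u Gen.Yi)
    | Gen.Y => gen r u Gen.Y
    | Gen.Yi => gen r u Gen.Yi
    | Gen.T => gen r u Gen.T
    | Gen.Ti => gen r u Gen.Ti := by
  cases g <;> rw [tauMinus, liftHom_gen]

end Intertwining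

/-! ### The monomial basis -/

section MonomialBasis

variable {R : Type*} [CommRing R]

theorem map_mem_of_suppIn {V : Type*} [AddCommGroup V] [Module R V] (L : R[T;T⁻¹] →ₗ[R] V)
    (W : Submodule R V) {a b : ℤ} (hW : ∀ j, a ≤ j → j ≤ b → L (T j) ∈ W) {f : R[T;T⁻¹]}
    (hf : SuppIn f a b) : L f ∈ W := by
  rw [← AddMonoidAlgebra.sum_coeff_single f, Finsupp.sum, map_sum]
  refine W.sum_mem fun j hj => ?_
  have h := hf j (Finsupp.mem_support_iff.mp hj)
  rw [single_eq_C_mul_T, ← smul_eq_C_mul, map_smul]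
  exact W.smul_mem _ (hW j h.1 h.2)

theorem mk_specE_eq_zero {r : Rˣ} {n : ℕ} {f : R[T;T⁻¹]} :
    Ideal.Quotient.mk (idealE (specE n) r) f = 0 ↔ polyE r n ∣ f := by
  rw [Ideal.Quotient.eq_zero_iff_mem, idealE_specE, Ideal.mem_span_singleton]

/-- With unit coefficients at both ends of the special polynomial, a nonzero multiple of it has
exponents at least `2n` apart, too wide for the window. -/
theorem eq_zero_of_polyE_dvd {r : Rˣ} {n : ℕ} {f : R[T;T⁻¹]} (h : polyE r n ∣ f)
    (hf : SuppIn f (-n + 1) n) : f = 0 := by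
  obtain ⟨g, rfl⟩ := h
  by_contra h0
  have hg : g ≠ 0 := by
    rintro rfl
    exact h0 (mul_zero _)
  obtain ⟨a, b, hab, ha, hb⟩ := exists_suppIn hg
  have h1 := coeff_mul_low (suppIn_polyE r n) hab
  have h2 := coeff_mul_high (suppIn_polyE r n) hab
  rw [coeff_polyE_low, one_mul] at h1
  rw [coeff_polyE_high] at h2
  have h3 := hf _ (by rw [h1]; exact ha)
  have h4 := hf (n + b) (by rw [h2]; exact fun h => hb ((Units.mul_right_eq_zero _).mp h))
  have := hab a ha
  omega

theorem span_monomials_shift {V : Type*} [AddCommGroup V] [Module R V] {r : Rˣ} {n : ℕ}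
    (L : R[T;T⁻¹] →ₗ[R] V) (hL : ∀ i, L (T i * polyE r n) = 0) (W : Submodule R V)
    (hW : ∀ j, -(n : ℤ) < j → j ≤ n → L (T j) ∈ W) (j : ℤ) : L (T j) ∈ W := by
  -- The relation given by `Xⁱ E` involves `2n + 1` consecutive monomials with unit coefficients at
  -- both ends, so either end is expressible by the others. The window therefore grows one step at a
  -- time in both directions.
  have hup (i : ℤ) (h : ∀ j, i - n ≤ j → j < i + n → L (T j) ∈ W) : L (T (i + n)) ∈ W := by
    have hs : SuppIn (T i * polyE r n - C ((r ^ (-n : ℤ) : Rˣ) : R) * T (i + n)) (i - n)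
        (i + n - 1) := fun j hj => by
      have h1 := (suppIn_polyE r n).T_mul i
      rw [AddMonoidAlgebra.coeff_sub, Finsupp.sub_apply, coeff_C_mul, T_apply] at hj
      by_cases hjn : i + n = j
      · rw [if_pos hjn, coeff_T_mul, ← hjn, add_sub_cancel_left, coeff_polyE_high] at hj
        exact absurd (by ring) hj
      · rw [if_neg hjn, mul_zero, sub_zero] at hj
        have := h1 j hj
        omega
    have h2 := map_mem_of_suppIn L W (fun j h3 h4 => h j h3 (by omega)) hs
    rw [map_sub, hL, zero_sub, ← smul_eq_C_mul, map_smul] at h2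
    have h3 := W.smul_mem ((r ^ (n : ℤ) : Rˣ) : R) (W.neg_mem h2)
    rwa [neg_neg, smul_smul, ← Units.val_mul, ← zpow_add, add_neg_cancel, zpow_zero,
      Units.val_one, one_smul] at h3
  have hdown (i : ℤ) (h : ∀ j, i - n < j → j ≤ i + n → L (T j) ∈ W) : L (T (i - n)) ∈ W := by
    have hs : SuppIn (T i * polyE r n - T (i - n)) (i - n + 1) (i + n) := fun j hj => by
      have h1 := (suppIn_polyE r n).T_mul i
      rw [AddMonoidAlgebra.coeff_sub, Finsupp.sub_apply, T_apply] at hj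
      by_cases hjn : i - n = j
      · rw [if_pos hjn, coeff_T_mul, ← hjn, sub_sub_cancel_left, coeff_polyE_low] at hj
        exact absurd (by ring) hj
      · rw [if_neg hjn, sub_zero] at hj
        have := h1 j hj
        omega
    have h2 := map_mem_of_suppIn L W (fun j h3 h4 => h j (by omega) h4) hs
    rw [map_sub, hL, zero_sub] at h2
    exact neg_mem_iff.mp h2
  have hwin (i : ℕ) : (∀ j, -(n : ℤ) < j → j ≤ i + n → L (T j) ∈ W) ∧
      ∀ j, -(i : ℤ) - n < j → j ≤ n → L (T j) ∈ W := by
    induction i with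
    | zero => exact ⟨fun j h1 h2 => hW j h1 (by simpa using h2), fun j h1 h2 => hW j (by simpa using h1) h2⟩
    | succ i ih =>
      refine ⟨fun j h1 h2 => ?_, fun j h1 h2 => ?_⟩
      · by_cases hj : j ≤ i + n
        · exact ih.1 j h1 hj
        · have h3 : j = (i + 1 : ℤ) + n := by push_cast at h2; omega
          rw [h3]
          exact hup _ fun j h4 h5 => ih.1 j (by omega) (by omega)
      · by_cases hj : -(i : ℤ) - n < j
        · exact ih.2 j hj h2
        · have h3 : j = -(i : ℤ) - n := by push_cast at h1; omega
          rw [h3]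
          exact hdown _ fun j h4 h5 => ih.2 j (by omega) (by omega)
  rcases lt_or_ge (-(n : ℤ)) j with h | h
  · exact (hwin j.natAbs).1 j h (by omega)
  · by_cases hn : -(n : ℤ) < j
    · exact (hwin j.natAbs).1 j hn (by omega)
    · exact (hwin (j.natAbs + 1)).2 j (by omega) (by omega)

/-- The images of the monomials `X^m`, `-n < m ≤ n`, form a basis. -/
theorem exists_monomial_basis (r : Rˣ) (n : ℕ) :
    ∃ b : Module.Basis (Set.Ioc (-(n : ℤ)) n) R (VPrime (specE n) r),
      ∀ m, b m = Ideal.Quotient.mk _ (T m) := by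
  let L : R[T;T⁻¹] →ₗ[R] VPrime (specE n) r := (Ideal.Quotient.mkₐ R (idealE (specE n) r)).toLinearMap
  have hL (f : R[T;T⁻¹]) : L f = Ideal.Quotient.mk _ f := rfl
  have hli : LinearIndependent R fun m : Set.Ioc (-(n : ℤ)) n => L (T m) := by
    rw [Fintype.linearIndependent_iff]
    intro g hg
    simp_rw [← map_smul] at hg
    rw [← map_sum, hL, mk_specE_eq_zero] at hg
    have hcoeff (j : ℤ) : (∑ m : Set.Ioc (-(n : ℤ)) n, g m • (T (m : ℤ) : R[T;T⁻¹])).coeff j =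
        ∑ m : Set.Ioc (-(n : ℤ)) n, if (m : ℤ) = j then g m else 0 := by
      rw [AddMonoidAlgebra.coeff_sum, Finsupp.finsetSum_apply]
      refine Finset.sum_congr rfl fun m _ => ?_
      rw [smul_eq_C_mul, coeff_C_mul, T_apply, mul_ite, mul_one, mul_zero]
    have h0 := eq_zero_of_polyE_dvd hg fun j hj => by
      rw [hcoeff] at hj
      obtain ⟨m, -, hm⟩ := Finset.exists_ne_zero_of_sum_ne_zero hj
      by_cases hmj : (m : ℤ) = j
      · have := m.2
        rw [Set.mem_Ioc, hmj] at this
        omega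
      · exact absurd (if_neg hmj) hm
    intro i
    have h1 := hcoeff i
    rw [h0, AddMonoidAlgebra.coeff_zero, Finsupp.zero_apply,
      Finset.sum_eq_single i (fun m _ hm => if_neg fun h => hm (Subtype.ext h))
        (fun h => absurd (Finset.mem_univ i) h), if_pos rfl] at h1
    exact h1.symm
  have hspan : ⊤ ≤ Submodule.span R (Set.range fun m : Set.Ioc (-(n : ℤ)) n => L (T m)) := by
    rintro v -
    obtain ⟨f, rfl⟩ := Ideal.Quotient.mk_surjective v
    rw [← hL]
    rcases eq_or_ne f 0 with rfl | hf
    · rw [map_zero]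
      exact Submodule.zero_mem _
    · obtain ⟨a, b, hab, -⟩ := exists_suppIn hf
      refine map_mem_of_suppIn L _ (fun j _ _ => ?_) hab
      refine span_monomials_shift L (r := r) (n := n) (fun i => ?_) _ (fun j h1 h2 => ?_) j
      · rw [hL, mk_specE_eq_zero]
        exact dvd_mul_left _ _
      · exact Submodule.subset_span ⟨⟨j, h1, h2⟩, rfl⟩
  exact ⟨Module.Basis.mk hli hspan, fun m => Module.Basis.mk_apply hli hspan m⟩

/-- The basis of monomials `X^m`, `-n < m ≤ n`. -/
def monomialBasis (r : Rˣ) (n : ℕ) :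
    Module.Basis (Set.Ioc (-(n : ℤ)) n) R (VPrime (specE n) r) :=
  (exists_monomial_basis r n).choose

theorem monomialBasis_apply (r : Rˣ) (n : ℕ) (m : Set.Ioc (-(n : ℤ)) n) :
    monomialBasis r n m = Ideal.Quotient.mk _ (T m) :=
  (exists_monomial_basis r n).choose_spec m

theorem finrank_VPrime [Nontrivial R] (r : Rˣ) (n : ℕ) :
    Module.finrank R (VPrime (specE n) r) = 2 * n := by
  rw [Module.finrank_eq_card_basis (monomialBasis r n), ← Set.toFinset_card, Set.toFinset_Ioc,
    Int.card_Ioc]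
  omega

end MonomialBasis

/-! ### Change of parameters -/

section Specialize

theorem mapL_opTi {R S : Type*} [CommRing R] [CommRing S] (φ : R →+* S) (u : Rˣ) (f : R[T;T⁻¹]) :
    mapL φ (opTi u f) = opTi (mapU φ u) (mapL φ f) := by
  rw [opTi_apply, opTi_apply, map_sub, map_mul, map_sub, mapL_C, mapL_C, mapL_opT]
  rfl

variable {R S : Type*} [CommRing R] [CommRing S] [Algebra R S]

theorem specMap_mk (E : ℤ[T;T⁻¹][T;T⁻¹]) (r : Rˣ) (f : R[T;T⁻¹]) :
    specMap S E r (Ideal.Quotient.mk _ f) = Ideal.Quotient.mk _ (mapL (algebraMap R S) f) := rfl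

/-- Specialization carries the monomial basis to the monomial basis. -/
theorem isBaseChange_specMap (r : Rˣ) (n : ℕ) :
    IsBaseChange S (specMap S (specE n) r).toLinearMap := by
  let e := ((monomialBasis r n).baseChange S).equiv (monomialBasis (baseUnit S r) n) (Equiv.refl _)
  refine IsBaseChange.of_equiv e fun x => ?_
  have h : (e.toLinearMap.restrictScalars R) ∘ₗ
      (TensorProduct.mk R S (VPrime (specE n) r) 1) = (specMap S (specE n) r).toLinearMap := by
    refine (monomialBasis r n).ext fun m => ?_
    rw [LinearMap.comp_apply, TensorProduct.mk_apply, LinearMap.restrictScalars_apply,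
      ← Module.Basis.baseChange_apply, LinearEquiv.coe_coe, Module.Basis.equiv_apply,
      Equiv.refl_apply, monomialBasis_apply, monomialBasis_apply, AlgHom.toLinearMap_apply,
      specMap_mk, mapL_T]
  exact LinearMap.congr_fun h x

variable {r u : Rˣ} {E : ℤ[T;T⁻¹][T;T⁻¹]} (hR : IsStable r u (idealE E r))
    (hS : IsStable (baseUnit S r) (baseUnit S u) (idealE E (baseUnit S r)))

theorem specMap_gen (g : Gen) (v : VPrime E r) :
    specMap S E r (quotRep r u _ hR (gen r u g) v) =
      quotRep _ _ _ hS (gen _ _ g) (specMap S E r v) := by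
  obtain ⟨f, rfl⟩ := Ideal.Quotient.mk_surjective v
  cases g
  · rw [quotRep_X, specMap_mk, specMap_mk, quotRep_X, map_mul, mapL_T]
  · rw [quotRep_Xi, specMap_mk, specMap_mk, quotRep_Xi, map_mul, mapL_T]
  · rw [quotRep_Y, specMap_mk, specMap_mk, quotRep_Y, mapL_opPi, mapL_opT]
  · rw [quotRep_Yi, specMap_mk, specMap_mk, quotRep_Yi, mapL_opTi, mapL_opPi]
  · rw [quotRep_T, specMap_mk, specMap_mk, quotRep_T, mapL_opT]
  · rw [quotRep_Ti, specMap_mk, specMap_mk, quotRep_Ti, mapL_opTi]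

theorem specMap_smul_gen_mul (c : R) (g g' : Gen) (v : VPrime E r) :
    specMap S E r (quotRep r u _ hR (c • (gen r u g * gen r u g')) v) =
      quotRep _ _ _ hS (algebraMap R S c • (gen _ _ g * gen _ _ g')) (specMap S E r v) := by
  rw [map_smul, map_smul, map_mul, map_mul, LinearMap.smul_apply, LinearMap.smul_apply,
    Module.End.mul_apply, Module.End.mul_apply, map_smul, specMap_gen hR hS, specMap_gen hR hS,
    algebraMap_smul]

theorem specMap_tauPlus {p : Rˣ} (hp : p ^ 2 = r) (hp' : baseUnit S p ^ 2 = baseUnit S r) (g : Gen)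
    (v : VPrime E r) :
    specMap S E r (quotRep r u _ hR (tauPlus p r u hp (gen r u g)) v) =
      quotRep _ (baseUnit S u) _ hS (tauPlus _ _ _ hp' (gen _ _ g)) (specMap S E r v) := by
  rw [tauPlus_gen, tauPlus_gen]
  cases g
  · exact specMap_gen hR hS _ v
  · exact specMap_gen hR hS _ v
  · exact specMap_smul_gen_mul hR hS _ _ _ v
  · exact specMap_smul_gen_mul hR hS _ _ _ v
  · exact specMap_gen hR hS _ v
  · exact specMap_gen hR hS _ v

theorem specMap_tauMinus {p : Rˣ} (hp : p ^ 2 = r) (hp' : baseUnit S p ^ 2 = baseUnit S r) (g : Gen)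
    (v : VPrime E r) :
    specMap S E r (quotRep r u _ hR (tauMinus p r u hp (gen r u g)) v) =
      quotRep _ (baseUnit S u) _ hS (tauMinus _ _ _ hp' (gen _ _ g)) (specMap S E r v) := by
  rw [tauMinus_gen, tauMinus_gen]
  cases g
  · exact specMap_smul_gen_mul hR hS _ _ _ v
  · exact specMap_smul_gen_mul hR hS _ _ _ v
  · exact specMap_gen hR hS _ v
  · exact specMap_gen hR hS _ v
  · exact specMap_gen hR hS _ v
  · exact specMap_gen hR hS _ v

theorem exists_baseChange_equiv {V W : Type*} [AddCommGroup V] [Module R V] [AddCommGroup W]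
    [Module R W] [Module S W] [IsScalarTower R S W] {ε : V →ₗ[R] W} (hε : IsBaseChange S ε)
    (τ : V ≃ₗ[R] V) : ∃ σ : W ≃ₗ[S] W, ∀ v, ε (τ v) = σ (ε v) := by
  refine ⟨(hε.equiv.symm.trans (τ.baseChange R S V V)).trans hε.equiv, fun v => ?_⟩
  have h : hε.equiv.symm (ε v) = TensorProduct.tmul R 1 v := by
    rw [LinearEquiv.symm_apply_eq, IsBaseChange.equiv_tmul, one_smul]
  rw [LinearEquiv.trans_apply, LinearEquiv.trans_apply, h, LinearEquiv.baseChange_tmul,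
    IsBaseChange.equiv_tmul, one_smul]

theorem IsPSLAction.specialize {p : Rˣ} {hp : p ^ 2 = r} (hp' : baseUnit S p ^ 2 = baseUnit S r)
    (hbc : IsBaseChange S (specMap S E r).toLinearMap) {τp τm : VPrime E r ≃ₗ[R] VPrime E r}
    (hτ : IsPSLAction hp (quotRep r u _ hR) τp τm) :
    ∃ σp σm : VPrime E (baseUnit S r) ≃ₗ[S] VPrime E (baseUnit S r),
      IsPSLAction hp' (quotRep _ (baseUnit S u) _ hS) σp σm ∧
      (∀ v, specMap S E r (τp v) = σp (specMap S E r v)) ∧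
      ∀ v, specMap S E r (τm v) = σm (specMap S E r v) := by
  obtain ⟨σp, hσp⟩ := exists_baseChange_equiv hbc τp
  obtain ⟨σm, hσm⟩ := exists_baseChange_equiv hbc τm
  simp only [AlgHom.toLinearMap_apply] at hσp hσm
  have hσm' (v : VPrime E r) : σm.symm (specMap S E r v) = specMap S E r (τm.symm v) := by
    rw [LinearEquiv.symm_apply_eq, ← hσm, LinearEquiv.apply_symm_apply]
  refine ⟨σp, σm, ⟨?_, ?_, ?_⟩, hσp, hσm⟩
  -- Both sides are linear over `S`, so they need only be compared on the image of `specMap`, where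
  -- the relation over `R` is available.
  · refine intertwine_of_gen _ ((quotRep _ _ _ hS).comp (tauPlus _ _ _ hp')) σp.toLinearMap
      fun g => LinearMap.congr_fun (hbc.algHom_ext (σp.toLinearMap ∘ₗ quotRep _ _ _ hS (gen _ _ g))
      ((quotRep _ _ _ hS (tauPlus _ _ _ hp' (gen _ _ g))) ∘ₗ σp.toLinearMap) fun v => ?_)
    simp only [AlgHom.toLinearMap_apply, LinearMap.comp_apply, LinearEquiv.coe_coe]
    rw [← specMap_gen hR hS, ← hσp, ← hσp, hτ.plus, specMap_tauPlus hR hS hp hp']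
  · refine intertwine_of_gen _ ((quotRep _ _ _ hS).comp (tauMinus _ _ _ hp')) σm.toLinearMap
      fun g => LinearMap.congr_fun (hbc.algHom_ext (σm.toLinearMap ∘ₗ quotRep _ _ _ hS (gen _ _ g))
      ((quotRep _ _ _ hS (tauMinus _ _ _ hp' (gen _ _ g))) ∘ₗ σm.toLinearMap) fun v => ?_)
    simp only [AlgHom.toLinearMap_apply, LinearMap.comp_apply, LinearEquiv.coe_coe]
    rw [← specMap_gen hR hS, ← hσm, ← hσm, hτ.minus, specMap_tauMinus hR hS hp hp']
  · refine LinearMap.congr_fun (hbc.algHom_ext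
      (σp.toLinearMap ∘ₗ σm.symm.toLinearMap ∘ₗ σp.toLinearMap)
      (σm.symm.toLinearMap ∘ₗ σp.toLinearMap ∘ₗ σm.symm.toLinearMap) fun v => ?_)
    simp only [AlgHom.toLinearMap_apply, LinearMap.comp_apply, LinearEquiv.coe_coe]
    rw [← hσp, hσm', ← hσp, hσm', ← hσp, hσm', hτ.braid]

end Specialize

/-! ### Evaluation at points -/

section Evaluation

variable {R : Type*} [CommRing R]

/-- Evaluation of Laurent polynomials at `x`. -/
def evX (x : Rˣ) : R[T;T⁻¹] →ₐ[R] R where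
  __ := eval₂ (RingHom.id R) x
  commutes' c := eval₂_C _ _ c

theorem evX_T (x : Rˣ) (k : ℤ) : evX x (T k) = ((x ^ k : Rˣ) : R) := eval₂_T _ _ k

theorem evX_C (x : Rˣ) (c : R) : evX x (C c) = c := eval₂_C _ _ c

theorem evX_opS (x : Rˣ) (f : R[T;T⁻¹]) : evX x (opS f) = evX x⁻¹ f := by
  induction f using LaurentPolynomial.induction_on' with
  | add p q hp hq => rw [map_add, map_add, map_add, hp, hq]
  | C_mul_T n a => rw [map_mul, opS_C, opS_T, map_mul, map_mul, evX_C, evX_C, evX_T, evX_T,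
      inv_zpow']

theorem evX_opPi (r x : Rˣ) (f : R[T;T⁻¹]) : evX x (opPi r f) = evX (r * x⁻¹) f := by
  induction f using LaurentPolynomial.induction_on' with
  | add p q hp hq => rw [map_add, map_add, map_add, hp, hq]
  | C_mul_T n a =>
    rw [map_mul, opPi_C, opPi_T, map_mul, map_mul, map_mul, evX_C, evX_C, evX_C, evX_T, evX_T,
      mul_zpow, inv_zpow', Units.val_mul]

theorem evX_demazure (x : Rˣ) (f : R[T;T⁻¹]) :
    ((x : R) ^ 2 - 1) * evX x (demazure f) = evX x⁻¹ f - evX x f := by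
  have h := congrArg (evX x) (demazure_spec f)
  rw [map_mul, map_sub, map_sub, map_one, evX_T, evX_opS] at h
  rw [← h]
  norm_cast

theorem evX_opT (u x : Rˣ) (f : R[T;T⁻¹]) :
    ((x : R) ^ 2 - 1) * evX x (opT u f) =
      ((u : R) * (x : R) ^ 2 - ((u⁻¹ : Rˣ) : R)) * evX x⁻¹ f -
        ((u : R) - ((u⁻¹ : Rˣ) : R)) * evX x f := by
  rw [opT_apply, ← map_sub, map_add, map_mul, map_mul, evX_C, evX_C, evX_opS]
  linear_combination ((u : R) - ((u⁻¹ : Rˣ) : R)) * evX_demazure x f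

/-- The coefficient `uX² - u⁻¹` of the Demazure part vanishes at `x`. No division by `x² - 1` is
involved, so the formula also covers `x² = 1`. -/
theorem evX_opT_of_sq {u x : Rˣ} (h : u ^ 2 * x ^ 2 = 1) (f : R[T;T⁻¹]) :
    evX x (opT u f) = u * evX x f := by
  have h1 : (u : R) * (x : R) ^ 2 = ((u⁻¹ : Rˣ) : R) := by
    have : u * x ^ 2 = u⁻¹ := by
      rw [eq_inv_iff_mul_eq_one, mul_right_comm, ← pow_two, h]
    rw [← this]
    push_cast
    rfl
  rw [opT_eq, map_add, map_mul, map_mul, map_sub, map_mul, evX_C, evX_C, evX_T]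
  have h2 : ((x ^ (2 : ℤ) : Rˣ) : R) = (x : R) ^ 2 := by norm_cast
  rw [h2, h1, sub_self, zero_mul, add_zero]

/-- All elements of the ideal vanish at `x`. -/
def Vanishes (J : Ideal R[T;T⁻¹]) (x : Rˣ) : Prop := ∀ f ∈ J, evX x f = 0

theorem Vanishes.opPi {r u x : Rˣ} {J : Ideal R[T;T⁻¹]} (hJ : IsStable r u J)
    (h : Vanishes J x) : Vanishes J (r * x⁻¹) := fun f hf => by
  rw [← evX_opPi]
  exact h _ (hJ.opPi_mem hf)

/-- In the formula for the value of `T f` at `x`, everything except the value of `f` at `x⁻¹`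
vanishes, and that value has the coefficient `ux² - u⁻¹`. -/
theorem Vanishes.inv [IsDomain R] {r u x : Rˣ} {J : Ideal R[T;T⁻¹]} (hJ : IsStable r u J)
    (h : Vanishes J x) (hx : u ^ 2 * x ^ 2 ≠ 1) : Vanishes J x⁻¹ := fun f hf => by
  have h1 := evX_opT u x f
  rw [h _ hf, h _ (hJ.opT_mem hf), mul_zero, mul_zero, sub_zero] at h1
  refine (mul_eq_zero.mp h1.symm).resolve_left fun h2 => hx (Units.ext ?_)
  push_cast
  have h3 := Units.mul_inv u
  linear_combination (u : R) * h2 + h3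

end Evaluation

/-! ### The spectrum -/

section Spectrum

variable {R : Type*} [CommRing R]

/-- The eigenvalues of `X`, inverse to those of `Y`. -/
def pt (r u : Rˣ) (m : ℤ) : Rˣ := (eigenY r u m)⁻¹

theorem pt_neg_nat (r u : Rˣ) (k : ℕ) : pt r u (-k) = (u * r ^ k)⁻¹ := by rw [pt, eigenY_neg]

theorem pt_succ (r u : Rˣ) (k : ℕ) : pt r u (k + 1) = u * r ^ (k + 1) := by
  rw [pt, eigenY_pos, inv_inv]

/-- The substitution `x ↦ r x⁻¹` underlying `π` permutes the spectrum by `m ↦ 1 - m`. -/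
theorem pt_one_sub (r u : Rˣ) (m : ℤ) : pt r u (1 - m) = r * (pt r u m)⁻¹ := by
  rcases int_cases_neg_pos m with ⟨k, rfl⟩ | ⟨k, rfl⟩
  · rw [sub_neg_eq_add, add_comm, pt_succ, pt_neg_nat, inv_inv, pow_succ']
    exact mul_left_comm _ _ _
  · have : (1 : ℤ) - (k + 1) = -k := by ring
    rw [this, pt_neg_nat, pt_succ, pow_succ', mul_left_comm, mul_inv_rev r, mul_comm _ r⁻¹,
      mul_inv_cancel_left]

theorem pt_neg (r u : Rˣ) {m : ℤ} (hm : m ≠ 0) : pt r u (-m) = (pt r u m)⁻¹ := by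
  rcases int_cases_neg_pos m with ⟨k, rfl⟩ | ⟨k, rfl⟩
  · obtain ⟨k, rfl⟩ := Nat.exists_eq_succ_of_ne_zero (n := k) (by omega)
    rw [neg_neg, pt_neg_nat, inv_inv, Nat.succ_eq_add_one, Nat.cast_add_one, pt_succ]
  · have h := pt_neg_nat r u (k + 1)
    rw [Nat.cast_add_one] at h
    rw [h, pt_succ]

theorem IsGeneric.isUnit_one_sub {n : ℕ} {r : Rˣ} (hg : IsGeneric n r) {k : ℤ} (hk : k ≠ 0)
    (hk' : |k| < n) : IsUnit (1 - ((r ^ k : Rˣ) : R)) ∧ IsUnit (1 + ((r ^ k : Rˣ) : R)) := by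
  have key : IsUnit ((1 - ((r ^ k : Rˣ) : R)) * (1 + ((r ^ k : Rˣ) : R))) := by
    have h1 : (1 - ((r ^ k : Rˣ) : R)) * (1 + ((r ^ k : Rˣ) : R)) =
        1 - ((r ^ (2 * k) : Rˣ) : R) := by
      rw [mul_comm 2, zpow_mul]
      ring_nf
      norm_cast
    obtain ⟨j, rfl | rfl⟩ := k.eq_nat_or_neg
    · rw [h1]
      have := hg.2 j (by omega) (by simpa using hk')
      rw [← Units.val_pow_eq_pow_val, ← zpow_natCast] at this
      simpa using this
    · have := hg.2 j (by omega) (by simpa using hk')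
      rw [h1]
      have h2 : 1 - ((r ^ (2 * -(j : ℤ)) : Rˣ) : R) =
          -((r ^ (2 * -(j : ℤ)) : Rˣ) : R) * (1 - (r : R) ^ (2 * j)) := by
        have h3 : ((r ^ (2 * -(j : ℤ)) : Rˣ) : R) * (r : R) ^ (2 * j) = 1 := by
          rw [← Units.val_pow_eq_pow_val, ← Units.val_mul, ← zpow_natCast, ← zpow_add]
          push_cast
          rw [mul_neg, neg_add_cancel, zpow_zero, Units.val_one]
        linear_combination (-1 : R) * h3
      rw [h2]
      exact (Units.isUnit _).neg.mul this
  exact ⟨isUnit_of_mul_isUnit_left key, isUnit_of_mul_isUnit_right key⟩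

theorem IsGeneric.isUnit_one_add {n : ℕ} {r : Rˣ} (hg : IsGeneric n r) {k : ℤ}
    (hk' : |k| < n) : IsUnit (1 + ((r ^ k : Rˣ) : R)) := by
  rcases eq_or_ne k 0 with rfl | hk
  · rw [zpow_zero, Units.val_one, one_add_one_eq_two]
    exact hg.1
  · exact (hg.isUnit_one_sub hk hk').2

theorem IsGeneric.isUnit_denomD {n : ℕ} {r u : Rˣ} (hg : IsGeneric n r) (h : u ^ 2 * r ^ n = -1)
    {j : ℕ} (h1 : 0 < j) (h2 : j < n) : IsUnit (denomD r u j) := by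
  rw [denomD_eq h]
  exact hg.isUnit_one_add (abs_lt.mpr ⟨by omega, by omega⟩)

/-- With this the eigenvalues for `-n < m ≤ n` are exactly `±u rⁱ`, `0 ≤ i < n`, which makes them
easy to compare. -/
theorem eigenY_pos_eq {n : ℕ} {r u : Rˣ} (h : u ^ 2 * r ^ n = -1) {k : ℕ} (hk : k + 1 ≤ n) :
    eigenY r u (k + 1) = -(u * r ^ (n - (k + 1))) := by
  rw [eigenY_pos, inv_eq_iff_mul_eq_one, mul_neg, mul_mul_mul_comm, ← pow_add,
    Nat.add_sub_cancel' hk, ← pow_two, h, neg_neg]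

theorem isUnit_sub_aux {n : ℕ} {r : Rˣ} (hg : IsGeneric n r) (u : Rˣ) {a b : ℕ} (hab : a ≠ b)
    (ha : a < n) (hb : b < n) : IsUnit (((u * r ^ a : Rˣ) : R) - ((u * r ^ b : Rˣ) : R)) := by
  have h : ((u * r ^ a : Rˣ) : R) - ((u * r ^ b : Rˣ) : R) =
      ((u * r ^ a : Rˣ) : R) * (1 - ((r ^ (b - a : ℤ) : Rˣ) : R)) := by
    rw [mul_sub, mul_one, ← Units.val_mul, mul_assoc, ← zpow_natCast, ← zpow_natCast, ← zpow_add,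
      add_sub_cancel]
  rw [h]
  exact (Units.isUnit _).mul
    (hg.isUnit_one_sub (by omega) (abs_lt.mpr ⟨by omega, by omega⟩)).1

theorem isUnit_add_aux {n : ℕ} {r : Rˣ} (hg : IsGeneric n r) (u : Rˣ) {a b : ℕ}
    (ha : a < n) (hb : b < n) : IsUnit (((u * r ^ a : Rˣ) : R) + ((u * r ^ b : Rˣ) : R)) := by
  have h : ((u * r ^ a : Rˣ) : R) + ((u * r ^ b : Rˣ) : R) =
      ((u * r ^ a : Rˣ) : R) * (1 + ((r ^ (b - a : ℤ) : Rˣ) : R)) := by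
    rw [mul_add, mul_one, ← Units.val_mul, mul_assoc, ← zpow_natCast, ← zpow_natCast, ← zpow_add,
      add_sub_cancel]
  rw [h]
  exact (Units.isUnit _).mul (hg.isUnit_one_add (abs_lt.mpr ⟨by omega, by omega⟩))

/-- Each difference is a unit times `1 - r^k` with `0 < |k| < n` or `1 + r^k` with `|k| < n`. The
case `1 + r⁰` is where invertibility of `2` is used. -/
theorem IsGeneric.isUnit_eigenY_sub {n : ℕ} {r u : Rˣ} (hg : IsGeneric n r)
    (h : u ^ 2 * r ^ n = -1) {m m' : ℤ} (hm : m ∈ Set.Ioc (-(n : ℤ)) n)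
    (hm' : m' ∈ Set.Ioc (-(n : ℤ)) n) (hne : m ≠ m') :
    IsUnit ((eigenY r u m : R) - (eigenY r u m' : R)) := by
  rw [Set.mem_Ioc] at hm hm'
  rcases int_cases_neg_pos m with ⟨k, rfl⟩ | ⟨k, rfl⟩ <;>
    rcases int_cases_neg_pos m' with ⟨l, rfl⟩ | ⟨l, rfl⟩
  · rw [eigenY_neg, eigenY_neg]
    exact isUnit_sub_aux hg u (by omega) (by omega) (by omega)
  · rw [eigenY_neg, eigenY_pos_eq h (by omega), Units.val_neg, sub_neg_eq_add]
    exact isUnit_add_aux hg u (by omega) (by omega)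
  · rw [eigenY_neg, eigenY_pos_eq h (by omega), Units.val_neg, ← neg_add', IsUnit.neg_iff]
    exact isUnit_add_aux hg u (by omega) (by omega)
  · rw [eigenY_pos_eq h (by omega), eigenY_pos_eq h (by omega), Units.val_neg, Units.val_neg,
      sub_neg_eq_add, neg_add_eq_sub]
    exact isUnit_sub_aux hg u (by omega) (by omega) (by omega)

theorem IsGeneric.isUnit_pt_sub {n : ℕ} {r u : Rˣ} (hg : IsGeneric n r)
    (h : u ^ 2 * r ^ n = -1) {m m' : ℤ} (hm : m ∈ Set.Ioc (-(n : ℤ)) n)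
    (hm' : m' ∈ Set.Ioc (-(n : ℤ)) n) (hne : m ≠ m') :
    IsUnit ((pt r u m : R) - (pt r u m' : R)) := by
  have h1 : (pt r u m : R) - (pt r u m' : R) =
      (pt r u m : R) * (pt r u m' : R) * ((eigenY r u m' : R) - (eigenY r u m : R)) := by
    have h2 := Units.inv_mul (eigenY r u m)
    have h3 := Units.inv_mul (eigenY r u m')
    rw [pt, pt]
    linear_combination (((eigenY r u m')⁻¹ : Rˣ) : R) * h2 - (((eigenY r u m)⁻¹ : Rˣ) : R) * h3
  rw [h1]
  exact ((Units.isUnit _).mul (Units.isUnit _)).mul (hg.isUnit_eigenY_sub h hm' hm hne.symm)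

theorem sq_pt_zero (r u : Rˣ) : u ^ 2 * pt r u 0 ^ 2 = 1 := by
  have h := pt_neg_nat r u 0
  rw [Nat.cast_zero, neg_zero, pow_zero, mul_one] at h
  rw [h, inv_pow, mul_inv_cancel]

/-- The special relation makes `m = n` a second end of the spectrum: `T` acts there as a scalar,
just as at `m = 0`. -/
theorem sq_pt_top {n : ℕ} {r u : Rˣ} (hn : 0 < n) (h : u ^ 2 * r ^ n = -1) :
    u ^ 2 * pt r u n ^ 2 = 1 := by
  obtain ⟨k, rfl⟩ := Nat.exists_eq_succ_of_ne_zero hn.ne'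
  rw [Nat.succ_eq_add_one, Nat.cast_add_one, pt_succ, u_mul_pow h, neg_sq, inv_pow, mul_inv_cancel]

theorem sq_pt {n : ℕ} {r u : Rˣ} (h : u ^ 2 * r ^ n = -1) (k : ℕ) :
    u ^ 2 * (u * r ^ k) ^ 2 = r ^ (2 * (k - n : ℤ)) := by
  have h1 : r ^ n * u ^ 2 = -1 := by rw [mul_comm, h]
  rw [mul_comm 2, zpow_mul, zpow_sub, zpow_natCast, zpow_natCast, ← div_eq_mul_inv, zpow_ofNat, div_pow,
    eq_div_iff_mul_eq', mul_comm]
  have : (r ^ n) ^ 2 * (u ^ 2 * (u * r ^ k) ^ 2) = (r ^ n * u ^ 2) ^ 2 * (r ^ k) ^ 2 := by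
    rw [mul_pow u, mul_pow, ← mul_assoc (u ^ 2), ← pow_two (u ^ 2), mul_assoc]
  rw [this, h1, neg_sq, one_pow, one_mul]

/-- Away from the two ends the step `x ↦ x⁻¹` is never blocked. -/
theorem IsGeneric.sq_pt_ne {n : ℕ} [Nontrivial R] {r u : Rˣ} (hg : IsGeneric n r)
    (h : u ^ 2 * r ^ n = -1) {m : ℤ} (hm0 : m ≠ 0) (hm : |m| < n) : u ^ 2 * pt r u m ^ 2 ≠ 1 := by
  rw [abs_lt] at hm
  have key (k : ℤ) (hk : k ≠ 0) (hk' : |k| < n) : r ^ (2 * k) ≠ 1 := by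
    intro h0
    have h1 := hg.isUnit_one_sub hk hk'
    have h2 := h1.1.mul h1.2
    have h3 : ((r ^ k : Rˣ) : R) * ((r ^ k : Rˣ) : R) = 1 := by
      rw [← Units.val_mul, ← zpow_add, ← two_mul, h0, Units.val_one]
    have h4 : (1 - ((r ^ k : Rˣ) : R)) * (1 + ((r ^ k : Rˣ) : R)) = 0 := by
      linear_combination -h3
    rw [h4] at h2
    exact not_isUnit_zero h2
  rcases int_cases_neg_pos m with ⟨k, rfl⟩ | ⟨k, rfl⟩
  · rw [pt_neg_nat, inv_pow, Ne, mul_inv_eq_one]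
    intro h0
    refine key k (by omega) (abs_lt.mpr ⟨by omega, by omega⟩) ?_
    rw [mul_pow, left_eq_mul, ← pow_mul] at h0
    rw [mul_comm, ← Nat.cast_ofNat, ← Nat.cast_mul, zpow_natCast, h0]
  · rw [pt_succ, sq_pt h]
    exact key _ (by omega) (abs_lt.mpr ⟨by omega, by omega⟩)

/-- These are the denominators in the formula for the values of `T f` at the interior points. -/
theorem IsGeneric.isUnit_sq_pt_sub_one {n : ℕ} {r u : Rˣ} (hg : IsGeneric n r)
    (h : u ^ 2 * r ^ n = -1) {m : ℤ} (hm0 : m ≠ 0) (hm : |m| < n) :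
    IsUnit ((pt r u m : R) ^ 2 - 1) := by
  have key (k : ℕ) (hk : k + 1 < n) : IsUnit ((pt r u (k + 1) : R) ^ 2 - 1) := by
    have h1 : (pt r u (k + 1) : R) ^ 2 - 1 = -denomD r u (k + 1) := by
      rw [pt_succ, denomD]
      push_cast
      ring
    rw [h1, IsUnit.neg_iff]
    exact hg.isUnit_denomD h (by omega) hk
  rw [abs_lt] at hm
  rcases lt_or_gt_of_ne hm0 with h0 | h0
  · obtain ⟨k, hk⟩ : ∃ k : ℕ, -m = k + 1 := ⟨(-m - 1).natAbs, by omega⟩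
    have h1 := key k (by omega)
    rw [← hk, pt_neg r u hm0] at h1
    have h2 : (pt r u m : R) ^ 2 - 1 = -((pt r u m : R) ^ 2 * ((((pt r u m)⁻¹ : Rˣ) : R) ^ 2 - 1)) := by
      rw [mul_sub, ← mul_pow, Units.mul_inv]
      ring
    rw [h2, IsUnit.neg_iff]
    exact ((Units.isUnit _).pow 2).mul h1
  · obtain ⟨k, rfl⟩ : ∃ k : ℕ, m = k + 1 := ⟨(m - 1).natAbs, by omega⟩
    exact key k (by omega)

theorem evX_linFactor {x c : Rˣ} (h : x ^ 2 = -c) : evX x (linFactor (c : R)) = 0 := by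
  have h1 : (c : R) = -(x : R) ^ 2 := by
    rw [← Units.val_pow_eq_pow_val, h, Units.val_neg, neg_neg]
  rw [linFactor, map_add, map_mul, evX_T, evX_C, evX_T, zpow_one, zpow_neg_one, h1]
  have h2 := Units.mul_inv x
  linear_combination (-(x : R)) * h2

theorem evX_polyE_of_sq {x r : Rˣ} {n i : ℕ} (hi : i < n) (h : x ^ 2 = -r ^ (2 * i + 2 - n : ℤ)) :
    evX x (polyE r n) = 0 := by
  rw [polyE, map_mul, map_prod, Finset.prod_eq_zero (Finset.mem_range.mpr hi) (evX_linFactor h),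
    mul_zero]

theorem sq_unit_eq {r u : Rˣ} {n : ℕ} (h : u ^ 2 * r ^ n = -1) (k : ℕ) :
    (u * r ^ k) ^ 2 = -r ^ (2 * k - n : ℤ) := by
  have h1 : u ^ 2 = -(r ^ (-n : ℤ)) := by
    rw [zpow_neg, zpow_natCast, eq_comm, ← mul_left_inj (r ^ n), h, neg_mul, inv_mul_cancel]
  rw [mul_pow, h1, neg_mul, ← pow_mul, ← zpow_natCast, ← zpow_add]
  congr 2
  push_cast
  ring

theorem evX_polyE {r u : Rˣ} {n : ℕ} (h : u ^ 2 * r ^ n = -1) {m : ℤ}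
    (hm : m ∈ Set.Ioc (-(n : ℤ)) n) : evX (pt r u m) (polyE r n) = 0 := by
  rw [Set.mem_Ioc] at hm
  rcases int_cases_neg_pos m with ⟨k, rfl⟩ | ⟨k, rfl⟩
  -- The factor with index `i` has two opposite roots among the points, those indexed by `i + 1` and
  -- `i + 1 - n`.
  · refine evX_polyE_of_sq (i := n - 1 - k) (by omega) ?_
    rw [pt_neg_nat, inv_pow, sq_unit_eq h, inv_neg, ← zpow_neg]
    congr 2
    omega
  · refine evX_polyE_of_sq (i := k) (by omega) ?_
    rw [pt_succ, sq_unit_eq h]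
    congr 2

/-- The evaluation of elements of the quotient at the points of the spectrum. -/
def evV {r u : Rˣ} {n : ℕ} (h : u ^ 2 * r ^ n = -1) :
    VPrime (specE n) r →ₐ[R] (Set.Ioc (-(n : ℤ)) n → R) :=
  Ideal.Quotient.liftₐ _ (AlgHom.pi fun m => evX (pt r u m)) fun f hf => by
    rw [idealE_specE, Ideal.mem_span_singleton] at hf
    obtain ⟨g, rfl⟩ := hf
    funext m
    rw [AlgHom.pi_apply, map_mul, evX_polyE h m.2, zero_mul, Pi.zero_apply]

theorem evV_mk {r u : Rˣ} {n : ℕ} (h : u ^ 2 * r ^ n = -1) (f : R[T;T⁻¹])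
    (m : Set.Ioc (-(n : ℤ)) n) : evV h (Ideal.Quotient.mk _ f) m = evX (pt r u m) f := rfl

/-- The Lagrange interpolation polynomial. -/
def lagrangePoly (r u : Rˣ) {n : ℕ} (m : Set.Ioc (-(n : ℤ)) n) : R[T;T⁻¹] :=
  ∏ j ∈ Finset.univ.erase m,
    C (Ring.inverse ((pt r u m : R) - (pt r u j : R))) * (T 1 - C (pt r u j : R))

theorem evX_lagrangePoly {r u : Rˣ} {n : ℕ} (hg : IsGeneric n r) (h : u ^ 2 * r ^ n = -1)
    (m m' : Set.Ioc (-(n : ℤ)) n) :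
    evX (pt r u m') (lagrangePoly r u m) = if m = m' then 1 else 0 := by
  rw [lagrangePoly, map_prod]
  simp_rw [map_mul, map_sub, evX_C, evX_T, zpow_one]
  split_ifs with hmm
  · subst hmm
    refine Finset.prod_eq_one fun j hj => Ring.inverse_mul_cancel _ ?_
    exact hg.isUnit_pt_sub h m.2 j.2 fun h0 => (Finset.ne_of_mem_erase hj) (Subtype.ext h0).symm
  · refine Finset.prod_eq_zero (Finset.mem_erase.mpr ⟨fun h0 => hmm h0.symm, Finset.mem_univ m'⟩) ?_
    rw [sub_self, mul_zero]

/-- Lagrange interpolation works over any ring in which the differences of the points are units. -/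
theorem evV_surjective {r u : Rˣ} {n : ℕ} (hg : IsGeneric n r) (h : u ^ 2 * r ^ n = -1) :
    Function.Surjective (evV h) := fun a => by
  refine ⟨Ideal.Quotient.mk _ (∑ m, C (a m) * lagrangePoly r u m), funext fun m' => ?_⟩
  rw [evV_mk, map_sum]
  simp_rw [map_mul, evX_C, evX_lagrangePoly hg h, mul_ite, mul_one, mul_zero]
  rw [Finset.sum_ite_eq', if_pos (Finset.mem_univ _)]

/-- Source and target are free of the same finite rank, and a surjective endomorphism of a finite
module is injective. -/
theorem evV_injective {r u : Rˣ} {n : ℕ} (hg : IsGeneric n r) (h : u ^ 2 * r ^ n = -1) :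
    Function.Injective (evV h) := by
  let e := (monomialBasis r n).equivFun
  have h1 := OrzechProperty.injective_of_surjective_endomorphism
    ((evV h).toLinearMap ∘ₗ e.symm.toLinearMap)
    ((evV_surjective hg h).comp e.symm.surjective)
  intro v w hvw
  have h2 := @h1 (e v) (e w)
  simp only [LinearMap.comp_apply, LinearEquiv.coe_coe, LinearEquiv.symm_apply_apply,
    AlgHom.toLinearMap_apply] at h2
  exact e.injective (h2 hvw)

/-- The identification of `V'` with the functions on the spectrum. -/
def evEquiv {r u : Rˣ} {n : ℕ} (hg : IsGeneric n r) (h : u ^ 2 * r ^ n = -1) :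
    VPrime (specE n) r ≃ₗ[R] (Set.Ioc (-(n : ℤ)) n → R) :=
  LinearEquiv.ofBijective (evV h).toLinearMap ⟨evV_injective hg h, evV_surjective hg h⟩

theorem evEquiv_mk {r u : Rˣ} {n : ℕ} (hg : IsGeneric n r) (h : u ^ 2 * r ^ n = -1) (f : R[T;T⁻¹])
    (m : Set.Ioc (-(n : ℤ)) n) :
    evEquiv hg h (Ideal.Quotient.mk _ f) m = evX (pt r u m) f := rfl

theorem isDiagonalizable_X {r u : Rˣ} {n : ℕ} (hg : IsGeneric n r) (h : u ^ 2 * r ^ n = -1)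
    (hE : IsStable r u (idealE (specE n) r)) :
    IsDiagonalizable (quotRep r u _ hE (gen r u Gen.X)) := by
  have key (v : VPrime (specE n) r) (m : Set.Ioc (-(n : ℤ)) n) :
      evEquiv hg h (quotRep r u _ hE (gen r u Gen.X) v) m = pt r u m * evEquiv hg h v m := by
    obtain ⟨f, rfl⟩ := Ideal.Quotient.mk_surjective v
    rw [quotRep_X, evEquiv_mk, evEquiv_mk, map_mul, evX_T, zpow_one]
  refine ⟨_, Module.Basis.ofEquivFun (evEquiv hg h), fun m => (pt r u m : R), fun m => ?_⟩
  rw [Module.Basis.coe_ofEquivFun]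
  refine (evEquiv hg h).injective (funext fun m' => ?_)
  rw [key, map_smul, LinearEquiv.apply_symm_apply, Pi.smul_apply, smul_eq_mul]
  by_cases hm : m' = m
  · rw [hm]
  · rw [Pi.single_eq_of_ne hm, mul_zero, mul_zero]

end Spectrum

/-! ### Irreducibility -/

section Irreducible

variable {K : Type*} [Field K] {r u : Kˣ} {n : ℕ}

/-- The points form a chain `0, 1, -1, 2, -2, …, -(n-1), n` whose links are alternately `π : m ↔ 1 -
m` and inversion `m ↔ -m`. Vanishing of a stable ideal propagates along every link, in both
directions. -/
theorem Vanishes.all {J : Ideal K[T;T⁻¹]} (hJ : IsStable r u J) (hg : IsGeneric n r)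
    (h : u ^ 2 * r ^ n = -1) {m : ℤ} (hm : m ∈ Set.Ioc (-(n : ℤ)) n)
    (hv : Vanishes J (pt r u m)) {m' : ℤ} (hm' : m' ∈ Set.Ioc (-(n : ℤ)) n) :
    Vanishes J (pt r u m') := by
  have hpi (k : ℕ) : Vanishes J (pt r u (-k)) ↔ Vanishes J (pt r u (k + 1)) := by
    have e1 : (k + 1 : ℤ) = 1 - -k := by ring
    have e2 : (-k : ℤ) = 1 - (k + 1) := by ring
    refine ⟨fun h0 => ?_, fun h0 => ?_⟩
    · rw [e1, pt_one_sub]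
      exact h0.opPi hJ
    · rw [e2, pt_one_sub]
      exact h0.opPi hJ
  have hs (k : ℕ) (hk : k + 1 < n) :
      Vanishes J (pt r u (k + 1)) ↔ Vanishes J (pt r u (-(k + 1 : ℤ))) := by
    have hk' : |(k + 1 : ℤ)| < n := abs_lt.mpr ⟨by omega, by omega⟩
    refine ⟨fun h0 => ?_, fun h0 => ?_⟩
    · rw [pt_neg r u (by omega)]
      exact h0.inv hJ (hg.sq_pt_ne h (by omega) hk')
    · have h1 := h0.inv hJ (hg.sq_pt_ne h (by omega) (by rwa [abs_neg]))
      rwa [← pt_neg r u (by omega), neg_neg] at h1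
  have hz (k : ℕ) (hk : k < n) : Vanishes J (pt r u 0) ↔ Vanishes J (pt r u (-k)) := by
    induction k with
    | zero => rw [Nat.cast_zero, neg_zero]
    | succ k ih =>
      rw [ih (by omega), hpi, hs k hk]
      push_cast
      rfl
  have hall {m : ℤ} (hm : m ∈ Set.Ioc (-(n : ℤ)) n) :
      Vanishes J (pt r u 0) ↔ Vanishes J (pt r u m) := by
    rw [Set.mem_Ioc] at hm
    rcases int_cases_neg_pos m with ⟨k, rfl⟩ | ⟨k, rfl⟩
    · exact hz k (by omega)
    · exact (hz k (by omega)).trans (hpi k)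
  exact (hall hm').mp ((hall hm).mpr hv)

/-- A stable ideal containing the special polynomial is generated by it or trivial. -/
theorem eq_of_isStable {J : Ideal K[T;T⁻¹]} (hJ : IsStable r u J) (hg : IsGeneric n r)
    (h : u ^ 2 * r ^ n = -1) (hle : idealE (specE n) r ≤ J) : J = idealE (specE n) r ∨ J = ⊤ := by
  by_cases hv : ∃ m : Set.Ioc (-(n : ℤ)) n, Vanishes J (pt r u m)
  · left
    obtain ⟨m, hm⟩ := hv
    refine le_antisymm (fun f hf => ?_) hle
    rw [← Ideal.Quotient.eq_zero_iff_mem]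
    refine evV_injective hg h (funext fun m' => ?_)
    rw [evV_mk, map_zero]
    exact hm.all hJ hg h m.2 m'.2 f hf
  · right
    simp only [Vanishes, not_exists, not_forall] at hv
    choose f hf hf0 using hv
    rw [Ideal.eq_top_iff_one]
    -- Rescaled elements of `J`, nonzero at the various points and cut out by Lagrange polynomials,
    -- add up to a function equal to `1` on the whole spectrum.
    have h1 : ∑ m : Set.Ioc (-(n : ℤ)) n, C ((evX (pt r u m) (f m))⁻¹) * lagrangePoly r u m * f m ∈ J :=
      J.sum_mem fun m _ => J.mul_mem_left _ (hf m)
    have h2 : 1 - ∑ m : Set.Ioc (-(n : ℤ)) n, C ((evX (pt r u m) (f m))⁻¹) * lagrangePoly r u m * f m ∈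
        idealE (specE n) r := by
      rw [← Ideal.Quotient.eq_zero_iff_mem]
      refine evV_injective hg h (funext fun m' => ?_)
      rw [evV_mk, map_zero, map_sub, map_one, map_sum]
      simp_rw [map_mul, evX_C, evX_lagrangePoly hg h, mul_ite, mul_one, mul_zero, ite_mul, zero_mul]
      rw [Finset.sum_ite_eq', if_pos (Finset.mem_univ _), inv_mul_cancel₀ (hf0 m'), sub_self]
      rfl
    have h3 := J.add_mem (hle h2) h1
    rwa [sub_add_cancel] at h3

/-- The ideal of a submodule that is stable under the action. -/
theorem exists_ideal_of_invariant {R : Type*} [CommRing R] {r u : Rˣ} {I : Ideal R[T;T⁻¹]}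
    (hI : IsStable r u I)
    (W : Submodule R (R[T;T⁻¹] ⧸ I)) (hW : ∀ h, ∀ w ∈ W, quotRep r u I hI h w ∈ W) :
    ∃ J : Ideal R[T;T⁻¹], IsStable r u J ∧ ∀ f, f ∈ J ↔ Ideal.Quotient.mk I f ∈ W := by
  refine ⟨{ carrier := {f | Ideal.Quotient.mk I f ∈ W}
            add_mem' := fun {a b} ha hb => by
              simp only [Set.mem_ofPred_eq, map_add] at *
              exact W.add_mem ha hb
            zero_mem' := by
              simp only [Set.mem_ofPred_eq, map_zero]
              exact W.zero_mem
            smul_mem' := fun c f hf => ?_ }, fun h f hf => hW h _ hf, fun f => Iff.rfl⟩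
  simp only [Set.mem_ofPred_eq, smul_eq_mul] at *
  -- Invariance under `X` and `X⁻¹` is what turns a submodule into an ideal.
  have hT (k : ℕ) : ∀ f, Ideal.Quotient.mk I f ∈ W →
      Ideal.Quotient.mk I (T k * f) ∈ W ∧ Ideal.Quotient.mk I (T (-k) * f) ∈ W := by
    induction k with
    | zero => intro f hf; simpa using hf
    | succ k ih =>
      intro f hf
      have h1 := hW (gen r u Gen.X) _ hf
      have h2 := hW (gen r u Gen.Xi) _ hf
      rw [quotRep_X] at h1
      rw [quotRep_Xi] at h2
      have h3 := (ih _ h1).1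
      have h4 := (ih _ h2).2
      rw [← mul_assoc, T_mul_T] at h3 h4
      push_cast
      rw [neg_add]
      exact ⟨h3, h4⟩
  induction c using LaurentPolynomial.induction_on' with
  | add p q hp hq =>
    rw [add_mul, map_add]
    exact W.add_mem hp hq
  | C_mul_T k a =>
    rw [mul_assoc, ← smul_eq_C_mul]
    suffices h : Ideal.Quotient.mk I (T k * f) ∈ W from W.smul_mem a h
    obtain ⟨j, rfl | rfl⟩ := k.eq_nat_or_neg
    · exact (hT j f hf).1
    · exact (hT j f hf).2

theorem isIrreducibleRep_specE (hn : 0 < n) (hE : IsStable r u (idealE (specE n) r))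
    (h : u ^ 2 * r ^ n = -1) (hg : IsGeneric n r) : IsIrreducibleRep (quotRep r u _ hE) := by
  refine ⟨?_, fun W hW => ?_⟩
  · have : Nonempty (Set.Ioc (-(n : ℤ)) n) := ⟨⟨0, by simpa using hn, by simp⟩⟩
    exact (evV_surjective hg h).nontrivial
  · obtain ⟨J, hJ, hJW⟩ := exists_ideal_of_invariant hE W hW
    have hle : idealE (specE n) r ≤ J := fun f hf => by
      rw [hJW, Ideal.Quotient.eq_zero_iff_mem.mpr hf]
      exact W.zero_mem
    rcases eq_of_isStable hJ hg h hle with h0 | h0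
    · left
      refine (Submodule.eq_bot_iff _).mpr fun v hv => ?_
      obtain ⟨f, rfl⟩ := Ideal.Quotient.mk_surjective v
      rw [← hJW, h0] at hv
      exact Ideal.Quotient.eq_zero_iff_mem.mpr hv
    · right
      refine Submodule.eq_top_iff'.mpr fun v => ?_
      obtain ⟨f, rfl⟩ := Ideal.Quotient.mk_surjective v
      rw [← hJW, h0]
      exact Submodule.mem_top

/-- A stable ideal whose quotient is irreducible contains every stable ideal with which it
has a proper sum. -/
theorem le_of_isIrreducibleRep {J : Ideal K[T;T⁻¹]} (hJ : IsStable r u J)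
    (hirr : IsIrreducibleRep (quotRep r u J hJ)) {I : Ideal K[T;T⁻¹]} (hI : IsStable r u I)
    (hIJ : I ⊔ J ≠ ⊤) : I ≤ J := by
  let π : K[T;T⁻¹] →ₗ[K] K[T;T⁻¹] ⧸ J := (Ideal.Quotient.mkₐ K J).toLinearMap
  -- The image of `I` in the irreducible quotient is zero or everything; in the second case `I` and
  -- `J` are comaximal.
  rcases hirr.2 ((I.restrictScalars K).map π) (by
    rintro h _ ⟨f, hf, rfl⟩
    exact ⟨_, hI h f hf, rfl⟩) with h0 | h0
  · intro f hf
    have h1 : π f ∈ (I.restrictScalars K).map π := ⟨f, hf, rfl⟩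
    rw [h0, Submodule.mem_bot] at h1
    exact Ideal.Quotient.eq_zero_iff_mem.mp h1
  · exfalso
    have h1 : π 1 ∈ (I.restrictScalars K).map π := by
      rw [h0]
      exact Submodule.mem_top
    obtain ⟨f, hf, hf1⟩ := h1
    have h2 : 1 - f ∈ J := by
      rw [← Ideal.Quotient.eq_zero_iff_mem, map_sub, sub_eq_zero]
      exact hf1.symm
    refine hIJ ((Ideal.eq_top_iff_one _).mpr ?_)
    have h3 := Ideal.add_mem (I ⊔ J) (Ideal.mem_sup_left hf) (Ideal.mem_sup_right h2)
    rwa [add_sub_cancel] at h3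

end Irreducible

/-! ### The action on the nonsymmetric Macdonald polynomials -/

section MacdonaldAction

variable {R : Type*} [CommRing R]

theorem X_opPi_X_opPi (r : Rˣ) (f : R[T;T⁻¹]) :
    T 1 * opPi r (T 1 * opPi r f) = C (r : R) * f := by
  have h3 : (T 1 * T (-1) : R[T;T⁻¹]) = 1 := by rw [T_mul_T, add_neg_cancel, T_zero]
  rw [map_mul, opPi_T, opPi_opPi, zpow_one]
  linear_combination (C (r : R) * f) * h3

theorem X_opPi_eMac (r u : Rˣ) (m : ℤ) :
    T 1 * opPi r (eMac r u m) = C ((r ^ m : Rˣ) : R) * eMac r u (1 - m) := by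
  have key (k : ℕ) : T 1 * opPi r (eNeg r u k) = C ((r ^ (-k : ℤ) : Rˣ) : R) * ePos r u k := by
    rw [ePos, ← mul_assoc, ← map_mul, ← Units.val_pow_eq_pow_val, ← Units.val_mul, zpow_neg,
      zpow_natCast, inv_mul_cancel, Units.val_one, map_one, one_mul]
  rcases int_cases_neg_pos m with ⟨k, rfl⟩ | ⟨k, rfl⟩
  · have e : (1 : ℤ) - -k = k + 1 := by ring
    rw [e, eMac_neg, eMac_pos, key]
  · have e : (1 : ℤ) - (k + 1) = -k := by ring
    rw [e, eMac_neg, eMac_pos, ePos, opPi_C_mul, mul_left_comm, X_opPi_X_opPi, ← mul_assoc,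
      ← map_mul]
    congr 2
    rw [← pow_succ]
    norm_cast

/-- The ratio of the norms of `e_{-k}` and `e_k`. -/
def normRatio (r u : Rˣ) (k : ℕ) : R :=
  1 - coefA r u k * ((u : R) - ((u⁻¹ : Rˣ) : R)) - coefA r u k ^ 2

theorem opT_ePos (r u : Rˣ) (k : ℕ) : opT u (ePos r u k) =
    C ((u⁻¹ : Rˣ) : R) * eNeg r u (k + 1) - C (coefA r u (k + 1)) * ePos r u k := by
  rw [eNeg_succ]
  linear_combination (-opT u (ePos r u k) - C (coefA r u (k + 1)) * ePos r u k) * C_unit_aux u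

/-- `e_{-k-1}` is a combination of `e_{k+1}` and its image under `T`, so the quadratic relation of
`T` closes the two-dimensional span. -/
theorem opT_eNeg_succ (r u : Rˣ) (k : ℕ) : opT u (eNeg r u (k + 1)) =
    C ((u : R) - ((u⁻¹ : Rˣ) : R) + coefA r u (k + 1)) * eNeg r u (k + 1) +
      C ((u : R) * normRatio r u (k + 1)) * ePos r u k := by
  have h1 := opT_ePos r u k
  have h2 := opT_opT u (ePos r u k)
  have h3 : eNeg r u (k + 1) =
      C (u : R) * opT u (ePos r u k) + C (u : R) * C (coefA r u (k + 1)) * ePos r u k := by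
    rw [eNeg_succ]
    ring
  rw [h3, map_add, opT_C_mul, mul_assoc, opT_C_mul, opT_C_mul, h2, normRatio]
  simp only [map_sub, map_add, map_mul, map_one, map_pow]
  ring

/-- Identifies the product of off-diagonal entries of `T` with the factor by which the prescribed
norms of `e_{-k}` and `e_k` differ; this is why those norms make `T` unitary. -/
theorem normRatio_mul {r u : Rˣ} {k : ℕ} (h : IsUnit (denomD r u k)) :
    normRatio r u k * denomD r u k ^ 2 =
      (1 - (r : R) ^ (2 * k)) * (1 - (r : R) ^ (2 * k) * (u : R) ^ 4) := by
  have h1 := coefA_mul h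
  have h2 := Units.mul_inv u
  have h3 : normRatio r u k * denomD r u k ^ 2 = denomD r u k ^ 2 +
      ((u : R) - ((u⁻¹ : Rˣ) : R)) ^ 2 * denomD r u k - ((u : R) - ((u⁻¹ : Rˣ) : R)) ^ 2 := by
    rw [normRatio]
    linear_combination (-((u : R) - ((u⁻¹ : Rˣ) : R)) * denomD r u k -
      (coefA r u k * denomD r u k - ((u : R) - ((u⁻¹ : Rˣ) : R)))) * h1
  rw [h3, denomD]
  generalize (r : R) ^ (2 * k) = Q
  generalize ((u⁻¹ : Rˣ) : R) = w at *
  linear_combination (2 * Q * u ^ 2 - Q * (u * w + 1)) * h2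

theorem opT_one (u : Rˣ) : opT u (1 : R[T;T⁻¹]) = C (u : R) := by
  have h : demazure (1 : R[T;T⁻¹]) = 0 := by
    apply cancel_aux
    rw [demazure_spec, map_one, sub_self, mul_zero]
  rw [opT_apply, h, mul_zero, add_zero, map_one, mul_one]

end MacdonaldAction

theorem intertwine_inv {R V W : Type*} [CommRing R] [AddCommGroup V] [Module R V] [AddCommGroup W]
    [Module R W] {A Ai : Module.End R V} {B Bi : Module.End R W} (hA : A * Ai = 1)
    (hB : Bi * B = 1) (τ : V →ₗ[R] W) (H : ∀ v, τ (A v) = B (τ v)) (v : V) :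
    τ (Ai v) = Bi (τ v) := by
  have h1 := congrArg Bi (H (Ai v))
  rw [← Module.End.mul_apply A, hA, ← Module.End.mul_apply Bi, hB] at h1
  exact h1.symm

/-! ### The basis of Macdonald polynomials and Schur's lemma -/

section EBasis

variable {R : Type*} [CommRing R] {r u : Rˣ} {n : ℕ}

theorem IsGeneric.isUnit_denomD_of_mem (hg : IsGeneric n r) (h : u ^ 2 * r ^ n = -1) {m : ℤ}
    (hm : m ∈ Set.Ioc (-(n : ℤ)) n) (j : ℕ) (h1 : 1 ≤ j) (h2 : j < tildeAbs m) :
    IsUnit (denomD r u j) := by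
  refine hg.isUnit_denomD h h1 ?_
  rw [Set.mem_Ioc] at hm
  rw [tildeAbs] at h2
  split_ifs at h2 <;> omega

/-- Only unitriangularity matters, in the order `X⁰, X, X⁻¹, X², X⁻², …`. Leading coefficients are
`1` even where a denominator is not invertible, so no genericity is needed. -/
theorem span_eMac (r u : Rˣ) (n : ℕ) (W : Submodule R (VPrime (specE n) r))
    (hW : ∀ m ∈ Set.Ioc (-(n : ℤ)) n, Ideal.Quotient.mk _ (eMac r u m) ∈ W) : W = ⊤ := by
  let L : R[T;T⁻¹] →ₗ[R] VPrime (specE n) r :=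
    (Ideal.Quotient.mkₐ R (idealE (specE n) r)).toLinearMap
  have hstep {m a b : ℤ} (hm : m ∈ Set.Ioc (-(n : ℤ)) n) (hs : SuppIn (eMac r u m - T m) a b)
      (hl : ∀ j, a ≤ j → j ≤ b → L (T j) ∈ W) : L (T m) ∈ W := by
    have h1 := map_mem_of_suppIn L W hl hs
    rw [map_sub] at h1
    exact (W.sub_mem_iff_right (hW m hm)).mp h1
  have hpos (k : ℕ) : SuppIn (eMac r u (k + 1) - T (k + 1)) (-k) k := fun j hj => by
    rw [eMac_pos, AddMonoidAlgebra.coeff_sub, Finsupp.sub_apply, T_apply] at hj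
    by_cases hjk : (k + 1 : ℤ) = j
    · rw [if_pos hjk, ← hjk, coeff_ePos (coeff_eNeg r u k), sub_self] at hj
      exact absurd rfl hj
    · rw [if_neg hjk, sub_zero] at hj
      have := (SuppIn.eNeg r u k).ePos j hj
      omega
  have hneg (k : ℕ) : SuppIn (eMac r u (-k) - T (-k)) (-k + 1) k := fun j hj => by
    rw [eMac_neg, AddMonoidAlgebra.coeff_sub, Finsupp.sub_apply, T_apply] at hj
    by_cases hjk : (-k : ℤ) = j
    · rw [if_pos hjk, ← hjk, coeff_eNeg, sub_self] at hj
      exact absurd rfl hj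
    · rw [if_neg hjk, sub_zero] at hj
      have := SuppIn.eNeg r u k j hj
      omega
  have hall (k : ℕ) (hk : k < n) : ∀ j : ℤ, -(k : ℤ) ≤ j → j ≤ k + 1 → L (T j) ∈ W := by
    induction k with
    | zero =>
      have h0 : L (T 0) ∈ W := by
        have h1 := hstep (m := 0) (a := 1) (b := 0) ⟨by omega, by omega⟩
          (by simpa using hneg 0) (fun j h1 h2 => by omega)
        exact h1
      have h1 : L (T 1) ∈ W := hstep (m := 1) (a := 0) (b := 0) ⟨by omega, by omega⟩
        (by simpa using hpos 0) (fun j h1 h2 => by rwa [show j = 0 by omega])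
      intro j h2 h3
      rcases (by push_cast at h2 h3; omega : j = 0 ∨ j = 1) with rfl | rfl
      · exact h0
      · exact h1
    | succ k ih =>
      have ih := ih (by omega)
      have h0 : L (T (-(k + 1 : ℕ))) ∈ W := hstep ⟨by omega, by omega⟩ (hneg (k + 1))
        fun j h1 h2 => ih j (by push_cast at h1; omega) (by push_cast at h2; omega)
      have h1 : L (T ((k + 1 : ℕ) + 1)) ∈ W := hstep ⟨by omega, by omega⟩ (hpos (k + 1))
        fun j h1 h2 => by
          by_cases hj : j = -(k + 1 : ℕ)
          · rw [hj]; exact h0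
          · exact ih j (by push_cast at h1 hj; omega) (by push_cast at h2; omega)
      intro j h2 h3
      by_cases hj : j = -(k + 1 : ℕ)
      · rw [hj]; exact h0
      · by_cases hj' : j = (k + 1 : ℕ) + 1
        · rw [hj']; exact h1
        · exact ih j (by push_cast at h2 hj; omega) (by push_cast at h3 hj'; omega)
  rw [eq_top_iff, ← (monomialBasis r n).span_eq, Submodule.span_le]
  rintro _ ⟨m, rfl⟩
  rw [monomialBasis_apply]
  have hm := m.2
  rw [Set.mem_Ioc] at hm
  exact hall (n - 1) (by omega) m (by omega) (by omega)

theorem exists_eBasis (r u : Rˣ) (n : ℕ) :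
    ∃ b : Module.Basis (Set.Ioc (-(n : ℤ)) n) R (VPrime (specE n) r),
      ∀ m, b m = Ideal.Quotient.mk _ (eMac r u m) := by
  let φ : VPrime (specE n) r →ₗ[R] VPrime (specE n) r :=
    (monomialBasis r n).constr R fun m => Ideal.Quotient.mk _ (eMac r u m)
  have hφ (m) : φ (monomialBasis r n m) = Ideal.Quotient.mk _ (eMac r u m) :=
    (monomialBasis r n).constr_basis R _ m
  have hsurj : Function.Surjective φ := by
    rw [← LinearMap.range_eq_top]
    exact span_eMac r u n _ fun m hm => ⟨_, hφ ⟨m, hm⟩⟩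
  have : Module.Finite R (VPrime (specE n) r) := Module.Finite.of_basis (monomialBasis r n)
  have hinj := OrzechProperty.injective_of_surjective_endomorphism φ hsurj
  exact ⟨(monomialBasis r n).map (LinearEquiv.ofBijective φ ⟨hinj, hsurj⟩), fun m => by
    rw [Module.Basis.map_apply]
    exact hφ m⟩

/-- The basis of the images of the nonsymmetric Macdonald polynomials. -/
def eBasis (r u : Rˣ) (n : ℕ) : Module.Basis (Set.Ioc (-(n : ℤ)) n) R (VPrime (specE n) r) :=
  (exists_eBasis r u n).choose

/-- The image of a nonsymmetric Macdonald polynomial. -/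
def vE (r u : Rˣ) (n : ℕ) (m : ℤ) : VPrime (specE n) r := Ideal.Quotient.mk _ (eMac r u m)

theorem eBasis_apply (r u : Rˣ) (n : ℕ) (m : Set.Ioc (-(n : ℤ)) n) :
    eBasis r u n m = vE r u n m := (exists_eBasis r u n).choose_spec m

theorem mk_C_mul (E : ℤ[T;T⁻¹][T;T⁻¹]) (r : Rˣ) (c : R) (f : R[T;T⁻¹]) :
    (Ideal.Quotient.mk (idealE E r) (C c * f) : VPrime E r) = c • Ideal.Quotient.mk _ f := by
  rw [← smul_eq_C_mul]
  rfl

variable (hE : IsStable r u (idealE (specE n) r))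

theorem quotRep_Y_vE (hg : IsGeneric n r) (h : u ^ 2 * r ^ n = -1) {m : ℤ}
    (hm : m ∈ Set.Ioc (-(n : ℤ)) n) :
    quotRep r u _ hE (gen r u Gen.Y) (vE r u n m) = (eigenY r u m : R) • vE r u n m := by
  rw [vE, quotRep_Y, ← opY_eq, (isMacdonald_eMac (hg.isUnit_denomD_of_mem h hm)).1, smul_eq_C_mul,
    mk_C_mul]

theorem isDiagonalizable_Y (hg : IsGeneric n r) (h : u ^ 2 * r ^ n = -1) :
    IsDiagonalizable (quotRep r u _ hE (gen r u Gen.Y)) :=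
  ⟨_, eBasis r u n, fun m => (eigenY r u m : R), fun m => by
    rw [eBasis_apply, quotRep_Y_vE hE hg h m.2]⟩

/-- The operator `X π` on the quotient. -/
def quotPi : Module.End R (VPrime (specE n) r) :=
  quotRep r u _ hE (gen r u Gen.X * gen r u Gen.Y * gen r u Gen.Ti)

theorem quotPi_mk (f : R[T;T⁻¹]) :
    quotPi hE (Ideal.Quotient.mk _ f) = Ideal.Quotient.mk _ (T 1 * opPi r f) := by
  rw [quotPi, map_mul, map_mul, Module.End.mul_apply, Module.End.mul_apply, quotRep_Ti, quotRep_Y,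
    quotRep_X, opT_opTi]

theorem quotPi_vE (m : ℤ) :
    quotPi hE (vE r u n m) = ((r ^ m : Rˣ) : R) • vE r u n (1 - m) := by
  rw [vE, quotPi_mk, X_opPi_eMac, mk_C_mul, vE]

theorem quotRep_T_vE_zero :
    quotRep r u _ hE (gen r u Gen.T) (vE r u n 0) = (u : R) • vE r u n 0 := by
  have h := eMac_neg r u 0
  rw [Nat.cast_zero, neg_zero, eNeg_zero] at h
  rw [vE, quotRep_T, h, opT_one, ← mk_C_mul, mul_one]

theorem quotRep_T_vE_pos (k : ℕ) :
    quotRep r u _ hE (gen r u Gen.T) (vE r u n (k + 1)) =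
      ((u⁻¹ : Rˣ) : R) • vE r u n (-(k + 1)) - coefA r u (k + 1) • vE r u n (k + 1) := by
  have h := eMac_neg r u (k + 1)
  rw [Nat.cast_add_one] at h
  rw [vE, quotRep_T, eMac_pos, opT_ePos, map_sub, mk_C_mul, mk_C_mul, vE, h]

theorem quotRep_T_vE_neg (k : ℕ) :
    quotRep r u _ hE (gen r u Gen.T) (vE r u n (-(k + 1))) =
      ((u : R) - ((u⁻¹ : Rˣ) : R) + coefA r u (k + 1)) • vE r u n (-(k + 1)) +
        ((u : R) * normRatio r u (k + 1)) • vE r u n (k + 1) := by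
  have h := eMac_neg r u (k + 1)
  rw [Nat.cast_add_one] at h
  rw [vE, quotRep_T, h, opT_eNeg_succ, map_add, mk_C_mul, mk_C_mul, vE, eMac_pos]

theorem quotRep_T_T (v : VPrime (specE n) r) :
    quotRep r u _ hE (gen r u Gen.T) (quotRep r u _ hE (gen r u Gen.T) v) =
      ((u : R) - ((u⁻¹ : Rˣ) : R)) • quotRep r u _ hE (gen r u Gen.T) v + v := by
  obtain ⟨f, rfl⟩ := Ideal.Quotient.mk_surjective v
  rw [quotRep_T, quotRep_T, opT_opT, map_add, ← map_sub, mk_C_mul]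

theorem quotRep_Ti_eq (v : VPrime (specE n) r) :
    quotRep r u _ hE (gen r u Gen.Ti) v =
      quotRep r u _ hE (gen r u Gen.T) v - ((u : R) - ((u⁻¹ : Rˣ) : R)) • v := by
  obtain ⟨f, rfl⟩ := Ideal.Quotient.mk_surjective v
  rw [quotRep_Ti, quotRep_T, opTi_apply, map_sub, ← map_sub C, mk_C_mul]

theorem smul_vE_zero_injective (hn : 0 < n) {a b : R}
    (hab : a • vE r u n 0 = b • vE r u n 0) : a = b := by
  have h0 : (0 : ℤ) ∈ Set.Ioc (-(n : ℤ)) n := ⟨by omega, by omega⟩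
  have h1 := congrArg (fun v => (eBasis r u n).repr v ⟨0, h0⟩) hab
  have h2 : vE r u n 0 = eBasis r u n ⟨0, h0⟩ := (eBasis_apply r u n ⟨0, h0⟩).symm
  simpa [h2] using h1

variable [IsDomain R]

/-- Over a domain an eigenvector of `Y` only involves basis vectors with the same eigenvalue. -/
theorem repr_eq_zero_of_eigen (hg : IsGeneric n r) (h : u ^ 2 * r ^ n = -1)
    {w : VPrime (specE n) r} {c : R} (hw : quotRep r u _ hE (gen r u Gen.Y) w = c • w)
    (m : Set.Ioc (-(n : ℤ)) n) (hm : (eigenY r u m : R) ≠ c) : (eBasis r u n).repr w m = 0 := by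
  have h1 : (eBasis r u n).repr (quotRep r u _ hE (gen r u Gen.Y) w) m =
      eigenY r u m * (eBasis r u n).repr w m := by
    conv_lhs => rw [← (eBasis r u n).sum_repr w, map_sum, map_sum]
    simp_rw [map_smul, eBasis_apply]
    rw [Finset.sum_congr rfl fun i _ => by
      rw [quotRep_Y_vE hE hg h i.2, ← eBasis_apply, map_smul, Module.Basis.repr_self]]
    simp only [Finsupp.coe_finsetSum, Finset.sum_apply, Finsupp.smul_apply, Finsupp.single_apply,
      smul_eq_mul, mul_ite, mul_one, mul_zero]
    rw [Finset.sum_ite_eq', if_pos (Finset.mem_univ _), mul_comm]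
  rw [hw, map_smul, Finsupp.smul_apply, smul_eq_mul] at h1
  have h2 : (c - eigenY r u m) * (eBasis r u n).repr w m = 0 := by rw [sub_mul, h1, sub_self]
  exact (mul_eq_zero.mp h2).resolve_left fun h3 => hm (sub_eq_zero.mp h3).symm

/-- Endomorphisms that commute with `X` and `Y` are scalar. -/
theorem exists_smul_of_commute (hn : 0 < n) (hg : IsGeneric n r) (h : u ^ 2 * r ^ n = -1)
    (φ : VPrime (specE n) r →ₗ[R] VPrime (specE n) r)
    (hX : ∀ v, φ (quotRep r u _ hE (gen r u Gen.X) v) = quotRep r u _ hE (gen r u Gen.X) (φ v))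
    (hY : ∀ v, φ (quotRep r u _ hE (gen r u Gen.Y) v) = quotRep r u _ hE (gen r u Gen.Y) (φ v)) :
    ∃ c : R, ∀ v, φ v = c • v := by
  have h0 : (0 : ℤ) ∈ Set.Ioc (-(n : ℤ)) n := ⟨by omega, by omega⟩
  -- The image of `e_0 = 1` is an eigenvector of `Y` for a simple eigenvalue, hence a multiple of
  -- `1`. As `1` generates the module under `X^{±1}`, this determines the endomorphism.
  have h1 : φ (vE r u n 0) = (eBasis r u n).repr (φ (vE r u n 0)) ⟨0, h0⟩ • vE r u n 0 := by
    have h2 : quotRep r u _ hE (gen r u Gen.Y) (φ (vE r u n 0)) =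
        (eigenY r u 0 : R) • φ (vE r u n 0) := by
      rw [← hY, quotRep_Y_vE hE hg h h0, map_smul]
    conv_lhs => rw [← (eBasis r u n).sum_repr (φ (vE r u n 0))]
    rw [Finset.sum_eq_single ⟨0, h0⟩, eBasis_apply]
    · intro m _ hm
      rw [repr_eq_zero_of_eigen hE hg h h2 m, zero_smul]
      have h3 := (hg.isUnit_eigenY_sub h m.2 h0 fun h4 => hm (Subtype.ext h4)).ne_zero
      exact sub_ne_zero.mp h3
    · exact fun h3 => absurd (Finset.mem_univ _) h3
  have hone : vE r u n 0 = Ideal.Quotient.mk _ (T 0) := by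
    have h := eMac_neg r u 0
    rw [Nat.cast_zero, neg_zero, eNeg_zero] at h
    rw [vE, h, T_zero]
  generalize (eBasis r u n).repr (φ (vE r u n 0)) ⟨0, h0⟩ = c at h1
  rw [hone] at h1
  have hXi (v : VPrime (specE n) r) : φ (quotRep r u _ hE (gen r u Gen.Xi) v) =
      quotRep r u _ hE (gen r u Gen.Xi) (φ v) := by
    refine intertwine_inv ?_ ?_ φ hX v
    · rw [← map_mul, (gen_rels r u).1, map_one]
    · rw [← map_mul, (gen_rels r u).2.1, map_one]
  have hT (k : ℕ) : φ (Ideal.Quotient.mk _ (T k)) = c • Ideal.Quotient.mk _ (T k) ∧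
      φ (Ideal.Quotient.mk _ (T (-k))) = c • Ideal.Quotient.mk _ (T (-k)) := by
    induction k with
    | zero => exact ⟨h1, h1⟩
    | succ k ih =>
      have e1 : (T ((k + 1 : ℕ) : ℤ) : R[T;T⁻¹]) = T 1 * T k := by
        rw [T_mul_T]; congr 1; push_cast; ring
      have e2 : (T (-(k + 1 : ℕ) : ℤ) : R[T;T⁻¹]) = T (-1) * T (-k) := by
        rw [T_mul_T]; congr 1; push_cast; ring
      rw [e1, e2, ← quotRep_X hE, ← quotRep_Xi hE, hX, hXi, ih.1, ih.2, map_smul, map_smul]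
      exact ⟨rfl, rfl⟩
  refine ⟨c, LinearMap.congr_fun (g := c • LinearMap.id) ((monomialBasis r n).ext fun m => ?_)⟩
  rw [monomialBasis_apply, LinearMap.smul_apply, LinearMap.id_apply]
  obtain ⟨k, hk | hk⟩ := (m : ℤ).eq_nat_or_neg
  · rw [hk]; exact (hT k).1
  · rw [hk]; exact (hT k).2

theorem exists_unit_of_commute (hn : 0 < n) (hg : IsGeneric n r) (h : u ^ 2 * r ^ n = -1)
    (φ : VPrime (specE n) r ≃ₗ[R] VPrime (specE n) r)
    (hX : ∀ v, φ (quotRep r u _ hE (gen r u Gen.X) v) = quotRep r u _ hE (gen r u Gen.X) (φ v))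
    (hY : ∀ v, φ (quotRep r u _ hE (gen r u Gen.Y) v) = quotRep r u _ hE (gen r u Gen.Y) (φ v)) :
    ∃ c : Rˣ, ∀ v, φ v = (c : R) • v := by
  obtain ⟨c, hc⟩ := exists_smul_of_commute hE hn hg h φ.toLinearMap hX hY
  obtain ⟨d, hd⟩ := exists_smul_of_commute hE hn hg h φ.symm.toLinearMap
    (fun v => by
      rw [LinearEquiv.coe_coe, LinearEquiv.symm_apply_eq, hX, LinearEquiv.apply_symm_apply])
    (fun v => by
      rw [LinearEquiv.coe_coe, LinearEquiv.symm_apply_eq, hY, LinearEquiv.apply_symm_apply])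
  simp only [LinearEquiv.coe_coe] at hc hd
  have hcd : c * d = 1 := by
    apply smul_vE_zero_injective (r := r) (u := u) hn
    rw [mul_smul, ← hd, ← hc, LinearEquiv.apply_symm_apply, one_smul]
  exact ⟨⟨c, d, hcd, by rw [mul_comm, hcd]⟩, hc⟩

/-- The image of `e_n` is an eigenvector of `T`. -/
theorem exists_quotRep_T_vE_top (hn : 0 < n) (hg : IsGeneric n r) (h : u ^ 2 * r ^ n = -1) :
    ∃ μ : R, quotRep r u _ hE (gen r u Gen.T) (vE r u n n) = μ • vE r u n n ∧
      (μ = u ∨ μ = -((u⁻¹ : Rˣ) : R)) := by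
  have h0 : (0 : ℤ) ∈ Set.Ioc (-(n : ℤ)) n := ⟨by omega, by omega⟩
  have hn' : (n : ℤ) ∈ Set.Ioc (-(n : ℤ)) n := ⟨by omega, by omega⟩
  -- The claim is that `w = (T - u) e_n` is a multiple of `e_n`. It is an eigenvector of `Y` with
  -- eigenvalue `-u⁻¹`, and this leaves only the components along `e_0` and `e_n`.
  obtain ⟨w, hw⟩ : ∃ w, w = quotRep r u _ hE (gen r u Gen.T) (vE r u n n) - (u : R) • vE r u n n :=
    ⟨_, rfl⟩
  have hlam : eigenY r u n = -u := by
    obtain ⟨k, rfl⟩ := Nat.exists_eq_succ_of_ne_zero hn.ne'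
    rw [Nat.succ_eq_add_one, Nat.cast_add_one, eigenY_pos, u_mul_pow h, inv_neg, inv_inv]
  have hYw : quotRep r u _ hE (gen r u Gen.Y) w = (-((u⁻¹ : Rˣ) : R)) • w := by
    have h1 := (isMacdonald_eMac (hg.isUnit_denomD_of_mem h hn')).1
    have h2 := opY_opT h1
    rw [hlam, inv_neg, Units.val_neg, Units.val_neg] at h2
    rw [hlam, Units.val_neg] at h1
    have h3 : w = Ideal.Quotient.mk _ (opT u (eMac r u n) - C (u : R) * eMac r u n) := by
      rw [hw, vE, quotRep_T, map_sub, mk_C_mul]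
    rw [h3, quotRep_Y, ← opY_eq, ← mk_C_mul, map_sub, ← smul_eq_C_mul (u : R), map_smul, h1, h2]
    congr 1
    simp only [smul_eq_C_mul, map_neg]
    ring
  have hother (m : Set.Ioc (-(n : ℤ)) n) (hm0 : (m : ℤ) ≠ 0) (hmn : (m : ℤ) ≠ n) :
      (eBasis r u n).repr w m = 0 := by
    refine repr_eq_zero_of_eigen hE hg h hYw m fun h1 => ?_
    have h2 : eigenY r u m = u * r ^ n := by
      rw [u_mul_pow h]
      exact Units.ext h1
    obtain ⟨m, hm⟩ := m
    rw [Set.mem_Ioc] at hm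
    simp only at h2 hm0 hmn
    have hne : |(n : ℤ) - m.natAbs| < n := abs_lt.mpr ⟨by omega, by omega⟩
    rcases int_cases_neg_pos m with ⟨k, rfl⟩ | ⟨k, rfl⟩
    · rw [eigenY_neg, mul_right_inj] at h2
      have h3 := (hg.isUnit_one_sub (k := n - k) (by omega)
        (abs_lt.mpr ⟨by omega, by omega⟩)).1
      rw [zpow_sub, zpow_natCast, zpow_natCast, ← h2, mul_inv_cancel, Units.val_one, sub_self] at h3
      exact not_isUnit_zero h3
    · rw [eigenY_pos_eq h (by omega), ← mul_neg, mul_right_inj] at h2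
      have h3 := (hg.isUnit_one_sub (k := (k + 1 : ℕ)) (by omega)
        (abs_lt.mpr ⟨by omega, by omega⟩)).2
      have h4 : r ^ (k + 1) = -1 := by
        have h5 : r ^ n = r ^ (n - (k + 1)) * r ^ (k + 1) := by
          rw [← pow_add, Nat.sub_add_cancel (by omega)]
        rw [h5, ← mul_neg_one, mul_right_inj] at h2
        exact h2.symm
      rw [zpow_natCast, h4, Units.val_neg, Units.val_one, add_neg_cancel] at h3
      exact not_isUnit_zero h3
  have hsum : w = (eBasis r u n).repr w ⟨0, h0⟩ • vE r u n 0 +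
      (eBasis r u n).repr w ⟨n, hn'⟩ • vE r u n n := by
    conv_lhs => rw [← (eBasis r u n).sum_repr w]
    rw [Finset.sum_eq_add (⟨0, h0⟩ : Set.Ioc (-(n : ℤ)) n) ⟨n, hn'⟩, eBasis_apply, eBasis_apply]
    · intro h1
      have := congrArg Subtype.val h1
      simp only at this
      omega
    · rintro m - ⟨h1, h2⟩
      rw [hother m (fun h3 => h1 (Subtype.ext h3)) (fun h3 => h2 (Subtype.ext h3)), zero_smul]
    · exact fun h1 => absurd (Finset.mem_univ _) h1
    · exact fun h1 => absurd (Finset.mem_univ _) h1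
  -- If the `e_0`-component were nonzero, distinctness of the eigenvalues would remove the other one
  -- and `w` would be a constant. But `w` vanishes at the point `m = 0`, where `T` is the scalar
  -- `u`.
  have hc0 : (eBasis r u n).repr w ⟨0, h0⟩ = 0 := by
    by_contra hne
    have h1 : (eigenY r u 0 : R) = -((u⁻¹ : Rˣ) : R) := by
      by_contra h2
      exact hne (repr_eq_zero_of_eigen hE hg h hYw ⟨0, h0⟩ h2)
    have h2 : (eBasis r u n).repr w ⟨n, hn'⟩ = 0 := by
      refine repr_eq_zero_of_eigen hE hg h hYw ⟨n, hn'⟩ fun h3 => ?_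
      exact (hg.isUnit_eigenY_sub h h0 hn' (by omega)).ne_zero (by rw [h1, ← h3, sub_self])
    rw [h2, zero_smul, add_zero] at hsum
    have h3 := congrArg (fun v => evV h v ⟨0, h0⟩) hsum
    have h4 : eMac r u 0 = 1 := by
      have h := eMac_neg r u 0
      rwa [Nat.cast_zero, neg_zero, eNeg_zero] at h
    generalize (eBasis r u n).repr w ⟨0, h0⟩ = c at h3 hne
    simp only [map_smul, Pi.smul_apply] at h3
    rw [vE, evV_mk, h4, map_one, smul_eq_mul, mul_one, hw, vE, quotRep_T, ← mk_C_mul, ← map_sub,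
      evV_mk, map_sub, evX_opT_of_sq (sq_pt_zero r u), map_mul, evX_C, sub_self] at h3
    exact hne h3.symm
  rw [hc0, zero_smul, zero_add] at hsum
  set d := (eBasis r u n).repr w ⟨n, hn'⟩
  have hT : quotRep r u _ hE (gen r u Gen.T) (vE r u n n) = ((u : R) + d) • vE r u n n := by
    rw [add_smul, ← hsum, hw]
    abel
  refine ⟨u + d, hT, ?_⟩
  -- The quadratic relation leaves only the two roots as possible eigenvalues.
  have h1 := quotRep_T_T hE (vE r u n n)
  rw [hT, map_smul, hT, smul_smul, smul_smul, ← one_smul R (vE r u n n), smul_smul, smul_smul,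
    ← add_smul, mul_one, mul_one] at h1
  have h2 : (u + d) * (u + d) = (u - ((u⁻¹ : Rˣ) : R)) * (u + d) + 1 := by
    have h3 : vE r u n n = eBasis r u n ⟨n, hn'⟩ := (eBasis_apply r u n ⟨n, hn'⟩).symm
    have h4 := congrArg (fun v => (eBasis r u n).repr v ⟨n, hn'⟩) h1
    simpa [h3] using h4
  have h3 : ((u : R) + d - u) * ((u : R) + d + ((u⁻¹ : Rˣ) : R)) = 0 := by
    linear_combination h2 - Units.mul_inv u
  rcases mul_eq_zero.mp h3 with h4 | h4
  · exact Or.inl (by linear_combination h4)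
  · exact Or.inr (by linear_combination h4)

end EBasis

/-! ### The action of the projective `PSL₂(ℤ)` -/

section Gaussian

variable {R : Type*} [CommRing R]

/-- The values of the Gaussian on the spectrum. -/
def gauss (p u : Rˣ) (m : ℤ) : Rˣ := u ^ m.natAbs * p ^ (m.natAbs ^ 2)

theorem gauss_neg (p u : Rˣ) (m : ℤ) : gauss p u (-m) = gauss p u m := by
  rw [gauss, gauss, Int.natAbs_neg]

/-- The functional equation of the Gaussian, responsible for the factor `q^{-1/4} X` in `τ₊(Y)` and,
in the dual picture, for `q^{1/4} Y` in `τ₋(X)`. -/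
theorem gauss_one_sub {p r : Rˣ} (hp : p ^ 2 = r) (u : Rˣ) (m : ℤ) :
    gauss p u m * p = pt r u m * gauss p u (1 - m) := by
  have key (k : ℕ) : gauss p u (k + 1) * p = u * r ^ (k + 1) * gauss p u (-k) := by
    have e : (k + 1 : ℤ).natAbs = k + 1 := rfl
    rw [gauss_neg, gauss, gauss, e, Int.natAbs_natCast, ← hp, ← pow_mul, pow_succ u, mul_assoc,
      mul_assoc (u ^ k) u, mul_left_comm (u ^ k), mul_assoc u, mul_left_comm (p ^ _),
      ← pow_add, ← pow_succ]
    congr 3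
    ring
  rcases int_cases_neg_pos m with ⟨k, rfl⟩ | ⟨k, rfl⟩
  · have e : (1 : ℤ) - -k = k + 1 := by ring
    rw [e, pt_neg_nat, ← mul_right_inj (u * r ^ k), mul_inv_cancel_left, ← mul_left_inj p, key,
      pow_succ, ← hp, pow_two]
    simp only [mul_assoc, mul_comm, mul_left_comm]
  · have e : (1 : ℤ) - (k + 1) = -k := by ring
    rw [e, pt_succ, key]

end Gaussian

section Intertwiners

variable {R : Type*} [CommRing R] {r u : Rˣ}

theorem intertwine_of_XYT {V W : Type*} [AddCommGroup V] [Module R V] [AddCommGroup W] [Module R W]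
    (ρ : Daha r u →ₐ[R] Module.End R V) (ρ' : Daha r u →ₐ[R] Module.End R W) (τ : V →ₗ[R] W)
    (hX : ∀ v, τ (ρ (gen r u Gen.X) v) = ρ' (gen r u Gen.X) (τ v))
    (hY : ∀ v, τ (ρ (gen r u Gen.Y) v) = ρ' (gen r u Gen.Y) (τ v))
    (hT : ∀ v, τ (ρ (gen r u Gen.T) v) = ρ' (gen r u Gen.T) (τ v)) (h : Daha r u) (v : V) :
    τ (ρ h v) = ρ' h (τ v) := by
  obtain ⟨h1, h2, h3, h4, h5, h6, -⟩ := gen_rels r u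
  have hinv {g g' : Daha r u} (ha : g * g' = 1) (hb : g' * g = 1)
      (H : ∀ v, τ (ρ g v) = ρ' g (τ v)) (v : V) : τ (ρ g' v) = ρ' g' (τ v) :=
    intertwine_inv (by rw [← map_mul, ha, map_one]) (by rw [← map_mul, hb, map_one]) τ H v
  refine intertwine_of_gen ρ ρ' τ (fun g => ?_) h v
  cases g
  · exact hX
  · exact hinv h1 h2 hX
  · exact hY
  · exact hinv h3 h4 hY
  · exact hT
  · exact hinv h5 h6 hT

end Intertwiners

/-! ### Realization of `tauPlus` in functions on the spectrum -/

section TauPlus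

variable {R : Type*} [CommRing R] {r u : Rˣ} {n : ℕ}
    (hE : IsStable r u (idealE (specE n) r))

theorem evEquiv_X (hg : IsGeneric n r) (h : u ^ 2 * r ^ n = -1) (v : VPrime (specE n) r)
    (m : Set.Ioc (-(n : ℤ)) n) :
    evEquiv hg h (quotRep r u _ hE (gen r u Gen.X) v) m = pt r u m * evEquiv hg h v m := by
  obtain ⟨f, rfl⟩ := Ideal.Quotient.mk_surjective v
  rw [quotRep_X, evEquiv_mk, evEquiv_mk, map_mul, evX_T, zpow_one]

theorem one_sub_mem {m : ℤ} (hm : m ∈ Set.Ioc (-(n : ℤ)) n) : 1 - m ∈ Set.Ioc (-(n : ℤ)) n := by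
  rw [Set.mem_Ioc] at *
  omega

theorem evEquiv_Y (hg : IsGeneric n r) (h : u ^ 2 * r ^ n = -1) (v : VPrime (specE n) r)
    (m : Set.Ioc (-(n : ℤ)) n) :
    evEquiv hg h (quotRep r u _ hE (gen r u Gen.Y) v) m =
      evEquiv hg h (quotRep r u _ hE (gen r u Gen.T) v) ⟨1 - m, one_sub_mem m.2⟩ := by
  obtain ⟨f, rfl⟩ := Ideal.Quotient.mk_surjective v
  rw [quotRep_Y, quotRep_T, evEquiv_mk, evEquiv_mk, evX_opPi, pt_one_sub]

theorem neg_mem {m : ℤ} (hm : m ∈ Set.Ioc (-(n : ℤ)) n) (hmn : m ≠ n) :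
    -m ∈ Set.Ioc (-(n : ℤ)) n := by
  rw [Set.mem_Ioc] at *
  omega

theorem evEquiv_T (hg : IsGeneric n r) (h : u ^ 2 * r ^ n = -1) (v : VPrime (specE n) r)
    (m : Set.Ioc (-(n : ℤ)) n) (hm0 : (m : ℤ) ≠ 0) (hmn : (m : ℤ) ≠ n) :
    ((pt r u m : R) ^ 2 - 1) * evEquiv hg h (quotRep r u _ hE (gen r u Gen.T) v) m =
      ((u : R) * (pt r u m : R) ^ 2 - ((u⁻¹ : Rˣ) : R)) * evEquiv hg h v ⟨-m, neg_mem m.2 hmn⟩ -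
        ((u : R) - ((u⁻¹ : Rˣ) : R)) * evEquiv hg h v m := by
  obtain ⟨f, rfl⟩ := Ideal.Quotient.mk_surjective v
  rw [quotRep_T, evEquiv_mk, evEquiv_mk, evEquiv_mk, evX_opT, pt_neg r u hm0]

theorem evEquiv_T_end (hn : 0 < n) (hg : IsGeneric n r) (h : u ^ 2 * r ^ n = -1)
    (v : VPrime (specE n) r) (m : Set.Ioc (-(n : ℤ)) n) (hm : (m : ℤ) = 0 ∨ (m : ℤ) = n) :
    evEquiv hg h (quotRep r u _ hE (gen r u Gen.T) v) m = u * evEquiv hg h v m := by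
  obtain ⟨f, rfl⟩ := Ideal.Quotient.mk_surjective v
  rw [quotRep_T, evEquiv_mk, evEquiv_mk, evX_opT_of_sq]
  rcases hm with hm | hm
  · rw [hm, sq_pt_zero]
  · rw [hm, sq_pt_top hn h]

/-- Multiplication by the Gaussian. -/
def gaussMul (hg : IsGeneric n r) (h : u ^ 2 * r ^ n = -1) (p : Rˣ) :
    VPrime (specE n) r ≃ₗ[R] VPrime (specE n) r :=
  ((evEquiv hg h).trans (LinearEquiv.piCongrRight fun m : Set.Ioc (-(n : ℤ)) n =>
    LinearEquiv.smulOfUnit (gauss p u m))).trans (evEquiv hg h).symm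

theorem evEquiv_gaussMul (hg : IsGeneric n r) (h : u ^ 2 * r ^ n = -1) (p : Rˣ)
    (v : VPrime (specE n) r) (m : Set.Ioc (-(n : ℤ)) n) :
    evEquiv hg h (gaussMul hg h p v) m = gauss p u m * evEquiv hg h v m := by
  rw [gaussMul, LinearEquiv.trans_apply, LinearEquiv.apply_symm_apply]
  rfl

/-- `T` relates only the values at `m` and `-m`, where the Gaussian agrees, and it is a scalar at
the ends. At interior points the unit `pt² - 1` is cancelled. -/
theorem gaussMul_T (hn : 0 < n) (hg : IsGeneric n r) (h : u ^ 2 * r ^ n = -1) (p : Rˣ)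
    (v : VPrime (specE n) r) :
    gaussMul hg h p (quotRep r u _ hE (gen r u Gen.T) v) =
      quotRep r u _ hE (gen r u Gen.T) (gaussMul hg h p v) := by
  refine (evEquiv hg h).injective (funext fun m => ?_)
  rw [evEquiv_gaussMul]
  by_cases hm : (m : ℤ) = 0 ∨ (m : ℤ) = n
  · rw [evEquiv_T_end hE hn hg h _ m hm, evEquiv_T_end hE hn hg h _ m hm, evEquiv_gaussMul]
    ring
  · rw [not_or] at hm
    have hm2 := m.2
    rw [Set.mem_Ioc] at hm2
    apply (hg.isUnit_sq_pt_sub_one h hm.1 (abs_lt.mpr ⟨hm2.1, by omega⟩)).mul_left_cancel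
    rw [mul_left_comm, evEquiv_T hE hg h _ m hm.1 hm.2, evEquiv_T hE hg h _ m hm.1 hm.2,
      evEquiv_gaussMul, evEquiv_gaussMul, gauss_neg]
    ring

theorem gaussMul_intertwines (hn : 0 < n) (hg : IsGeneric n r) (h : u ^ 2 * r ^ n = -1) {p : Rˣ}
    (hp : p ^ 2 = r) (a : Daha r u) (v : VPrime (specE n) r) :
    gaussMul hg h p (quotRep r u _ hE a v) =
      quotRep r u _ hE (tauPlus p r u hp a) (gaussMul hg h p v) := by
  refine intertwine_of_XYT (quotRep r u _ hE) ((quotRep r u _ hE).comp (tauPlus p r u hp))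
    (gaussMul hg h p).toLinearMap (fun v => ?_) (fun v => ?_) (fun v => ?_) a v
  · rw [AlgHom.comp_apply, tauPlus_gen, LinearEquiv.coe_coe]
    refine (evEquiv hg h).injective (funext fun m => ?_)
    rw [evEquiv_gaussMul, evEquiv_X, evEquiv_X, evEquiv_gaussMul]
    ring
  · rw [AlgHom.comp_apply, tauPlus_gen, LinearEquiv.coe_coe]
    refine (evEquiv hg h).injective (funext fun m => ?_)
    simp only [map_smul, map_mul, LinearMap.smul_apply, Module.End.mul_apply, Pi.smul_apply,
      smul_eq_mul]
    rw [evEquiv_gaussMul, evEquiv_X, evEquiv_Y, evEquiv_Y, ← gaussMul_T hE hn hg h, evEquiv_gaussMul]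
    have h1 := congrArg Units.val (gauss_one_sub hp u m)
    rw [Units.val_mul, Units.val_mul] at h1
    have h2 := Units.inv_mul p
    linear_combination (((p⁻¹ : Rˣ) : R) * evEquiv hg h (quotRep r u _ hE (gen r u Gen.T) v)
      ⟨1 - m, one_sub_mem m.2⟩) * h1 - (gauss p u m *
      evEquiv hg h (quotRep r u _ hE (gen r u Gen.T) v) ⟨1 - m, one_sub_mem m.2⟩) * h2
  · rw [AlgHom.comp_apply, tauPlus_gen, LinearEquiv.coe_coe]
    exact gaussMul_T hE hn hg h p v

end TauPlus

/-! ### Realization of `tauMinus` in the Macdonald basis -/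

section TauMinus

variable {R : Type*} [CommRing R] {r u : Rˣ} {n : ℕ}
    (hE : IsStable r u (idealE (specE n) r))

/-- The operator that is diagonal on the nonsymmetric Macdonald polynomials, with the inverse
values of the Gaussian as eigenvalues. -/
def gaussDiag (p r u : Rˣ) (n : ℕ) : VPrime (specE n) r ≃ₗ[R] VPrime (specE n) r :=
  ((eBasis r u n).equivFun.trans (LinearEquiv.piCongrRight fun m : Set.Ioc (-(n : ℤ)) n =>
    LinearEquiv.smulOfUnit (gauss p u m)⁻¹)).trans (eBasis r u n).equivFun.symm

theorem gaussDiag_vE (p : Rˣ) {m : ℤ} (hm : m ∈ Set.Ioc (-(n : ℤ)) n) :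
    gaussDiag p r u n (vE r u n m) = (((gauss p u m)⁻¹ : Rˣ) : R) • vE r u n m := by
  have h1 : vE r u n m = eBasis r u n ⟨m, hm⟩ := (eBasis_apply r u n ⟨m, hm⟩).symm
  rw [h1, gaussDiag, LinearEquiv.trans_apply, LinearEquiv.trans_apply, LinearEquiv.symm_apply_eq,
    map_smul]
  funext j
  rw [LinearEquiv.piCongrRight_apply, Pi.smul_apply, Module.Basis.equivFun_self]
  by_cases hj : (⟨m, hm⟩ : Set.Ioc (-(n : ℤ)) n) = j
  · subst hj; rfl
  · rw [if_neg hj, map_zero, smul_zero]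

theorem eBasis_ext {W : Type*} [AddCommGroup W] [Module R W] {φ ψ : VPrime (specE n) r →ₗ[R] W}
    (H : ∀ m ∈ Set.Ioc (-(n : ℤ)) n, φ (vE r u n m) = ψ (vE r u n m)) (v : VPrime (specE n) r) :
    φ v = ψ v :=
  LinearMap.congr_fun ((eBasis r u n).ext fun m => by rw [eBasis_apply, H m m.2]) v

theorem gaussDiag_Y (hg : IsGeneric n r) (h : u ^ 2 * r ^ n = -1) (p : Rˣ)
    (v : VPrime (specE n) r) :
    gaussDiag p r u n (quotRep r u _ hE (gen r u Gen.Y) v) =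
      quotRep r u _ hE (gen r u Gen.Y) (gaussDiag p r u n v) := by
  refine eBasis_ext (r := r) (u := u) (n := n)
    (φ := (gaussDiag p r u n).toLinearMap ∘ₗ quotRep r u _ hE (gen r u Gen.Y))
    (ψ := quotRep r u _ hE (gen r u Gen.Y) ∘ₗ (gaussDiag p r u n).toLinearMap) (fun m hm => ?_) v
  simp only [LinearMap.comp_apply, LinearEquiv.coe_coe]
  rw [quotRep_Y_vE hE hg h hm, map_smul, gaussDiag_vE p hm, map_smul, quotRep_Y_vE hE hg h hm,
    smul_comm]

/-- Dual to `gaussMul_T`: `T` mixes only `e_m` and `e_{-m}`, while `e_0` and `e_n` are eigenvectors.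
The latter, which has no partner `e_{-n}`, relies on `exists_quotRep_T_vE_top`. -/
theorem gaussDiag_T [IsDomain R] (hn : 0 < n) (hg : IsGeneric n r) (h : u ^ 2 * r ^ n = -1)
    (p : Rˣ) (v : VPrime (specE n) r) :
    gaussDiag p r u n (quotRep r u _ hE (gen r u Gen.T) v) =
      quotRep r u _ hE (gen r u Gen.T) (gaussDiag p r u n v) := by
  refine eBasis_ext (r := r) (u := u) (n := n)
    (φ := (gaussDiag p r u n).toLinearMap ∘ₗ quotRep r u _ hE (gen r u Gen.T))
    (ψ := quotRep r u _ hE (gen r u Gen.T) ∘ₗ (gaussDiag p r u n).toLinearMap) (fun m hm => ?_) v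
  simp only [LinearMap.comp_apply, LinearEquiv.coe_coe]
  rw [gaussDiag_vE p hm, map_smul]
  rcases eq_or_ne m 0 with rfl | hm0
  · rw [quotRep_T_vE_zero, map_smul, gaussDiag_vE p hm, smul_comm]
  rcases eq_or_ne m n with rfl | hmn
  · obtain ⟨μ, hμ, -⟩ := exists_quotRep_T_vE_top hE hn hg h
    rw [hμ, map_smul, gaussDiag_vE p hm, smul_comm]
  have hm' := neg_mem hm hmn
  rcases lt_or_gt_of_ne hm0 with h0 | h0
  · obtain ⟨k, rfl⟩ : ∃ k : ℕ, m = -(k + 1) := ⟨(-m - 1).natAbs, by omega⟩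
    rw [neg_neg] at hm'
    rw [quotRep_T_vE_neg, map_add, map_smul, map_smul, gaussDiag_vE p hm, gaussDiag_vE p hm',
      gauss_neg, smul_add, smul_comm, smul_comm ((u : R) * _)]
  · obtain ⟨k, rfl⟩ : ∃ k : ℕ, m = k + 1 := ⟨(m - 1).natAbs, by omega⟩
    rw [quotRep_T_vE_pos, map_sub, map_smul, map_smul, gaussDiag_vE p hm, gaussDiag_vE p hm',
      gauss_neg, smul_sub, smul_comm, smul_comm (coefA r u _)]

theorem gaussDiag_quotPi (hg : IsGeneric n r) (h : u ^ 2 * r ^ n = -1) {p : Rˣ} (hp : p ^ 2 = r)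
    (v : VPrime (specE n) r) :
    gaussDiag p r u n (quotPi hE v) =
      (p : R) • quotRep r u _ hE (gen r u Gen.Y) (quotPi hE (gaussDiag p r u n v)) := by
  refine eBasis_ext (r := r) (u := u) (n := n)
    (φ := (gaussDiag p r u n).toLinearMap ∘ₗ quotPi hE)
    (ψ := (p : R) • (quotRep r u _ hE (gen r u Gen.Y) ∘ₗ quotPi hE ∘ₗ
      (gaussDiag p r u n).toLinearMap)) (fun m hm => ?_) v
  have hm' := one_sub_mem hm
  simp only [LinearMap.smul_apply, LinearMap.comp_apply, LinearEquiv.coe_coe]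
  rw [gaussDiag_vE p hm, map_smul, map_smul, quotPi_vE, map_smul, map_smul, gaussDiag_vE p hm',
    quotRep_Y_vE hE hg h hm', smul_smul, smul_smul, smul_smul, smul_smul]
  congr 1
  have h1 : (gauss p u (1 - m))⁻¹ = p * (gauss p u m)⁻¹ * eigenY r u (1 - m) := by
    have h2 := gauss_one_sub hp u (1 - m)
    rw [sub_sub_cancel, pt] at h2
    rw [inv_eq_iff_mul_eq_one, ← mul_assoc, ← mul_assoc, h2, mul_assoc (eigenY r u (1 - m))⁻¹,
      mul_inv_cancel, mul_one, inv_mul_cancel]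
  rw [h1]
  push_cast
  ring

/-- `X` has no simple formula in the basis of the `e_m`, whereas `Xπ`, `T` and `Y` do, so questions
about `X` are reduced to these three. -/
theorem quotRep_X_eq (v : VPrime (specE n) r) : quotRep r u _ hE (gen r u Gen.X) v =
    quotPi hE (quotRep r u _ hE (gen r u Gen.T) (quotRep r u _ hE (gen r u Gen.Yi) v)) := by
  obtain ⟨-, -, h3, -, -, h6, -⟩ := gen_rels r u
  rw [quotPi, ← Module.End.mul_apply, ← Module.End.mul_apply, ← map_mul, ← map_mul]
  congr 2
  have h7 : gen r u Gen.X * gen r u Gen.Y * gen r u Gen.Ti * (gen r u Gen.T * gen r u Gen.Yi) =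
      gen r u Gen.X * gen r u Gen.Y * (gen r u Gen.Ti * gen r u Gen.T) * gen r u Gen.Yi := by
    simp only [mul_assoc]
  rw [← mul_assoc] at h7
  rw [h7, h6, mul_one, mul_assoc, h3, mul_one]

theorem gaussDiag_intertwines [IsDomain R] (hn : 0 < n) (hg : IsGeneric n r)
    (h : u ^ 2 * r ^ n = -1) {p : Rˣ} (hp : p ^ 2 = r) (a : Daha r u) (v : VPrime (specE n) r) :
    gaussDiag p r u n (quotRep r u _ hE a v) =
      quotRep r u _ hE (tauMinus p r u hp a) (gaussDiag p r u n v) := by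
  refine intertwine_of_XYT (quotRep r u _ hE) ((quotRep r u _ hE).comp (tauMinus p r u hp))
    (gaussDiag p r u n).toLinearMap (fun v => ?_) (fun v => ?_) (fun v => ?_) a v
  · rw [AlgHom.comp_apply, tauMinus_gen, LinearEquiv.coe_coe]
    obtain ⟨-, -, h3, h4, -⟩ := gen_rels r u
    have hYi := intertwine_inv (by rw [← map_mul, h3, map_one]) (by rw [← map_mul, h4, map_one])
      (gaussDiag p r u n).toLinearMap (gaussDiag_Y hE hg h p)
      (Ai := quotRep r u _ hE (gen r u Gen.Yi)) (Bi := quotRep r u _ hE (gen r u Gen.Yi))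
    simp only [LinearEquiv.coe_coe] at hYi
    simp only [map_smul, map_mul, LinearMap.smul_apply, Module.End.mul_apply]
    rw [quotRep_X_eq, gaussDiag_quotPi hE hg h hp, gaussDiag_T hE hn hg h, hYi, ← quotRep_X_eq]
  · rw [AlgHom.comp_apply, tauMinus_gen, LinearEquiv.coe_coe]
    exact gaussDiag_Y hE hg h p v
  · rw [AlgHom.comp_apply, tauMinus_gen, LinearEquiv.coe_coe]
    exact gaussDiag_T hE hn hg h p v

end TauMinus

/-! ### The braid relation and uniqueness of the projective action -/

section Braid

variable {R : Type*} [CommRing R] [IsDomain R] {p r u : Rˣ} {n : ℕ}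
    (hE : IsStable r u (idealE (specE n) r))

/-- The two sides of the braid relation are proportional. -/
theorem exists_braid_scalar (hn : 0 < n) (hg : IsGeneric n r) (h : u ^ 2 * r ^ n = -1)
    (hp : p ^ 2 = r) (τp τm : VPrime (specE n) r ≃ₗ[R] VPrime (specE n) r)
    (hplus : ∀ a v, τp (quotRep r u _ hE a v) = quotRep r u _ hE (tauPlus p r u hp a) (τp v))
    (hminus : ∀ a v, τm (quotRep r u _ hE a v) = quotRep r u _ hE (tauMinus p r u hp a) (τm v)) :
    ∃ c : Rˣ, ∀ v, τm.symm (τp (τm.symm v)) = (c : R) • τp (τm.symm (τp v)) := by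
  obtain ⟨-, g2, -, g4, -⟩ := gen_rels r u
  let X := quotRep r u _ hE (gen r u Gen.X)
  let Xi := quotRep r u _ hE (gen r u Gen.Xi)
  let Y := quotRep r u _ hE (gen r u Gen.Y)
  let Yi := quotRep r u _ hE (gen r u Gen.Yi)
  have hXiX (v) : Xi (X v) = v := by
    rw [← Module.End.mul_apply, ← map_mul, g2, map_one, Module.End.one_apply]
  have hYiY (v) : Yi (Y v) = v := by
    rw [← Module.End.mul_apply, ← map_mul, g4, map_one, Module.End.one_apply]
  have pX (v) : τp (X v) = X (τp v) := by
    rw [hplus, tauPlus_gen]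
  have pY (v) : τp (Y v) = ((p⁻¹ : Rˣ) : R) • X (Y (τp v)) := by
    rw [hplus, tauPlus_gen]
    simp only [map_smul, map_mul, LinearMap.smul_apply, Module.End.mul_apply]
    rfl
  have pYi (v) : τp (Yi v) = (p : R) • Yi (Xi (τp v)) := by
    rw [hplus, tauPlus_gen]
    simp only [map_smul, map_mul, LinearMap.smul_apply, Module.End.mul_apply]
    rfl
  have mY (v) : τm.symm (Y v) = Y (τm.symm v) := by
    rw [LinearEquiv.symm_apply_eq, hminus, tauMinus_gen]
    simp only [LinearEquiv.apply_symm_apply]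
    rfl
  have mYi (v) : τm.symm (Yi v) = Yi (τm.symm v) := by
    rw [LinearEquiv.symm_apply_eq, hminus, tauMinus_gen]
    simp only [LinearEquiv.apply_symm_apply]
    rfl
  have mX (v) : τm.symm (X v) = ((p⁻¹ : Rˣ) : R) • Yi (X (τm.symm v)) := by
    have h1 : τm (X (τm.symm v)) = (p : R) • Y (X v) := by
      rw [hminus, tauMinus_gen]
      simp only [map_smul, map_mul, LinearMap.smul_apply, Module.End.mul_apply,
        LinearEquiv.apply_symm_apply]
      rfl
    rw [(LinearEquiv.eq_symm_apply _).mpr h1, map_smul, mY, map_smul, hYiY, smul_smul,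
      Units.inv_mul, one_smul]
  -- Conjugation by either side of the braid relation sends `X` to `Y⁻¹` and `Y` to `q^{-1/2}
  -- Y⁻¹XY`, so `A⁻¹B` commutes with `X` and `Y`.
  let A : VPrime (specE n) r ≃ₗ[R] VPrime (specE n) r := (τp.trans τm.symm).trans τp
  let B : VPrime (specE n) r ≃ₗ[R] VPrime (specE n) r := (τm.symm.trans τp).trans τm.symm
  have AX (v) : A (X v) = Yi (A v) := by
    change τp (τm.symm (τp (X v))) = Yi (τp (τm.symm (τp v)))
    rw [pX, mX, map_smul, pYi, pX, hXiX, smul_smul, Units.inv_mul, one_smul]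
  have BX (v) : B (X v) = Yi (B v) := by
    change τm.symm (τp (τm.symm (X v))) = Yi (τm.symm (τp (τm.symm v)))
    rw [mX, map_smul, pYi, pX, hXiX, smul_smul, Units.inv_mul, one_smul, mYi]
  have AY (v) : A (Y v) = (((p⁻¹ : Rˣ) : R) * ((p⁻¹ : Rˣ) : R)) • Yi (X (Y (A v))) := by
    change τp (τm.symm (τp (Y v))) = _ • Yi (X (Y (τp (τm.symm (τp v)))))
    rw [pY, map_smul, mX, mY, smul_smul, map_smul, pYi, pX, hXiX, pY, smul_smul, map_smul,
      smul_smul]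
    congr 1
    rw [mul_assoc, mul_assoc, Units.mul_inv, mul_one]
  have BY (v) : B (Y v) = (((p⁻¹ : Rˣ) : R) * ((p⁻¹ : Rˣ) : R)) • Yi (X (Y (B v))) := by
    change τm.symm (τp (τm.symm (Y v))) = _ • Yi (X (Y (τm.symm (τp (τm.symm v)))))
    rw [mY, pY, map_smul, mX, mY, smul_smul]
  obtain ⟨c, hc⟩ := exists_unit_of_commute hE hn hg h (B.trans A.symm)
    (fun v => by
      change A.symm (B (X v)) = X (A.symm (B v))
      rw [LinearEquiv.symm_apply_eq, AX, LinearEquiv.apply_symm_apply, BX])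
    (fun v => by
      change A.symm (B (Y v)) = Y (A.symm (B v))
      rw [LinearEquiv.symm_apply_eq, AY, LinearEquiv.apply_symm_apply, BY])
  refine ⟨c, fun v => ?_⟩
  have h1 : A.symm (B v) = (c : R) • v := hc v
  rw [LinearEquiv.symm_apply_eq, map_smul] at h1
  exact h1

/-- The left side of the braid relation is quadratic in `τ₊` and the right side linear, so
multiplying `τ₊` by the discrepancy `c` repairs the relation without affecting the conjugation
action. -/
theorem exists_isPSLAction (hn : 0 < n) (hg : IsGeneric n r) (h : u ^ 2 * r ^ n = -1)
    (hp : p ^ 2 = r) : ∃ τp τm, IsPSLAction hp (quotRep r u _ hE) τp τm := by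
  obtain ⟨c, hc⟩ := exists_braid_scalar hE hn hg h hp (gaussMul hg h p) (gaussDiag p r u n)
    (gaussMul_intertwines hE hn hg h hp) (gaussDiag_intertwines hE hn hg h hp)
  refine ⟨(gaussMul hg h p).trans (LinearEquiv.smulOfUnit c), gaussDiag p r u n, ⟨fun a v => ?_,
    gaussDiag_intertwines hE hn hg h hp, fun v => ?_⟩⟩
  · change (c : R) • gaussMul hg h p _ = quotRep r u _ hE _ ((c : R) • gaussMul hg h p v)
    rw [gaussMul_intertwines hE hn hg h hp, map_smul]
  · change (c : R) • gaussMul hg h p ((gaussDiag p r u n).symm ((c : R) • gaussMul hg h p v)) =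
      (gaussDiag p r u n).symm ((c : R) • gaussMul hg h p ((gaussDiag p r u n).symm v))
    rw [map_smul, map_smul, map_smul, hc]

theorem IsPSLAction.unique (hn : 0 < n) (hg : IsGeneric n r) (h : u ^ 2 * r ^ n = -1)
    (hp : p ^ 2 = r) {τp τm σp σm : VPrime (specE n) r ≃ₗ[R] VPrime (specE n) r}
    (hτ : IsPSLAction hp (quotRep r u _ hE) τp τm) (hσ : IsPSLAction hp (quotRep r u _ hE) σp σm) :
    ∃ c : Rˣ, (∀ v, σp v = (c : R) • τp v) ∧ ∀ v, σm v = ((c⁻¹ : Rˣ) : R) • τm v := by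
  obtain ⟨a, ha⟩ := exists_unit_of_commute hE hn hg h (σp.trans τp.symm)
    (fun v => by
      rw [LinearEquiv.trans_apply, LinearEquiv.symm_apply_eq, hτ.plus, LinearEquiv.trans_apply,
        LinearEquiv.apply_symm_apply, hσ.plus])
    (fun v => by
      rw [LinearEquiv.trans_apply, LinearEquiv.symm_apply_eq, hτ.plus, LinearEquiv.trans_apply,
        LinearEquiv.apply_symm_apply, hσ.plus])
  obtain ⟨b, hb⟩ := exists_unit_of_commute hE hn hg h (σm.trans τm.symm)
    (fun v => by
      rw [LinearEquiv.trans_apply, LinearEquiv.symm_apply_eq, hτ.minus, LinearEquiv.trans_apply,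
        LinearEquiv.apply_symm_apply, hσ.minus])
    (fun v => by
      rw [LinearEquiv.trans_apply, LinearEquiv.symm_apply_eq, hτ.minus, LinearEquiv.trans_apply,
        LinearEquiv.apply_symm_apply, hσ.minus])
  have ha' (v) : σp v = (a : R) • τp v := by
    rw [← map_smul, ← LinearEquiv.symm_apply_eq, ← LinearEquiv.trans_apply, ha]
  have hb' (v) : σm v = (b : R) • τm v := by
    rw [← map_smul, ← LinearEquiv.symm_apply_eq, ← LinearEquiv.trans_apply, hb]
  have hbs (v) : σm.symm v = ((b⁻¹ : Rˣ) : R) • τm.symm v := by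
    rw [LinearEquiv.symm_apply_eq, hb', map_smul, LinearEquiv.apply_symm_apply, smul_smul,
      Units.mul_inv, one_smul]
  -- Comparing the braid relations of the two actions gives `a² b⁻¹ = a b⁻²`.
  have hab : a * b = 1 := by
    let A : VPrime (specE n) r ≃ₗ[R] VPrime (specE n) r := (τp.trans τm.symm).trans τp
    have h1 := hσ.braid (A.symm (vE r u n 0))
    have h2 : τp (τm.symm (τp (A.symm (vE r u n 0)))) = vE r u n 0 :=
      A.apply_symm_apply (vE r u n 0)
    simp only [ha', hbs, map_smul, smul_smul] at h1
    rw [← hτ.braid, h2] at h1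
    have h3 := smul_vE_zero_injective hn h1
    have h4 : a * (b⁻¹ * a) = b⁻¹ * (a * b⁻¹) := Units.ext (by
      push_cast
      linear_combination h3)
    rw [mul_left_comm, mul_right_inj, mul_right_inj] at h4
    rw [h4, inv_mul_cancel]
  have hb2 : b = a⁻¹ := eq_inv_of_mul_eq_one_right hab
  exact ⟨a, ha', fun v => by rw [hb', hb2]⟩

end Braid

/-! ### The standard form -/

theorem adjoint_of_basis {ι R V : Type*} [CommRing R] [StarRing R] [AddCommGroup V] [Module R V]
    (b : Module.Basis ι R V) (B : V →ₗ[R] V →ₗ⋆[R] R) (φ ψ : Module.End R V)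
    (h : ∀ i j, B (φ (b i)) (b j) = B (b i) (ψ (b j))) (v w : V) :
    B (φ v) w = B v (ψ w) :=
  LinearMap.congr_fun (LinearMap.congr_fun
    (LinearMap.ext_basis (B := B ∘ₗ φ) (B' := B.compl₂ ψ) b b h) v) w

/-! ### Sesquilinear forms diagonal in a basis -/

section DiagonalForm

variable {ι R V : Type*} [Fintype ι] [CommRing R] [StarRing R] [AddCommGroup V]
  [Module R V]

/-- The sesquilinear form that is diagonal in a given basis. -/
def diagForm (b : Module.Basis ι R V) (c : ι → R) : V →ₗ[R] V →ₗ⋆[R] R :=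
  LinearMap.mk₂'ₛₗ (RingHom.id R) (starRingEnd R)
    (fun v w => ∑ m, c m * b.repr v m * star (b.repr w m))
    (fun v v' w => by
      rw [← Finset.sum_add_distrib]
      refine Finset.sum_congr rfl fun m _ => ?_
      rw [map_add, Finsupp.add_apply]
      ring)
    (fun a v w => by
      rw [RingHom.id_apply, smul_eq_mul, Finset.mul_sum]
      refine Finset.sum_congr rfl fun m _ => ?_
      rw [map_smul, Finsupp.smul_apply, smul_eq_mul]
      ring)
    (fun v w w' => by
      rw [← Finset.sum_add_distrib]
      refine Finset.sum_congr rfl fun m _ => ?_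
      rw [map_add, Finsupp.add_apply, star_add]
      ring)
    (fun a v w => by
      rw [smul_eq_mul, Finset.mul_sum]
      refine Finset.sum_congr rfl fun m _ => ?_
      rw [map_smul, Finsupp.smul_apply, smul_eq_mul, star_mul', starRingEnd_apply]
      ring)

theorem diagForm_apply (b : Module.Basis ι R V) (c : ι → R) (v w : V) :
    diagForm b c v w = ∑ m, c m * b.repr v m * star (b.repr w m) := rfl

theorem diagForm_basis [DecidableEq ι] (b : Module.Basis ι R V) (c : ι → R) (i j : ι) :
    diagForm b c (b i) (b j) = if i = j then c i else 0 := by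
  rw [diagForm_apply, Finset.sum_eq_single i]
  · rw [Module.Basis.repr_self, Module.Basis.repr_self, Finsupp.single_eq_same, mul_one,
      Finsupp.single_apply]
    by_cases hij : i = j
    · rw [if_pos hij, if_pos hij.symm, star_one, mul_one]
    · rw [if_neg hij, if_neg (Ne.symm hij), star_zero, mul_zero]
  · intro m _ hm
    rw [Module.Basis.repr_self, Finsupp.single_eq_of_ne hm, mul_zero, zero_mul]
  · exact fun h => absurd (Finset.mem_univ _) h

theorem eq_diagForm_iff [DecidableEq ι] (b : Module.Basis ι R V) (c : ι → R) (B : V →ₗ[R] V →ₗ⋆[R] R) :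
    B = diagForm b c ↔ ∀ i j, B (b i) (b j) = if i = j then c i else 0 := by
  refine ⟨?_, fun h => LinearMap.ext_basis b b fun i j => by rw [h, diagForm_basis]⟩
  rintro rfl
  exact diagForm_basis b c

theorem star_diagForm (b : Module.Basis ι R V) {c : ι → R} (hc : ∀ i, star (c i) = c i) (v w : V) :
    star (diagForm b c v w) = diagForm b c w v := by
  rw [diagForm_apply, diagForm_apply, star_sum]
  refine Finset.sum_congr rfl fun m _ => ?_
  rw [star_mul', star_mul', star_star, hc]
  ring

end DiagonalForm

/-! ### The norms and their behaviour under the involution -/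

section Norms

variable {R : Type*} [CommRing R]

/-- The norm of `e_m`. -/
def normC (r u : Rˣ) (m : ℤ) : R := normNum r u m * Ring.inverse (normDen r u m)

theorem isUnit_normDen {r u : Rˣ} {m : ℤ}
    (hD : ∀ j, 1 ≤ j → j < tildeAbs m → IsUnit (denomD r u j)) :
    IsUnit (normDen r u m : R) := by
  rw [normDen]
  refine Finset.prod_induction _ IsUnit (fun _ _ => IsUnit.mul) isUnit_one fun j hj => ?_
  rw [Finset.mem_Ico] at hj
  exact (hD j hj.1 hj.2).pow 2

theorem normC_mul {r u : Rˣ} {m : ℤ} (hD : ∀ j, 1 ≤ j → j < tildeAbs m → IsUnit (denomD r u j)) :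
    normC r u m * normDen r u m = normNum r u m := by
  rw [normC, mul_assoc, Ring.inverse_mul_cancel _ (isUnit_normDen hD), mul_one]

theorem eq_normC_iff {r u : Rˣ} {m : ℤ}
    (hD : ∀ j, 1 ≤ j → j < tildeAbs m → IsUnit (denomD r u j)) {x : R} :
    x * normDen r u m = normNum r u m ↔ x = normC r u m := by
  rw [← normC_mul hD]
  exact (isUnit_normDen hD).mul_left_inj

theorem tildeAbs_one_sub (m : ℤ) : tildeAbs (1 - m) = tildeAbs m := by
  unfold tildeAbs
  split_ifs <;> omega

theorem normC_one_sub (r u : Rˣ) (m : ℤ) : normC r u (1 - m) = normC r u m := by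
  rw [normC, normC, normNum, normDen, tildeAbs_one_sub]
  rfl

theorem normC_neg {r u : Rˣ} {k : ℕ} (hD : ∀ j, 1 ≤ j → j < k + 2 → IsUnit (denomD r u j)) :
    normC r u (-(k + 1)) = normRatio r u (k + 1) * normC r u (k + 1) := by
  have e : tildeAbs (-(k + 1)) = k + 2 := by
    have := tildeAbs_neg (k + 1)
    rwa [Nat.cast_add_one] at this
  have hD1 : ∀ j, 1 ≤ j → j < tildeAbs (-(k + 1)) → IsUnit (denomD r u j) := by rwa [e]
  have hD2 : ∀ j, 1 ≤ j → j < tildeAbs (k + 1) → IsUnit (denomD r u j) := by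
    rw [tildeAbs_pos]
    exact fun j h1 h2 => hD j h1 (by omega)
  rw [eq_comm, ← eq_normC_iff hD1]
  have h1 : normNum r u (-(k + 1)) = (normNum r u (k + 1) : R) *
      ((1 - (r : R) ^ (2 * (k + 1))) * (1 - (r : R) ^ (2 * (k + 1)) * (u : R) ^ 4)) := by
    rw [normNum, e, Finset.prod_Ico_succ_top (by omega), normNum, tildeAbs_pos]
  have h2 : normDen r u (-(k + 1)) = (normDen r u (k + 1) : R) * denomD r u (k + 1) ^ 2 := by
    rw [normDen, e, Finset.prod_Ico_succ_top (by omega), normDen, tildeAbs_pos, denomD]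
  rw [h1, h2, ← normRatio_mul (hD (k + 1) (by omega) (by omega)), ← normC_mul hD2]
  ring

theorem map_normC {S : Type*} [CommRing S] (φ : R →+* S) {r u : Rˣ} {m : ℤ}
    (hD : ∀ j, 1 ≤ j → j < tildeAbs m → IsUnit (denomD r u j)) :
    φ (normC r u m) = normC (mapU φ r) (mapU φ u) m := by
  rw [normC, map_mul, map_inverse_of_isUnit φ (isUnit_normDen hD), normC]
  simp [normNum, normDen, map_prod]

variable [StarRing R] {r u : Rˣ}

theorem star_denomD (hr : star (r : R) = ((r⁻¹ : Rˣ) : R)) (hu : star (u : R) = ((u⁻¹ : Rˣ) : R))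
    (k : ℕ) :
    star (denomD r u k) * ((r : R) ^ (2 * k) * (u : R) ^ 2) = -denomD r u k := by
  have h1 : ((r⁻¹ : Rˣ) : R) ^ (2 * k) * (r : R) ^ (2 * k) = 1 := by
    rw [← mul_pow, Units.inv_mul, one_pow]
  have h2 : ((u⁻¹ : Rˣ) : R) ^ 2 * (u : R) ^ 2 = 1 := by rw [← mul_pow, Units.inv_mul, one_pow]
  rw [denomD, star_sub, star_one, star_mul', star_pow, star_pow, hr, hu]
  linear_combination (-((u⁻¹ : Rˣ) : R) ^ 2 * (u : R) ^ 2) * h1 - h2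

/-- The involution inverts `q^k t` and changes the sign of `t^{1/2} - t^{-1/2}`; clearing
denominators with `star_denomD` leaves exactly this shift. -/
theorem star_coefA (hr : star (r : R) = ((r⁻¹ : Rˣ) : R)) (hu : star (u : R) = ((u⁻¹ : Rˣ) : R))
    {k : ℕ} (h : IsUnit (denomD r u k)) :
    star (coefA r u k) = coefA r u k + ((u : R) - ((u⁻¹ : Rˣ) : R)) := by
  have h1 := star_denomD hr hu k
  have h2 := congrArg star (coefA_mul h)
  have hu' : star (((u⁻¹ : Rˣ) : R)) = u := by rw [← hu, star_star]
  rw [star_mul', star_neg, star_sub, hu, hu'] at h2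
  have h3 := coefA_mul h
  rw [← h.mul_left_inj]
  have h4 : denomD r u k = 1 - (r : R) ^ (2 * k) * (u : R) ^ 2 := rfl
  generalize star (coefA r u k) = a' at *
  generalize coefA r u k = a at *
  generalize star (denomD r u k) = d' at *
  generalize denomD r u k = d at *
  linear_combination (-(r : R) ^ (2 * k) * (u : R) ^ 2) * h2 + a' * h1 - h3 -
    ((u : R) - ((u⁻¹ : Rˣ) : R)) * h4

/-- By `star_coefA` the ratio is `1 - a a*` with `a` the intertwiner coefficient, hence
self-conjugate. -/
theorem star_normRatio (hr : star (r : R) = ((r⁻¹ : Rˣ) : R)) (hu : star (u : R) = ((u⁻¹ : Rˣ) : R))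
    {k : ℕ} (h : IsUnit (denomD r u k)) :
    star (normRatio r u k) = normRatio r u k := by
  have hu' : star (((u⁻¹ : Rˣ) : R)) = u := by rw [← hu, star_star]
  rw [normRatio, star_sub, star_sub, star_one, star_mul', star_pow, star_sub, hu, hu',
    star_coefA hr hu h]
  ring

theorem star_normC (hr : star (r : R) = ((r⁻¹ : Rˣ) : R)) (hu : star (u : R) = ((u⁻¹ : Rˣ) : R))
    {m : ℤ} (hD : ∀ j, 1 ≤ j → j < tildeAbs m → IsUnit (denomD r u j)) :
    star (normC r u m) = normC r u m := by
  -- Under the involution numerator and denominator acquire the same factor, the inverse of `K = ∏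
  -- (q^j t)²`.
  obtain ⟨K, hK⟩ : ∃ K : R, K = ∏ j ∈ Finset.Ico 1 (tildeAbs m),
    ((r : R) ^ (2 * j) * (u : R) ^ 2) ^ 2 := ⟨_, rfl⟩
  have h1 : star (normNum r u m) * K = normNum r u m := by
    rw [hK, normNum, star_prod, ← Finset.prod_mul_distrib]
    refine Finset.prod_congr rfl fun j _ => ?_
    have h1 : ((r⁻¹ : Rˣ) : R) ^ (2 * j) * (r : R) ^ (2 * j) = 1 := by
      rw [← mul_pow, Units.inv_mul, one_pow]
    have h2 : ((u⁻¹ : Rˣ) : R) ^ 4 * (u : R) ^ 4 = 1 := by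
      rw [← mul_pow, Units.inv_mul, one_pow]
    rw [star_mul', star_sub, star_sub, star_one, star_mul', star_pow, star_pow, hr, hu]
    generalize (r : R) ^ (2 * j) = Q at *
    generalize ((r⁻¹ : Rˣ) : R) ^ (2 * j) = Q' at *
    generalize ((u⁻¹ : Rˣ) : R) ^ 4 = t' at *
    have h3 : ((u : R) ^ 2) ^ 2 = (u : R) ^ 4 := by ring
    rw [mul_pow, h3]
    generalize (u : R) ^ 4 = t at *
    have h4 : (1 - Q') * Q = Q - 1 := by linear_combination -h1
    have h5 : (1 - Q' * t') * (Q * t) = Q * t - 1 := by linear_combination -t' * t * h1 - h2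
    linear_combination (1 - Q' * t') * Q * t * h4 + (Q - 1) * h5
  have h2 : star (normDen r u m) * K = normDen r u m := by
    rw [hK, normDen, star_prod, ← Finset.prod_mul_distrib]
    refine Finset.prod_congr rfl fun j _ => ?_
    have h1 := star_denomD hr hu j
    rw [denomD] at h1
    rw [star_pow, ← mul_pow, h1, neg_sq]
  rw [← eq_normC_iff hD]
  have h3 := congrArg star (normC_mul hD)
  rw [star_mul'] at h3
  rw [← h1, ← h3, mul_assoc, h2]

end Norms

/-! ### Existence, uniqueness and invariance of the standard form -/

section StandardForm

variable {R : Type*} [CommRing R] [StarRing R] {r u : Rˣ} {n : ℕ}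

/-- The standard form of `V'`. -/
def stdForm (r u : Rˣ) (n : ℕ) : VPrime (specE n) r →ₗ[R] VPrime (specE n) r →ₗ⋆[R] R :=
  diagForm (eBasis r u n) fun m => normC r u m

/-- The polynomials `e_m` exist and are unique, and the denominators of their norms are units, so
the defining condition prescribes the values on a basis. -/
theorem isStdForm_iff [IsDomain R] (hg : IsGeneric n r) (h : u ^ 2 * r ^ n = -1)
    (B : VPrime (specE n) r →ₗ[R] VPrime (specE n) r →ₗ⋆[R] R) :
    IsStdForm r u n (idealE (specE n) r) B ↔ B = stdForm r u n := by
  rw [stdForm, eq_diagForm_iff]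
  have key (m m' : ℤ) (hm : m ∈ Set.Ioc (-(n : ℤ)) n) (x : R) :
      x * normDen r u m = (if m = m' then normNum r u m else 0) ↔
        x = if m = m' then normC r u m else 0 := by
    have hD := hg.isUnit_denomD_of_mem h hm
    split_ifs
    · exact eq_normC_iff hD
    · exact (isUnit_normDen hD).mul_left_eq_zero
  constructor
  · rintro hB ⟨m, hm⟩ ⟨m', hm'⟩
    rw [eBasis_apply, eBasis_apply]
    simp only [Subtype.mk.injEq]
    rw [← key m m' hm]
    exact hB m hm m' hm' _ _ (isEPoly_eMac (hg.isUnit_denomD_of_mem h hm))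
      (isEPoly_eMac (hg.isUnit_denomD_of_mem h hm'))
  · intro hB m hm m' hm' e e' he he'
    rw [he.unique (isEPoly_eMac (hg.isUnit_denomD_of_mem h hm)),
      he'.unique (isEPoly_eMac (hg.isUnit_denomD_of_mem h hm')), key m m' hm]
    have h1 := hB ⟨m, hm⟩ ⟨m', hm'⟩
    rw [eBasis_apply, eBasis_apply] at h1
    simp only [Subtype.mk.injEq] at h1
    exact h1

theorem existsUnique_isStdForm [IsDomain R] (hg : IsGeneric n r) (h : u ^ 2 * r ^ n = -1) :
    ∃! B, IsStdForm r u n (idealE (specE n) r) B := by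
  refine ⟨stdForm r u n, (isStdForm_iff hg h _).mpr rfl, fun B hB => (isStdForm_iff hg h B).mp hB⟩

theorem stdForm_vE {m m' : ℤ} (hm : m ∈ Set.Ioc (-(n : ℤ)) n) (hm' : m' ∈ Set.Ioc (-(n : ℤ)) n) :
    stdForm r u n (vE r u n m) (vE r u n m') = if m = m' then normC r u m else 0 := by
  have h1 := diagForm_basis (eBasis r u n) (fun m => normC r u m) ⟨m, hm⟩ ⟨m', hm'⟩
  rw [eBasis_apply, eBasis_apply] at h1
  simp only [Subtype.mk.injEq] at h1
  exact h1

theorem stdForm_adjoint {φ ψ : Module.End R (VPrime (specE n) r)}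
    (H : ∀ m ∈ Set.Ioc (-(n : ℤ)) n, ∀ m' ∈ Set.Ioc (-(n : ℤ)) n,
      stdForm r u n (φ (vE r u n m)) (vE r u n m') = stdForm r u n (vE r u n m) (ψ (vE r u n m')))
    (v w : VPrime (specE n) r) : stdForm r u n (φ v) w = stdForm r u n v (ψ w) :=
  adjoint_of_basis (eBasis r u n) _ φ ψ (fun i j => by
    rw [eBasis_apply, eBasis_apply]
    exact H i i.2 j j.2) v w

theorem star_stdForm (hg : IsGeneric n r) (h : u ^ 2 * r ^ n = -1)
    (hr : star (r : R) = ((r⁻¹ : Rˣ) : R)) (hu : star (u : R) = ((u⁻¹ : Rˣ) : R))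
    (v w : VPrime (specE n) r) : star (stdForm r u n v w) = stdForm r u n w v :=
  star_diagForm _ (fun m => star_normC hr hu (hg.isUnit_denomD_of_mem h m.2)) v w

variable (hE : IsStable r u (idealE (specE n) r))

/-- The matrix of `T` in the basis of the nonsymmetric Macdonald polynomials. -/
theorem exists_quotRep_T_vE [IsDomain R] (hn : 0 < n) (hg : IsGeneric n r) (h : u ^ 2 * r ^ n = -1)
    (hr : star (r : R) = ((r⁻¹ : Rˣ) : R)) (hu : star (u : R) = ((u⁻¹ : Rˣ) : R)) {m : ℤ}
    (hm : m ∈ Set.Ioc (-(n : ℤ)) n) :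
    ∃ α β : R, quotRep r u _ hE (gen r u Gen.T) (vE r u n m) =
        α • vE r u n m + β • vE r u n (-m) ∧ star α = α - ((u : R) - ((u⁻¹ : Rˣ) : R)) ∧
      (m = 0 ∨ m = n → β = 0) ∧ (0 < m → m ≠ n → β = ((u⁻¹ : Rˣ) : R)) ∧
      (m < 0 → star β * normC r u (-m) = ((u⁻¹ : Rˣ) : R) * normC r u m) := by
  have hu' : star (((u⁻¹ : Rˣ) : R)) = u := by rw [← hu, star_star]
  rcases eq_or_ne m 0 with rfl | hm0
  · refine ⟨u, 0, ?_, ?_, fun _ => rfl, fun h => absurd h (lt_irrefl _),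
      fun h => absurd h (lt_irrefl _)⟩
    · rw [quotRep_T_vE_zero, zero_smul, add_zero]
    · rw [hu]; ring
  rcases eq_or_ne m n with rfl | hmn
  · obtain ⟨μ, h1, h2⟩ := exists_quotRep_T_vE_top hE hn hg h
    refine ⟨μ, 0, ?_, ?_, fun _ => rfl, fun _ h => absurd rfl h, fun _ => by omega⟩
    · rw [h1, zero_smul, add_zero]
    · rcases h2 with rfl | rfl
      · rw [hu]; ring
      · rw [star_neg, hu']; ring
  have hm1 := hm
  rw [Set.mem_Ioc] at hm1
  rcases lt_or_gt_of_ne hm0 with h0 | h0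
  · obtain ⟨k, rfl⟩ : ∃ k : ℕ, m = -(k + 1) := ⟨(-m - 1).natAbs, by omega⟩
    have hD (j : ℕ) (h1 : 1 ≤ j) (h2 : j < k + 2) : IsUnit (denomD r u j) :=
      hg.isUnit_denomD h h1 (by omega)
    have hk := hD (k + 1) (by omega) (by omega)
    refine ⟨_, _, by rw [quotRep_T_vE_neg, neg_neg], ?_, fun h => by omega, fun h => by omega,
      fun _ => ?_⟩
    · rw [star_add, star_sub, hu, hu', star_coefA hr hu hk]
      ring
    · rw [normC_neg hD, star_mul', hu, star_normRatio hr hu hk, neg_neg]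
      ring
  · obtain ⟨k, rfl⟩ : ∃ k : ℕ, m = k + 1 := ⟨(m - 1).natAbs, by omega⟩
    have hk : IsUnit (denomD r u (k + 1)) := hg.isUnit_denomD h (by omega) (by omega)
    refine ⟨-coefA r u (k + 1), ((u⁻¹ : Rˣ) : R), ?_, ?_, fun h => by omega, fun _ _ => rfl,
      fun h => by omega⟩
    · rw [quotRep_T_vE_pos, neg_smul]
      abel
    · rw [star_neg, star_coefA hr hu hk]
      ring

/-- A check in the span of `e_m` and `e_{-m}`, with `T⁻¹ = T - (u - u⁻¹)`. Diagonal entries match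
because conjugation shifts them by `-(u - u⁻¹)`, off-diagonal ones because of the ratio of the
norms. -/
theorem stdForm_T [IsDomain R] (hn : 0 < n) (hg : IsGeneric n r) (h : u ^ 2 * r ^ n = -1)
    (hr : star (r : R) = ((r⁻¹ : Rˣ) : R)) (hu : star (u : R) = ((u⁻¹ : Rˣ) : R))
    (v w : VPrime (specE n) r) :
    stdForm r u n (quotRep r u _ hE (gen r u Gen.T) v) w =
      stdForm r u n v (quotRep r u _ hE (gen r u Gen.Ti) w) := by
  have hu' : star (((u⁻¹ : Rˣ) : R)) = u := by rw [← hu, star_star]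
  refine stdForm_adjoint (fun m hm m' hm' => ?_) v w
  obtain ⟨α, β, h1, h2, h3, h4, h5⟩ := exists_quotRep_T_vE hE hn hg h hr hu hm
  obtain ⟨α', β', h1', h2', h3', h4', h5'⟩ := exists_quotRep_T_vE hE hn hg h hr hu hm'
  rw [quotRep_Ti_eq, h1, h1']
  simp only [map_add, map_sub, LinearMap.add_apply, map_smul, LinearMap.smul_apply,
    LinearMap.map_smulₛₗ, starRingEnd_apply, hu, hu', stdForm_vE hm hm', smul_eq_mul, h2']
  have e1 : β * stdForm r u n (vE r u n (-m)) (vE r u n m') =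
      if -m = m' then β * normC r u m' else 0 := by
    by_cases hmn : m = n
    · rw [h3 (Or.inr hmn), zero_mul, zero_mul, ite_self]
    · rw [stdForm_vE (neg_mem hm hmn) hm', mul_ite, mul_zero]
      split_ifs with hh
      · rw [hh]
      · rfl
  have e2 : star β' * stdForm r u n (vE r u n m) (vE r u n (-m')) =
      if -m = m' then star β' * normC r u m else 0 := by
    by_cases hmn : m' = n
    · rw [h3' (Or.inr hmn), star_zero, zero_mul, zero_mul, ite_self]
    · rw [stdForm_vE hm (neg_mem hm' hmn), mul_ite, mul_zero]
      exact if_congr (by omega) rfl rfl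
  rw [e1, e2]
  -- The coefficients come from two separate existence statements; for equal indices they agree by
  -- comparing coordinates.
  have hdiag : m = m' → α = α' := by
    rintro rfl
    by_cases hm0 : m = 0
    · subst hm0
      rw [h3 (Or.inl rfl), zero_smul, add_zero] at h1
      rw [h3' (Or.inl rfl), zero_smul, add_zero, h1] at h1'
      exact smul_vE_zero_injective hn h1'
    by_cases hmn : m = n
    · rw [h3 (Or.inr hmn), zero_smul, add_zero] at h1
      rw [h3' (Or.inr hmn), zero_smul, add_zero, h1] at h1'
      have h6 := congrArg (fun v => (eBasis r u n).repr v ⟨m, hm⟩) h1'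
      have h7 : vE r u n m = eBasis r u n ⟨m, hm⟩ := (eBasis_apply r u n ⟨m, hm⟩).symm
      simpa [h7] using h6
    · have h6 := congrArg (fun v => (eBasis r u n).repr v ⟨m, hm⟩) (h1.symm.trans h1')
      have h7 : vE r u n m = eBasis r u n ⟨m, hm⟩ := (eBasis_apply r u n ⟨m, hm⟩).symm
      have h8 : vE r u n (-m) = eBasis r u n ⟨-m, neg_mem hm hmn⟩ :=
        (eBasis_apply r u n ⟨-m, neg_mem hm hmn⟩).symm
      have h9 : -m ≠ m := by omega
      simpa [h7, h8, Finsupp.single_apply, h9] using h6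
  -- The two signs of `m` are related by conjugation, since the norms are self-conjugate.
  have hoff : -m = m' → β * normC r u m' = star β' * normC r u m := by
    rintro rfl
    by_cases hm0 : m = 0
    · rw [h3 (Or.inl hm0), h3' (Or.inl (by omega)), star_zero, zero_mul, zero_mul]
    rw [Set.mem_Ioc] at hm hm'
    rcases lt_or_gt_of_ne hm0 with h0 | h0
    · rw [h4' (by omega) (by omega), hu']
      have h6 := congrArg star (h5 h0)
      rw [star_mul', star_mul', star_star, hu',
        star_normC hr hu (hg.isUnit_denomD_of_mem h (Set.mem_Ioc.mpr hm)),
        star_normC hr hu (hg.isUnit_denomD_of_mem h (Set.mem_Ioc.mpr hm'))] at h6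
      exact h6
    · rw [h4 h0 (by omega), ← h5' (by omega), neg_neg]
  split_ifs with i1 i2 i2
  · rw [hdiag i1, hoff i2]; ring
  · rw [hdiag i1]; ring
  · rw [hoff i2]; ring
  · ring

theorem star_eigenY (hr : star (r : R) = ((r⁻¹ : Rˣ) : R)) (hu : star (u : R) = ((u⁻¹ : Rˣ) : R))
    (m : ℤ) : star (eigenY r u m : R) = (((eigenY r u m)⁻¹ : Rˣ) : R) := by
  have h1 (k : ℕ) : star ((u * r ^ k : Rˣ) : R) = (((u * r ^ k)⁻¹ : Rˣ) : R) := by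
    rw [mul_inv, ← inv_pow, Units.val_mul, Units.val_mul, Units.val_pow_eq_pow_val,
      Units.val_pow_eq_pow_val, star_mul', star_pow, hr, hu]
  rcases int_cases_neg_pos m with ⟨k, rfl⟩ | ⟨k, rfl⟩
  · rw [eigenY_neg, h1]
  · rw [eigenY_pos, ← h1, star_star, inv_inv]

/-- The `e_m` are orthogonal eigenvectors whose eigenvalues are inverted by the involution. -/
theorem stdForm_Y (hg : IsGeneric n r) (h : u ^ 2 * r ^ n = -1)
    (hr : star (r : R) = ((r⁻¹ : Rˣ) : R)) (hu : star (u : R) = ((u⁻¹ : Rˣ) : R))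
    (v w : VPrime (specE n) r) :
    stdForm r u n (quotRep r u _ hE (gen r u Gen.Y) v) w =
      stdForm r u n v (quotRep r u _ hE (gen r u Gen.Yi) w) := by
  refine stdForm_adjoint (fun m hm m' hm' => ?_) v w
  have hYi : quotRep r u _ hE (gen r u Gen.Yi) (vE r u n m') =
      (((eigenY r u m')⁻¹ : Rˣ) : R) • vE r u n m' := by
    have h1 := congrArg (quotRep r u _ hE (gen r u Gen.Yi)) (quotRep_Y_vE hE hg h hm')
    rw [← Module.End.mul_apply, ← map_mul, (gen_rels r u).2.2.2.1, map_one, map_smul,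
      Module.End.one_apply] at h1
    conv_rhs => rw [h1]
    rw [smul_smul, Units.inv_mul, one_smul]
  rw [hYi, quotRep_Y_vE hE hg h hm, map_smul, LinearMap.smul_apply, LinearMap.map_smulₛₗ,
    stdForm_vE hm hm', starRingEnd_apply, ← star_eigenY hr hu, star_star]
  split_ifs with hh
  · rw [hh]
  · rw [smul_zero, smul_zero]

/-- `Xπ` sends `e_m` to `r^m e_{1-m}`, and `e_m`, `e_{1-m}` have the same norm. The factor `r` is
`r^m` divided by the conjugate of `r^{1-m}`. -/
theorem stdForm_quotPi (hr : star (r : R) = ((r⁻¹ : Rˣ) : R)) (v w : VPrime (specE n) r) :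
    stdForm r u n (quotPi hE v) w = ((r : Rˣ) : R) * stdForm r u n v (quotPi hE w) := by
  have hr1 : star ((r⁻¹ : Rˣ) : R) = r := by rw [← hr, star_star]
  have hrz (k : ℕ) : star ((r ^ k : Rˣ) : R) = (((r ^ k)⁻¹ : Rˣ) : R) := by
    rw [← inv_pow, Units.val_pow_eq_pow_val, Units.val_pow_eq_pow_val, star_pow, hr]
  have hrz' (m : ℤ) : star ((r ^ m : Rˣ) : R) = ((r ^ (-m) : Rˣ) : R) := by
    obtain ⟨k, rfl | rfl⟩ := m.eq_nat_or_neg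
    · rw [zpow_neg, zpow_natCast, hrz]
    · rw [neg_neg, zpow_neg, zpow_natCast, ← hrz, star_star]
  have h1 := stdForm_adjoint (u := u) (φ := quotPi hE) (ψ := ((r⁻¹ : Rˣ) : R) • quotPi hE)
    (fun m hm m' hm' => ?_) v w
  · rw [h1, LinearMap.smul_apply, LinearMap.map_smulₛₗ, starRingEnd_apply, hr1, smul_eq_mul]
  · rw [LinearMap.smul_apply, quotPi_vE, quotPi_vE, map_smul, LinearMap.smul_apply,
      LinearMap.map_smulₛₗ, LinearMap.map_smulₛₗ, stdForm_vE (one_sub_mem hm) hm',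
      stdForm_vE hm (one_sub_mem hm'), starRingEnd_apply, starRingEnd_apply, hr1, hrz',
      normC_one_sub]
    by_cases hh : 1 - m = m'
    · rw [if_pos hh, if_pos (by omega), smul_smul]
      congr 1
      rw [← hh, ← Units.val_mul, ← zpow_one_add]
      congr 2
      ring
    · rw [if_neg hh, if_neg (by omega), smul_zero, smul_zero, smul_zero]

theorem adjoint_inv {V : Type*} [AddCommGroup V] [Module R V] (B : V →ₗ[R] V →ₗ⋆[R] R)
    {A Ai : Module.End R V} (h1 : A * Ai = 1) (h2 : Ai * A = 1)
    (H : ∀ v w, B (A v) w = B v (Ai w)) (v w : V) : B (Ai v) w = B v (A w) := by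
  have h3 := H (Ai v) (A w)
  rw [← Module.End.mul_apply, ← Module.End.mul_apply, h1, h2] at h3
  exact h3.symm

/-- `X = (Xπ) T Y⁻¹`, and each of the three factors preserves the form; for `Xπ` this follows from
`(Xπ)² = r`. -/
theorem stdForm_X [IsDomain R] (hn : 0 < n) (hg : IsGeneric n r) (h : u ^ 2 * r ^ n = -1)
    (hr : star (r : R) = ((r⁻¹ : Rˣ) : R)) (hu : star (u : R) = ((u⁻¹ : Rˣ) : R))
    (v w : VPrime (specE n) r) :
    stdForm r u n (quotRep r u _ hE (gen r u Gen.X) v) w =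
      stdForm r u n v (quotRep r u _ hE (gen r u Gen.Xi) w) := by
  obtain ⟨h1, h2, h3, h4, h5, h6, -⟩ := gen_rels r u
  have hYi := adjoint_inv (stdForm r u n) (by rw [← map_mul, h3, map_one])
    (by rw [← map_mul, h4, map_one]) (stdForm_Y hE hg h hr hu)
    (Ai := quotRep r u _ hE (gen r u Gen.Yi))
  suffices H : ∀ v w, stdForm r u n (quotRep r u _ hE (gen r u Gen.X) v)
      (quotRep r u _ hE (gen r u Gen.X) w) = stdForm r u n v w by
    have h7 := H v (quotRep r u _ hE (gen r u Gen.Xi) w)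
    rwa [← Module.End.mul_apply (quotRep r u _ hE (gen r u Gen.X)), ← map_mul, h1, map_one,
      Module.End.one_apply] at h7
  intro v w
  have hPi (v w : VPrime (specE n) r) :
      stdForm r u n (quotPi hE v) (quotPi hE w) = stdForm r u n v w := by
    rw [stdForm_quotPi hE hr]
    obtain ⟨f, rfl⟩ := Ideal.Quotient.mk_surjective w
    rw [quotPi_mk, quotPi_mk, X_opPi_X_opPi, mk_C_mul, LinearMap.map_smulₛₗ, starRingEnd_apply, hr,
      smul_eq_mul, ← mul_assoc, Units.mul_inv, one_mul]
  have hT (v w : VPrime (specE n) r) : stdForm r u n (quotRep r u _ hE (gen r u Gen.T) v)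
      (quotRep r u _ hE (gen r u Gen.T) w) = stdForm r u n v w := by
    rw [stdForm_T hE hn hg h hr hu, ← Module.End.mul_apply (quotRep r u _ hE (gen r u Gen.Ti)),
      ← map_mul, h6, map_one, Module.End.one_apply]
  rw [quotRep_X_eq, quotRep_X_eq, hPi, hT, hYi,
    ← Module.End.mul_apply (quotRep r u _ hE (gen r u Gen.Y)), ← map_mul, h3, map_one,
    Module.End.one_apply]

end StandardForm

/-! ### Specialization of the standard form -/

section Specialization

variable {R S : Type*} [CommRing R] [CommRing S] [Algebra R S] {r u : Rˣ} {n : ℕ}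

theorem IsGeneric.map (hg : IsGeneric n r) : IsGeneric n (baseUnit S r) := by
  refine ⟨?_, fun j h1 h2 => ?_⟩
  · have h3 := hg.1.map (algebraMap R S)
    rwa [map_ofNat] at h3
  · have h3 := (hg.2 j h1 h2).map (algebraMap R S)
    rwa [map_sub, map_one, map_pow] at h3

theorem baseUnit_special (h : u ^ 2 * r ^ n = -1) : baseUnit S u ^ 2 * baseUnit S r ^ n = -1 := by
  have h1 := congrArg (fun x : Rˣ => algebraMap R S x) h
  simp only [Units.val_mul, Units.val_pow_eq_pow_val, Units.val_neg, Units.val_one, map_mul,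
    map_pow, map_neg, map_one] at h1
  exact Units.ext h1

theorem specMap_vE (hg : IsGeneric n r) (h : u ^ 2 * r ^ n = -1) {m : ℤ}
    (hm : m ∈ Set.Ioc (-(n : ℤ)) n) :
    specMap S (specE n) r (vE r u n m) = vE (baseUnit S r) (baseUnit S u) n m := by
  rw [vE, specMap_mk, mapL_eMac _ (hg.isUnit_denomD_of_mem h hm)]
  rfl

theorem repr_specMap (hg : IsGeneric n r) (h : u ^ 2 * r ^ n = -1) (v : VPrime (specE n) r)
    (m : Set.Ioc (-(n : ℤ)) n) :
    (eBasis (baseUnit S r) (baseUnit S u) n).repr (specMap S (specE n) r v) m =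
      algebraMap R S ((eBasis r u n).repr v m) := by
  conv_lhs => rw [← (eBasis r u n).sum_repr v, map_sum, map_sum]
  rw [Finsupp.finsetSum_apply, Finset.sum_eq_single m]
  · rw [map_smul, eBasis_apply, specMap_vE hg h m.2, ← eBasis_apply, algebra_compatible_smul S,
      map_smul, Module.Basis.repr_self, Finsupp.smul_apply, Finsupp.single_eq_same, smul_eq_mul,
      mul_one]
  · intro i _ hi
    rw [map_smul, eBasis_apply, specMap_vE hg h i.2, ← eBasis_apply, algebra_compatible_smul S,
      map_smul, Module.Basis.repr_self, Finsupp.smul_apply, Finsupp.single_eq_of_ne hi.symm,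
      smul_zero]
  · exact fun h => absurd (Finset.mem_univ _) h

theorem stdForm_specMap [StarRing R] [StarRing S] (hg : IsGeneric n r) (h : u ^ 2 * r ^ n = -1)
    (hs : ∀ a : R, algebraMap R S (star a) = star (algebraMap R S a)) (v w : VPrime (specE n) r) :
    stdForm (baseUnit S r) (baseUnit S u) n (specMap S (specE n) r v) (specMap S (specE n) r w) =
      algebraMap R S (stdForm r u n v w) := by
  rw [stdForm, stdForm, diagForm_apply, diagForm_apply, map_sum]
  refine Finset.sum_congr rfl fun m _ => ?_
  rw [map_mul, map_mul, hs, repr_specMap hg h, repr_specMap hg h,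
    map_normC _ (hg.isUnit_denomD_of_mem h m.2)]

end Specialization

/-! ### Roots of unity -/

section RootsOfUnity

theorem pow_half_eq_neg_one {R : Type*} [CommRing R] [IsDomain R] {r : Rˣ} {N : ℕ} (hN : 0 < N)
    (hr : IsPrimitiveRoot (r : R) (2 * N)) : r ^ N = -1 := by
  have h1 : IsPrimitiveRoot ((r : R) ^ N) 2 := hr.pow (by omega) (mul_comm _ _)
  exact Units.ext (by
    rw [Units.val_pow_eq_pow_val, h1.eq_neg_one_of_two_right, Units.val_neg, Units.val_one])

/-- `t qⁿᐟ² = r^{κ+n} = r^N`, which is `-1` because `r` is a primitive `2N`-th root of unity. -/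
theorem special_of_isPrimitiveRoot {R : Type*} [CommRing R] [IsDomain R] {r u : Rˣ} {N κ n : ℕ}
    (hn : 0 < n) (hN : n + κ = N) (hr : IsPrimitiveRoot (r : R) (2 * N)) (hu : u ^ 2 = r ^ κ) :
    u ^ 2 * r ^ n = -1 := by
  rw [hu, ← pow_add, add_comm, hN, pow_half_eq_neg_one (by omega) hr]

theorem sq_pow_ne_one {R : Type*} [CommRing R] {r : Rˣ} {N j : ℕ}
    (hr : IsPrimitiveRoot (r : R) (2 * N)) (h0 : 0 < j) (hj : j < N) : r ^ (2 * j) ≠ 1 := fun h =>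
  hr.pow_ne_one_of_pos_of_lt (l := 2 * j) (by omega) (by omega) (by
    rw [← Units.val_pow_eq_pow_val, h, Units.val_one])

theorem isEPoly_of_isPrimitiveRoot {R : Type*} [CommRing R] [IsDomain R] [CharZero R] {r u : Rˣ}
    {N κ n : ℕ} (hκ : 0 < κ) (hn : 0 < n) (hN : n + κ = N)
    (hr : IsPrimitiveRoot (r : R) (2 * N)) (hu : u ^ 2 = r ^ κ) :
    IsEPoly r u (-n) (evalCoeffs (specE n) r) := by
  rw [evalCoeffs_specE]
  exact isEPoly_polyE hn (special_of_isPrimitiveRoot hn hN hr hu) two_ne_zero fun j h1 h2 =>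
    sq_pow_ne_one hr h1 (by omega)

variable {K : Type*} [Field K] {r u : Kˣ} {N κ n : ℕ}

theorem isGeneric_of_isPrimitiveRoot [CharZero K] (hN : n + κ = N)
    (hr : IsPrimitiveRoot (r : K) (2 * N)) : IsGeneric n r := by
  refine ⟨isUnit_iff_ne_zero.mpr two_ne_zero, fun j h1 h2 => isUnit_iff_ne_zero.mpr ?_⟩
  intro h3
  exact sq_pow_ne_one hr h1 (by omega : j < N) (Units.ext (by
    rw [Units.val_pow_eq_pow_val, Units.val_one]
    exact (sub_eq_zero.mp h3).symm))

/-- At a maximal ideal above `J` the class `z` of `X` satisfies `z^{2N} = (-1)^κ = u^{2N}`. Hence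
`z/u` is a power of `r`, the residue point is defined over `K`, and no algebraic closure is needed.
-/
theorem exists_vanishes {J : Ideal K[T;T⁻¹]} (hJ : J ≠ ⊤) (hN : 0 < N)
    (hr : IsPrimitiveRoot (r : K) (2 * N)) (hu : u ^ 2 = r ^ κ)
    (hZ : (if Even κ then (T (2 * N) + T (-(2 * N)) - 2 : K[T;T⁻¹]) else T N + T (-N)) ∈ J) :
    ∃ j : ℕ, Vanishes J (u * r ^ j) := by
  obtain ⟨M, hM, hJM⟩ := Ideal.exists_le_maximal J hJ
  let L := K[T;T⁻¹] ⧸ M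
  let _ : Field L := Ideal.Quotient.field M
  let z : L := Ideal.Quotient.mk M (T 1)
  let ε : K →+* L := (Ideal.Quotient.mk M).comp C
  have hz (k : ℕ) : Ideal.Quotient.mk M (T k) = z ^ k := by
    rw [← map_pow, T_pow, mul_one]
  have hmem := hJM hZ
  have h1 : z ^ (2 * N) = (-1) ^ κ := by
    have e1 : (T N * T N : K[T;T⁻¹]) = T (2 * N : ℕ) := by
      rw [T_mul_T]; congr 1; push_cast; ring
    rw [← hz]
    split_ifs at hmem with hκ
    · rw [hκ.neg_one_pow]
      -- The relation is a unit times a square, and a maximal ideal is prime.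
      have h2 : ((T (2 * N : ℕ) - 1) ^ 2 : K[T;T⁻¹]) ∈ M := by
        have h3 : (T (2 * N) * T (-(2 * N)) : K[T;T⁻¹]) = 1 := by
          rw [T_mul_T, add_neg_cancel, T_zero]
        have h4 : ((T (2 * N : ℕ) - 1) ^ 2 : K[T;T⁻¹]) =
            T (2 * N) * (T (2 * N) + T (-(2 * N)) - 2) := by
          push_cast
          linear_combination -h3
        rw [h4]
        exact M.mul_mem_left _ hmem
      have h5 := hM.isPrime.mem_of_pow_mem 2 h2
      rw [← Ideal.Quotient.eq_zero_iff_mem, map_sub, map_one, sub_eq_zero] at h5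
      exact h5
    · rw [(Nat.not_even_iff_odd.mp hκ).neg_one_pow]
      have h2 : (T (2 * N : ℕ) + 1 : K[T;T⁻¹]) ∈ M := by
        have h3 : (T N * T (-N) : K[T;T⁻¹]) = 1 := by rw [T_mul_T, add_neg_cancel, T_zero]
        have h4 : (T (2 * N : ℕ) + 1 : K[T;T⁻¹]) = T N * (T N + T (-N)) := by
          linear_combination -h3 - e1
        rw [h4]
        exact M.mul_mem_left _ hmem
      rw [← Ideal.Quotient.eq_zero_iff_mem, map_add, map_one] at h2
      exact eq_neg_of_add_eq_zero_left h2
  have h2 : (ε u) ^ (2 * N) = (-1) ^ κ := by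
    have h3 : u ^ (2 * N) = (-1) ^ κ := by
      rw [pow_mul, hu, ← pow_mul, mul_comm, pow_mul, pow_half_eq_neg_one hN hr]
    rw [← map_pow, ← Units.val_pow_eq_pow_val, h3, Units.val_pow_eq_pow_val, Units.val_neg,
      Units.val_one, map_pow, map_neg, map_one]
  have hu0 : ε u ≠ 0 := by
    rw [Ne, map_eq_zero]
    exact u.ne_zero
  have : NeZero (2 * N) := ⟨by omega⟩
  obtain ⟨j, -, hj⟩ := (hr.map_of_injective ε.injective).eq_pow_of_pow_eq_one
    (ξ := z / ε u) (by rw [div_pow, h1, h2, div_self]; exact pow_ne_zero _ (by simp))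
  have hzj : z = ε ((u * r ^ j : Kˣ) : K) := by
    rw [eq_div_iff hu0] at hj
    rw [← hj]
    push_cast
    rw [map_mul, map_pow, mul_comm]
  refine ⟨j, fun f hf => ?_⟩
  have h3 (f : K[T;T⁻¹]) : Ideal.Quotient.mk M f = ε (evX (u * r ^ j) f) := by
    induction f using LaurentPolynomial.induction_on' with
    | add p q hp hq => rw [map_add, map_add, map_add, hp, hq]
    | C_mul_T m c =>
      rw [map_mul, map_mul, map_mul, evX_C, evX_T]
      congr 1
      obtain ⟨k, rfl | rfl⟩ := m.eq_nat_or_neg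
      · rw [hz, hzj, ← map_pow, zpow_natCast, Units.val_pow_eq_pow_val]
      · have h4 : z ^ k * Ideal.Quotient.mk M (T (-k)) = 1 := by
          rw [← hz, ← map_mul, T_mul_T, add_neg_cancel, T_zero, map_one]
        have h5 : z ^ k * ε (((u * r ^ j) ^ (-k : ℤ) : Kˣ) : K) = 1 := by
          rw [hzj, ← map_pow, ← map_mul, ← Units.val_pow_eq_pow_val, ← Units.val_mul, zpow_neg,
            zpow_natCast, mul_inv_cancel, Units.val_one, map_one]
        exact mul_left_cancel₀ (left_ne_zero_of_mul_eq_one h4) (h4.trans h5.symm)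
  have h4 := h3 f
  rw [Ideal.Quotient.eq_zero_iff_mem.mpr (hJM hf)] at h4
  exact (map_eq_zero ε).mp h4.symm

/-- Inversion followed by `π` moves a zero `x` to `r x`, unless `u²x² = 1`; in that case `x² = -rⁿ`
and `x` is already a root of the last factor of the special polynomial. Since `u²x² = r^{2(κ+j)}` at
`x = u r^j`, the walk is stopped at the latest when `N` divides `κ + j`, and `d` bounds the
remaining steps. -/
theorem exists_vanishes_polyE {J : Ideal K[T;T⁻¹]} (hJ : IsStable r u J) (hn : 0 < n)
    (hN : n + κ = N) (hr : IsPrimitiveRoot (r : K) (2 * N)) (hu : u ^ 2 = r ^ κ) (d : ℕ) :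
    ∀ j : ℕ, N ∣ κ + j + d → Vanishes J (u * r ^ j) →
      ∃ x : Kˣ, Vanishes J x ∧ evX x (polyE r n) = 0 := by
  have hend (j : ℕ) (h1 : u ^ 2 * (u * r ^ j) ^ 2 = 1) (hv : Vanishes J (u * r ^ j)) :
      ∃ x : Kˣ, Vanishes J x ∧ evX x (polyE r n) = 0 := by
    refine ⟨_, hv, evX_polyE_of_sq (i := n - 1) (by omega) ?_⟩
    have h2 := special_of_isPrimitiveRoot hn hN hr hu
    have e : (2 * ((n - 1 : ℕ) : ℤ) + 2 - n) = n := by omega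
    rw [e, zpow_natCast]
    have h3 : u ^ 2 * -r ^ n = 1 := by rw [mul_neg, h2, neg_neg]
    exact mul_left_cancel (h1.trans h3.symm)
  have hsq (j : ℕ) : u ^ 2 * (u * r ^ j) ^ 2 = r ^ (2 * (κ + j)) := by
    rw [mul_pow, hu, ← pow_mul, ← pow_add, ← pow_add]
    congr 1
    ring
  induction d with
  | zero =>
    intro j hd hv
    obtain ⟨c, hc⟩ := hd
    refine hend j ?_ hv
    rw [hsq, ← add_zero (κ + j), hc, mul_left_comm, pow_mul, pow_half_eq_neg_one (by omega) hr,
      pow_mul, neg_one_sq, one_pow]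
  | succ d ih =>
    intro j hd hv
    by_cases h1 : u ^ 2 * (u * r ^ j) ^ 2 = 1
    · exact hend j h1 hv
    · refine ih (j + 1) (by convert hd using 1; ring) ?_
      have h2 := (hv.inv hJ h1).opPi hJ
      rwa [inv_inv, mul_left_comm, ← pow_succ'] at h2

theorem isIrreducibleRep_iff_of_isPrimitiveRoot [CharZero K] (hn : 0 < n) (hN : n + κ = N)
    (hr : IsPrimitiveRoot (r : K) (2 * N)) (hu : u ^ 2 = r ^ κ) {J : Ideal K[T;T⁻¹]}
    (hJ : IsStable r u J)
    (hZ : (if Even κ then (T (2 * N) + T (-(2 * N)) - 2 : K[T;T⁻¹]) else T N + T (-N)) ∈ J) :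
    IsIrreducibleRep (quotRep r u J hJ) ↔ J = idealE (specE n) r := by
  have h := special_of_isPrimitiveRoot hn hN hr hu
  have hg := isGeneric_of_isPrimitiveRoot hN hr
  have hE : IsStable r u (idealE (specE n) r) := by
    rw [idealE_specE]
    exact isStable_polyE hn h
  constructor
  · intro hirr
    have hne : J ≠ ⊤ := Ideal.Quotient.nontrivial_iff.mp hirr.1
    obtain ⟨j, hj⟩ := exists_vanishes hne (by omega) hr hu hZ
    -- With this number of steps `κ + j + d = (κ + j) N`.
    obtain ⟨x, hx, hx'⟩ := exists_vanishes_polyE hJ hn hN hr hu ((κ + j) * (N - 1)) j (by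
      obtain ⟨m, rfl⟩ : ∃ m, N = m + 1 := ⟨N - 1, by omega⟩
      exact ⟨κ + j, by rw [Nat.add_sub_cancel]; ring⟩) hj
    have hle : idealE (specE n) r ⊔ J ≤ RingHom.ker (evX x : K[T;T⁻¹] →+* K) := by
      refine sup_le ?_ hx
      rw [idealE_specE, Ideal.span_singleton_le_iff_mem]
      exact hx'
    -- A common zero makes the sum proper, so irreducibility puts the special ideal inside `J`; that
    -- ideal admits no larger proper stable ideal.
    have hIJ : idealE (specE n) r ⊔ J ≠ ⊤ := fun h1 =>
      RingHom.ker_ne_top _ (top_le_iff.mp (h1 ▸ hle))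
    exact (eq_of_isStable hJ hg h (le_of_isIrreducibleRep hJ hirr hE hIJ)).resolve_right hne
  · rintro rfl
    exact isIrreducibleRep_specE hn hE h hg

end RootsOfUnity

/-! ### Positivity -/

section Positivity

theorem diagForm_self_pos {ι V : Type*} [Fintype ι] [AddCommGroup V] [Module ℂ V]
    (b : Module.Basis ι ℂ V) {c : ι → ℂ} {d : ι → ℝ} (hc : ∀ i, c i = d i) (hd : ∀ i, 0 < d i)
    {v : V} (hv : v ≠ 0) : 0 < (diagForm b c v v).re ∧ (diagForm b c v v).im = 0 := by
  have h1 : diagForm b c v v = ((∑ i, d i * Complex.normSq (b.repr v i) : ℝ) : ℂ) := by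
    rw [diagForm_apply, Complex.ofReal_sum]
    refine Finset.sum_congr rfl fun i _ => ?_
    rw [hc, mul_assoc, Complex.ofReal_mul, Complex.normSq_eq_conj_mul_self, mul_comm (b.repr v i)]
    rfl
  rw [h1, Complex.ofReal_re, Complex.ofReal_im]
  refine ⟨Finset.sum_pos' (fun i _ => mul_nonneg (hd i).le (Complex.normSq_nonneg _)) ?_, rfl⟩
  obtain ⟨i, hi⟩ : ∃ i, b.repr v i ≠ 0 := by
    by_contra! h
    exact hv ((LinearEquiv.map_eq_zero_iff b.repr).mp (Finsupp.ext h))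
  exact ⟨i, Finset.mem_univ _, mul_pos (hd i) (Complex.normSq_pos.mpr hi)⟩

/-- For `w = e^{ia}`, `y = e^{ib}` the half-sum is `cos (a - b)` and the two factors with `I` are
`sin a` and `sin b`. -/
theorem normRatio_aux {w y : ℂ} (hw : w ≠ 0) (hy : y ≠ 0) :
    (1 - w ^ 2) * (1 - (y ^ 2)⁻¹) * (1 + (w * y⁻¹ + w⁻¹ * y) / 2) =
      2 * ((w⁻¹ - w) * Complex.I / 2) * ((y⁻¹ - y) * Complex.I / 2) * (1 + w * y⁻¹) ^ 2 := by
  have h1 : (w⁻¹ - w) * Complex.I / 2 * ((y⁻¹ - y) * Complex.I / 2) =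
      -((w⁻¹ - w) * (y⁻¹ - y)) / 4 := by
    linear_combination ((w⁻¹ - w) * (y⁻¹ - y)) / 4 * Complex.I_sq
  rw [mul_assoc 2, h1]
  field_simp
  ring

/-- The factors of the norms are positive. -/
theorem exists_pos_factor {N n j : ℕ} {φ : ℝ} {r u : ℂˣ} (hN : n < N)
    (hφ : |φ| ≤ 2 * Real.pi / N) (hr : (r : ℂ) ^ 2 = Complex.exp (φ * Complex.I))
    (hrn : (r : ℂ) ^ n = Complex.exp (n * φ / 2 * Complex.I)) (h : u ^ 2 * r ^ n = -1)
    (hg : IsGeneric n r) (h1 : 0 < j) (h2 : j < n) :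
    ∃ x : ℝ, 0 < x ∧ (1 - (r : ℂ) ^ (2 * j)) * (1 - (r : ℂ) ^ (2 * j) * (u : ℂ) ^ 4) =
      x * (1 - (r : ℂ) ^ (2 * j) * (u : ℂ) ^ 2) ^ 2 := by
  -- The half-angles split `r^n = e^{ia} e^{ib}`, so that `q^j = w²`, `t = -(wy)⁻¹`, `q^j t = -w
  -- y⁻¹` and `q^j t² = y⁻²`.
  obtain ⟨a, ha⟩ : ∃ a : ℝ, a = j * φ / 2 := ⟨_, rfl⟩
  obtain ⟨b, hb⟩ : ∃ b : ℝ, b = (n - j : ℕ) * φ / 2 := ⟨_, rfl⟩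
  obtain ⟨w, hw⟩ : ∃ w : ℂ, w = Complex.exp (a * Complex.I) := ⟨_, rfl⟩
  obtain ⟨y, hy⟩ : ∃ y : ℂ, y = Complex.exp (b * Complex.I) := ⟨_, rfl⟩
  have hw0 : w ≠ 0 := hw ▸ Complex.exp_ne_zero _
  have hy0 : y ≠ 0 := hy ▸ Complex.exp_ne_zero _
  have hwi : w⁻¹ = Complex.exp (-a * Complex.I) := by rw [hw, ← Complex.exp_neg, neg_mul]
  have hyi : y⁻¹ = Complex.exp (-b * Complex.I) := by rw [hy, ← Complex.exp_neg, neg_mul]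
  have hq : (r : ℂ) ^ (2 * j) = w ^ 2 := by
    rw [pow_mul, hr, hw, ← Complex.exp_nat_mul, ← Complex.exp_nat_mul, ha]
    congr 1
    push_cast
    ring
  have hwy : (r : ℂ) ^ n = w * y := by
    rw [hrn, hw, hy, ← Complex.exp_add, ha, hb, Nat.cast_sub h2.le]
    congr 1
    push_cast
    ring
  have hu : (u : ℂ) ^ 2 = -(w * y)⁻¹ := by
    have h3 := congrArg (fun x : ℂˣ => (x : ℂ)) h
    simp only [Units.val_mul, Units.val_pow_eq_pow_val, Units.val_neg, Units.val_one] at h3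
    rw [hwy] at h3
    rw [← neg_inj, neg_neg]
    exact eq_inv_of_mul_eq_one_left (by rw [neg_mul, h3, neg_neg])
  have e1 : (r : ℂ) ^ (2 * j) * (u : ℂ) ^ 2 = -(w * y⁻¹) := by
    rw [hq, hu]
    field_simp
  have e2 : (r : ℂ) ^ (2 * j) * (u : ℂ) ^ 4 = (y ^ 2)⁻¹ := by
    rw [show (u : ℂ) ^ 4 = ((u : ℂ) ^ 2) ^ 2 by ring, hq, hu]
    field_simp
  have hsa : (Real.sin a : ℂ) = (w⁻¹ - w) * Complex.I / 2 := by
    rw [Complex.ofReal_sin, Complex.sin, hwi, hw]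
  have hsb : (Real.sin b : ℂ) = (y⁻¹ - y) * Complex.I / 2 := by
    rw [Complex.ofReal_sin, Complex.sin, hyi, hy]
  have hcos : (Real.cos (a - b) : ℂ) = (w * y⁻¹ + w⁻¹ * y) / 2 := by
    rw [Complex.ofReal_cos, Complex.cos, hwi, hyi, hw, hy, ← Complex.exp_add, ← Complex.exp_add]
    push_cast
    ring_nf
  have hD : (1 + w * y⁻¹) ≠ 0 := by
    have h3 := (hg.isUnit_denomD h h1 h2).ne_zero
    rwa [denomD, e1, sub_neg_eq_add] at h3
  -- Equality would make the denominator `1 - q^j t = 1 + w y⁻¹` vanish, against genericity.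
  have hc0 : 0 < 1 + Real.cos (a - b) := by
    refine lt_of_le_of_ne (by linarith [Real.neg_one_le_cos (a - b)]) fun h3 => ?_
    have h4 : (1 + w * y⁻¹) ^ 2 = 0 := by
      have h5 : (1 : ℂ) + (Real.cos (a - b) : ℂ) = 0 := by
        rw [← Complex.ofReal_one, ← Complex.ofReal_add, ← h3, Complex.ofReal_zero]
      rw [hcos] at h5
      have h6 : (1 + w * y⁻¹) ^ 2 = 2 * (w * y⁻¹) * (1 + (w * y⁻¹ + w⁻¹ * y) / 2) := by
        field_simp
        ring
      rw [h6, h5, mul_zero]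
    exact hD (pow_eq_zero_iff two_ne_zero |>.mp h4)
  -- Both angles have the sign of `φ`, and since `j` and `n - j` are less than `N` they lie strictly
  -- between `-π` and `π`. The value `φ = 0` is excluded by genericity, as `0 < j < n` forces `n >
  -- 1`.
  have hsin : 0 < Real.sin a * Real.sin b := by
    have hφ0 : φ ≠ 0 := by
      rintro rfl
      have h3 := (hg.2 1 one_pos (by omega)).ne_zero
      rw [mul_one, hr, Complex.ofReal_zero, zero_mul, Complex.exp_zero, sub_self] at h3
      exact h3 rfl
    have hNpos : (0 : ℝ) < N := Nat.cast_pos.mpr (by omega)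
    have hN' : |φ| * N ≤ 2 * Real.pi := (le_div_iff₀ hNpos).mp hφ
    have hlt {k : ℕ} (hk : k < N) : k * |φ| / 2 < Real.pi := by
      have h3 : (k : ℝ) < N := Nat.cast_lt.mpr hk
      have h4 := mul_lt_mul_of_pos_left h3 (abs_pos.mpr hφ0)
      linarith
    have hl1 := hlt (k := j) (by omega)
    have hl2 := hlt (k := n - j) (by omega)
    have hp1 : (0 : ℝ) < j := Nat.cast_pos.mpr h1
    have hp2 : (0 : ℝ) < (n - j : ℕ) := Nat.cast_pos.mpr (by omega)
    rcases lt_or_gt_of_ne hφ0 with h3 | h3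
    · rw [abs_of_neg h3] at hl1 hl2
      have h4 := mul_pos hp1 (neg_pos.mpr h3)
      have h5 := mul_pos hp2 (neg_pos.mpr h3)
      exact mul_pos_of_neg_of_neg
        (Real.sin_neg_of_neg_of_neg_pi_lt (by linarith) (by linarith))
        (Real.sin_neg_of_neg_of_neg_pi_lt (by linarith) (by linarith))
    · rw [abs_of_pos h3] at hl1 hl2
      have h4 := mul_pos hp1 h3
      have h5 := mul_pos hp2 h3
      exact mul_pos (Real.sin_pos_of_pos_of_lt_pi (by linarith) (by linarith))
        (Real.sin_pos_of_pos_of_lt_pi (by linarith) (by linarith))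
  refine ⟨2 * (Real.sin a * Real.sin b) / (1 + Real.cos (a - b)), by positivity, ?_⟩
  have hc1 : (1 : ℂ) + (Real.cos (a - b) : ℂ) ≠ 0 := by
    rw [← Complex.ofReal_one, ← Complex.ofReal_add]
    exact Complex.ofReal_ne_zero.mpr hc0.ne'
  rw [e1, e2, hq, sub_neg_eq_add, Complex.ofReal_div, Complex.ofReal_mul, Complex.ofReal_mul,
    Complex.ofReal_add, Complex.ofReal_one, div_mul_eq_mul_div, eq_div_iff hc1, hcos, hsa, hsb,
    normRatio_aux hw0 hy0, Complex.ofReal_ofNat]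
  ring

theorem stdForm_self_pos {N n : ℕ} {φ : ℝ} {r u : ℂˣ} (hN : n < N)
    (hφ : |φ| ≤ 2 * Real.pi / N) (hr : (r : ℂ) ^ 2 = Complex.exp (φ * Complex.I))
    (hrn : (r : ℂ) ^ n = Complex.exp (n * φ / 2 * Complex.I)) (h : u ^ 2 * r ^ n = -1)
    (hg : IsGeneric n r) {v : VPrime (specE n) r} (hv : v ≠ 0) :
    0 < (stdForm r u n v v).re ∧ (stdForm r u n v v).im = 0 := by
  have key (m : Set.Ioc (-(n : ℤ)) n) : ∃ d : ℝ, 0 < d ∧ normC r u m = (d : ℂ) := by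
    have h1 (j : ℕ) : ∃ x : ℝ, 0 < x ∧ (j ∈ Finset.Ico 1 (tildeAbs m) →
        (1 - (r : ℂ) ^ (2 * j)) * (1 - (r : ℂ) ^ (2 * j) * (u : ℂ) ^ 4) =
          x * (1 - (r : ℂ) ^ (2 * j) * (u : ℂ) ^ 2) ^ 2) := by
      by_cases hj : j ∈ Finset.Ico 1 (tildeAbs m)
      · have hle : tildeAbs m ≤ n := by
          have hm := m.2
          rw [Set.mem_Ioc] at hm
          rw [tildeAbs]
          split_ifs <;> omega
        rw [Finset.mem_Ico] at hj
        obtain ⟨x, hx, hx'⟩ := exists_pos_factor hN hφ hr hrn h hg (j := j) (by omega) (by omega)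
        exact ⟨x, hx, fun _ => hx'⟩
      -- The default value `1` keeps the chosen function positive at indices outside the product.
      · exact ⟨1, one_pos, fun h1 => absurd h1 hj⟩
    choose x hx hx' using h1
    refine ⟨∏ j ∈ Finset.Ico 1 (tildeAbs m), x j, Finset.prod_pos fun j _ => hx j, ?_⟩
    rw [eq_comm, ← eq_normC_iff (hg.isUnit_denomD_of_mem h m.2), normDen, normNum,
      Complex.ofReal_prod, ← Finset.prod_mul_distrib]
    exact Finset.prod_congr rfl fun j hj => (hx' j hj).symm
  choose d hd hd' using key
  exact diagForm_self_pos _ hd' hd hv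

end Positivity

end DahaA1

end

/-! ### The main theorem -/

theorem mainTheorem4 (N κ n : ℕ) (hκ : 0 < κ) (hn : 0 < n) (hN : n + κ = N) :
    -- `e_{-n}` at `t = -q^{-n/2}` has coefficients in `ℤ[q^{±1/2}]`
    (∃! E : ℤ[T;T⁻¹][T;T⁻¹], DahaA1.IsSpecialE n E) ∧
    ∀ E : ℤ[T;T⁻¹][T;T⁻¹], DahaA1.IsSpecialE n E →
    -- `V'` is defined for all nonzero `q`, and free of rank `2 n` over the ring of parameters
    (∀ (R : Type*) [CommRing R] (r u : Rˣ), u ^ 2 * r ^ n = -1 →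
      DahaA1.IsStable r u (DahaA1.idealE E r) ∧
      ∃ b : Module.Basis (Set.Ioc (-(n : ℤ)) n) R (DahaA1.VPrime E r),
        ∀ m, b m = Ideal.Quotient.mk _ (LaurentPolynomial.T m)) ∧
    -- the algebra `V'` and the action on it are compatible with specializations of the parameters,
    -- and so is the action of the projective `PSL₂(ℤ)`
    (∀ (R S : Type*) [CommRing R] [CommRing S] [Algebra R S] (r u : Rˣ)
      (hR : DahaA1.IsStable r u (DahaA1.idealE E r))
      (hS : DahaA1.IsStable (DahaA1.baseUnit S r) (DahaA1.baseUnit S u)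
        (DahaA1.idealE E (DahaA1.baseUnit S r))), u ^ 2 * r ^ n = -1 →
      IsBaseChange S (DahaA1.specMap S E r).toLinearMap ∧
      (∀ g v, DahaA1.specMap S E r (DahaA1.quotRep r u _ hR (DahaA1.gen r u g) v) =
        DahaA1.quotRep _ _ _ hS (DahaA1.gen _ _ g) (DahaA1.specMap S E r v)) ∧
      ∀ (p : Rˣ) (hp : p ^ 2 = r) (hp' : DahaA1.baseUnit S p ^ 2 = DahaA1.baseUnit S r)
        (τp τm : DahaA1.VPrime E r ≃ₗ[R] DahaA1.VPrime E r),
        DahaA1.IsPSLAction hp (DahaA1.quotRep r u _ hR) τp τm →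
        ∃ σp σm : DahaA1.VPrime E (DahaA1.baseUnit S r) ≃ₗ[S]
            DahaA1.VPrime E (DahaA1.baseUnit S r),
          DahaA1.IsPSLAction hp' (DahaA1.quotRep _ (DahaA1.baseUnit S u) _ hS) σp σm ∧
          (∀ v, DahaA1.specMap S E r (τp v) = σp (DahaA1.specMap S E r v)) ∧
          ∀ v, DahaA1.specMap S E r (τm v) = σm (DahaA1.specMap S E r v)) ∧
    -- for a primitive `2N`-th root of unity `q^{1/2}` and `t = q^k`, `k = κ / 2`, the module
    -- `V_{2N-4k}`, the quotient by `e_{-n}`, is isomorphic to `V'`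
    (∀ (R : Type*) [CommRing R] [IsDomain R] [CharZero R] (r u : Rˣ),
      IsPrimitiveRoot (r : R) (2 * N) → u ^ 2 = r ^ κ →
      u ^ 2 * r ^ n = -1 ∧
      ∃ hE : DahaA1.IsStable r u (DahaA1.idealE E r),
        (∃! f : R[T;T⁻¹], DahaA1.IsEPoly r u (-(n : ℤ)) f) ∧
        ∀ f : R[T;T⁻¹], DahaA1.IsEPoly r u (-(n : ℤ)) f →
          ∃ hf : DahaA1.IsStable r u (Ideal.span {f}),
            Module.finrank R (R[T;T⁻¹] ⧸ Ideal.span {f}) = 2 * N - 2 * κ ∧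
            ∃ Φ : (R[T;T⁻¹] ⧸ Ideal.span {f}) ≃ₐ[R] DahaA1.VPrime E r,
              (∀ g, Φ (Ideal.Quotient.mk _ g) = Ideal.Quotient.mk _ g) ∧
              ∀ h v, Φ (DahaA1.quotRep r u _ hf h v) = DahaA1.quotRep r u _ hE h (Φ v)) ∧
    -- over a field, it is the unique irreducible quotient of `V^{(-2)}_{4N}` (for integral `k`)
    -- or `V^{(2)}_{2N}` (for half-integral `k`), and its standard form is that of `V'`;
    -- the parameter `q` is generic in the sense of the assertions that follow
    (∀ (K : Type*) [Field K] [CharZero K] (r u : Kˣ),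
      IsPrimitiveRoot (r : K) (2 * N) → u ^ 2 = r ^ κ →
      DahaA1.IsGeneric n r ∧
      (∀ (J : Ideal K[T;T⁻¹]) (hJ : DahaA1.IsStable r u J),
        (if Even κ then
            (LaurentPolynomial.T (2 * N) + LaurentPolynomial.T (-(2 * N)) - 2 : K[T;T⁻¹])
          else LaurentPolynomial.T N + LaurentPolynomial.T (-N)) ∈ J →
        (DahaA1.IsIrreducibleRep (DahaA1.quotRep r u J hJ) ↔ J = DahaA1.idealE E r)) ∧
      ∀ [StarRing K] (f : K[T;T⁻¹]), DahaA1.IsEPoly r u (-(n : ℤ)) f →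
        (∃! B, DahaA1.IsStdForm r u n (Ideal.span {f}) B) ∧
        ∀ B B', DahaA1.IsStdForm r u n (Ideal.span {f}) B →
          DahaA1.IsStdForm r u n (DahaA1.idealE E r) B' →
          ∀ g h : K[T;T⁻¹], B (Ideal.Quotient.mk _ g) (Ideal.Quotient.mk _ h) =
            B' (Ideal.Quotient.mk _ g) (Ideal.Quotient.mk _ h)) ∧
    -- for generic `q`: `V'` is irreducible
    (∀ (K : Type*) [Field K] (r u : Kˣ) (hE : DahaA1.IsStable r u (DahaA1.idealE E r)),
      u ^ 2 * r ^ n = -1 → DahaA1.IsGeneric n r →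
      DahaA1.IsIrreducibleRep (DahaA1.quotRep r u _ hE)) ∧
    -- for generic `q`: the images of the `e_m` form a basis, `X` and `Y` are semisimple, and the
    -- projective `PSL₂(ℤ)` acts, in a way that is unique up to scalars
    (∀ (R : Type*) [CommRing R] [IsDomain R] (r u : Rˣ)
      (hE : DahaA1.IsStable r u (DahaA1.idealE E r)),
      u ^ 2 * r ^ n = -1 → DahaA1.IsGeneric n r →
      (∀ m ∈ Set.Ioc (-(n : ℤ)) n, ∃! f : R[T;T⁻¹], DahaA1.IsEPoly r u m f) ∧
      (∃ b : Module.Basis (Set.Ioc (-(n : ℤ)) n) R (DahaA1.VPrime E r),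
        ∀ (m : Set.Ioc (-(n : ℤ)) n) (f : R[T;T⁻¹]), DahaA1.IsEPoly r u m f →
          b m = Ideal.Quotient.mk _ f) ∧
      DahaA1.IsDiagonalizable (DahaA1.quotRep r u _ hE (DahaA1.gen r u DahaA1.Gen.X)) ∧
      DahaA1.IsDiagonalizable (DahaA1.quotRep r u _ hE (DahaA1.gen r u DahaA1.Gen.Y)) ∧
      ∀ (p : Rˣ) (hp : p ^ 2 = r),
        (∃ τp τm, DahaA1.IsPSLAction hp (DahaA1.quotRep r u _ hE) τp τm) ∧
        ∀ τp τm σp σm, DahaA1.IsPSLAction hp (DahaA1.quotRep r u _ hE) τp τm →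
          DahaA1.IsPSLAction hp (DahaA1.quotRep r u _ hE) σp σm →
          ∃ c : Rˣ, (∀ v, σp v = (c : R) • τp v) ∧ ∀ v, σm v = ((c⁻¹ : Rˣ) : R) • τm v) ∧
    -- for generic `q`: the standard form is Hermitian and invariant
    (∀ (R : Type*) [CommRing R] [IsDomain R] [StarRing R] (r u : Rˣ)
      (hE : DahaA1.IsStable r u (DahaA1.idealE E r)),
      u ^ 2 * r ^ n = -1 → DahaA1.IsGeneric n r →
      star (r : R) = ((r⁻¹ : Rˣ) : R) → star (u : R) = ((u⁻¹ : Rˣ) : R) →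
      (∃! B, DahaA1.IsStdForm r u n (DahaA1.idealE E r) B) ∧
      ∀ B, DahaA1.IsStdForm r u n (DahaA1.idealE E r) B →
        (∀ v w, star (B v w) = B w v) ∧
        ∀ v w,
          B (DahaA1.quotRep r u _ hE (DahaA1.gen r u DahaA1.Gen.X) v) w =
            B v (DahaA1.quotRep r u _ hE (DahaA1.gen r u DahaA1.Gen.Xi) w) ∧
          B (DahaA1.quotRep r u _ hE (DahaA1.gen r u DahaA1.Gen.Y) v) w =
            B v (DahaA1.quotRep r u _ hE (DahaA1.gen r u DahaA1.Gen.Yi) w) ∧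
          B (DahaA1.quotRep r u _ hE (DahaA1.gen r u DahaA1.Gen.T) v) w =
            B v (DahaA1.quotRep r u _ hE (DahaA1.gen r u DahaA1.Gen.Ti) w)) ∧
    -- and the standard form is compatible with specializations of the parameters
    (∀ (R S : Type*) [CommRing R] [IsDomain R] [StarRing R] [CommRing S] [IsDomain S] [StarRing S]
      [Algebra R S] (r u : Rˣ), u ^ 2 * r ^ n = -1 → DahaA1.IsGeneric n r →
      (∀ a : R, algebraMap R S (star a) = star (algebraMap R S a)) →
      ∀ B B', DahaA1.IsStdForm r u n (DahaA1.idealE E r) B →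
        DahaA1.IsStdForm (DahaA1.baseUnit S r) (DahaA1.baseUnit S u) n
          (DahaA1.idealE E (DahaA1.baseUnit S r)) B' →
        ∀ v w, B' (DahaA1.specMap S E r v) (DahaA1.specMap S E r w) = algebraMap R S (B v w)) ∧
    -- it is positive definite if `|q| = 1`, `|arg q| ≤ 2π/N` (and `q` is generic)
    (∀ (φ : ℝ) (r u : ℂˣ), |φ| ≤ 2 * Real.pi / N →
      (r : ℂ) ^ 2 = Complex.exp (φ * Complex.I) →
      (r : ℂ) ^ n = Complex.exp (n * φ / 2 * Complex.I) →
      u ^ 2 * r ^ n = -1 → DahaA1.IsGeneric n r →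
      ∃ B, DahaA1.IsStdForm r u n (DahaA1.idealE E r) B ∧
        ∀ v, v ≠ 0 → 0 < (B v v).re ∧ (B v v).im = 0) := by
  refine ⟨⟨DahaA1.specE n, DahaA1.isSpecialE_specE hn, fun E hE => hE.eq_specE hn⟩, ?_⟩
  intro E hE
  obtain rfl := hE.eq_specE hn
  refine ⟨?_, ?_, ?_, ?_, ?_, ?_, ?_, ?_, ?_⟩
  · intro R _ r u h
    refine ⟨?_, DahaA1.exists_monomial_basis r n⟩
    rw [DahaA1.idealE_specE]
    exact DahaA1.isStable_polyE hn h
  · intro R S _ _ _ r u hR hS _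
    have hbc := DahaA1.isBaseChange_specMap (S := S) r n
    exact ⟨hbc, DahaA1.specMap_gen hR hS, fun p hp hp' τp τm hτ =>
      hτ.specialize hR hS hp' hbc⟩
  · intro R _ _ _ r u hr hu
    have h := DahaA1.special_of_isPrimitiveRoot hn hN hr hu
    have hE' := DahaA1.isStable_polyE hn h
    rw [← DahaA1.idealE_specE] at hE'
    have hf := DahaA1.isEPoly_of_isPrimitiveRoot hκ hn hN hr hu
    refine ⟨h, hE', ⟨_, hf, fun g hg => hg.unique hf⟩, fun f hf' => ?_⟩
    -- Uniqueness of the specialization makes the two ideals equal, so the isomorphism is the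
    -- identity.
    obtain rfl := hf'.unique hf
    exact ⟨hE', (DahaA1.finrank_VPrime r n).trans (by omega), AlgEquiv.refl, fun g => rfl,
      fun a v => rfl⟩
  · intro K _ _ r u hr hu
    have h := DahaA1.special_of_isPrimitiveRoot hn hN hr hu
    have hg := DahaA1.isGeneric_of_isPrimitiveRoot hN hr
    refine ⟨hg, fun J hJ hZ => DahaA1.isIrreducibleRep_iff_of_isPrimitiveRoot hn hN hr hu hJ hZ, ?_⟩
    intro _ f hf
    obtain rfl := hf.unique (DahaA1.isEPoly_of_isPrimitiveRoot hκ hn hN hr hu)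
    refine ⟨DahaA1.existsUnique_isStdForm hg h, fun B B' hB hB' g g' => ?_⟩
    obtain rfl := (DahaA1.existsUnique_isStdForm hg h).unique hB hB'
    rfl
  · intro K _ r u hE' h hg
    exact DahaA1.isIrreducibleRep_specE hn hE' h hg
  · intro R _ _ r u hE' h hg
    refine ⟨fun m hm => ?_, ⟨DahaA1.eBasis r u n, fun m f hf => ?_⟩,
      DahaA1.isDiagonalizable_X hg h hE', DahaA1.isDiagonalizable_Y hE' hg h, fun p hp =>
      ⟨DahaA1.exists_isPSLAction hE' hn hg h hp, fun τp τm σp σm hτ hσ =>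
        DahaA1.IsPSLAction.unique hE' hn hg h hp hτ hσ⟩⟩
    · have hf := DahaA1.isEPoly_eMac (hg.isUnit_denomD_of_mem h hm)
      exact ⟨_, hf, fun g hg => hg.unique hf⟩
    · rw [hf.unique (DahaA1.isEPoly_eMac (hg.isUnit_denomD_of_mem h m.2))]
      exact DahaA1.eBasis_apply r u n m
  · intro R _ _ _ r u hE' h hg hr hu
    refine ⟨DahaA1.existsUnique_isStdForm hg h, fun B hB => ?_⟩
    obtain rfl := (DahaA1.isStdForm_iff hg h B).mp hB
    exact ⟨DahaA1.star_stdForm hg h hr hu, fun v w =>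
      ⟨DahaA1.stdForm_X hE' hn hg h hr hu v w, DahaA1.stdForm_Y hE' hg h hr hu v w,
        DahaA1.stdForm_T hE' hn hg h hr hu v w⟩⟩
  · intro R S _ _ _ _ _ _ _ r u h hg hs B B' hB hB' v w
    rw [(DahaA1.isStdForm_iff hg h B).mp hB,
      (DahaA1.isStdForm_iff hg.map (DahaA1.baseUnit_special h) B').mp hB']
    exact DahaA1.stdForm_specMap hg h hs v w
  · intro φ r u hφ hr hrn h hg
    exact ⟨DahaA1.stdForm r u n, (DahaA1.isStdForm_iff hg h _).mpr rfl, fun v hv =>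
      DahaA1.stdForm_self_pos (by omega) hφ hr hrn h hg hv⟩
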